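/- **Setting.** Let $d=2$ and let $\Omega\subset\mathbb R^2$ be a bounded polygonal domain with Lipschitz boundary. Let $\mathcal D\subset\Omega$ be finite and nonempty, $\{\mathbf y_t\}_{t\in\mathcal D}\subset\mathbb R^2$, $\lambda>0$, $\mathbf a,\mathbf b\in\mathbb R^2$ with $\mathbf a<\mathbf b$ componentwise, $\mathbb U_{ad}=\{\mathbf v\in\mathbf L^2(\Omega):\mathbf a\le\mathbf v\le\mathbf b \text{ a.e. in }\Omega\}$, and $\alpha\in(d-2,2)$. Let $d_{\mathcal D}$ be the smallest distance from a point of $\mathcal D$ to $\partial\Omega$ or to another point of $\mathcal D$. The weight $\rho$ is $\rho(x)=|x-t|^\alpha$ if $\mathcal D=\{t\}$; if $\#\mathcal D\ge 2$, then $\rho(x)=|x-t|^\alpha$ if $|x-t|<d_{\mathcal D}/2$ for some $t\in\mathcal D$, and $\rho(x)=1$ otherwise. For a weight $\omega$, $H^1_0(\omega,\Omega)$ is the closure of $C_0^\infty(\Omega)$ in the weighted space $H^1(\omega,\Omega)$. Put $a(\mathbf w,\mathbf v)=\int_\Omega\nabla\mathbf w:\nabla\mathbf v$ and $b(\mathbf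 v,q)=-\int_\Omega q\,\mathrm{div}\,\mathbf v$. **Optimality system.** Let $(\bar{\mathbf y},\bar p,\bar{\mathbf z},\bar r,\bar{\mathbf u})\in\mathbf H^1_0(\Omega)\times L^2(\Omega)/\mathbb R\times\mathbf H^1_0(\rho,\Omega)\times L^2(\rho,\Omega)/\mathbb R\times\mathbb U_{ad}$ satisfy - $a(\bar{\mathbf y},\mathbf v)+b(\mathbf v,\bar p)=(\bar{\mathbf u},\mathbf v)_{\mathbf L^2(\Omega)}$ for all $\mathbf v\in\mathbf H^1_0(\Omega)$ and $b(\bar{\mathbf y},q)=0$ for all $q\in L^2(\Omega)/\mathbb R$; - $a(\mathbf w,\bar{\mathbf z})-b(\mathbf w,\bar r)=\sum_{t\in\mathcal D}\langle(\bar{\mathbf y}(t)-\mathbf y_t)\delta_t,\mathbf w\rangle$ for all $\mathbf w\in\mathbf H^1_0(\rho^{-1},\Omega)$ and $b(\bar{\mathbf z},s)=0$ for all $s\in L^2(\rho^{-1},\Omega)/\mathbb R$, where $\delta_t$ denotes the continuous extension to $H_0^1(\rho^{-1},\Omega)$ of the evaluation at $t$; - $(\bar{\mathbf z}+\lambda\bar{\mathbf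 u},\mathbf u-\bar{\mathbf u})_{\mathbf L^2(\Omega)}\ge 0$ for all $\mathbf u\in\mathbb U_{ad}$. **Discretization.** Let $\mathscr T$ be a conforming partition of $\bar\Omega$ into triangles, $h_T=\mathrm{diam}(T)$, with shape regularity constant $\sigma$: each $T\in\mathscr T$ contains a ball of some radius $r_T>0$ with $h_T\le\sigma r_T$. Let $Q(\mathscr T)$ be the space of continuous functions on $\bar\Omega$ that are affine on each $T$, modulo constants; let $\mathbf U(\mathscr T)$ be the space of continuous vector fields on $\bar\Omega$ that are polynomials of degree at most $2$ on each $T$, $\mathbf V(\mathscr T)=\mathbf U(\mathscr T)\cap\mathbf H^1_0(\Omega)$ and $\mathbb U_{ad}(\mathscr T)=\mathbf U(\mathscr T)\cap\mathbb U_{ad}$. Let $(\bar{\mathbf y}_{\mathscr T},\bar p_{\mathscr T},\bar{\mathbf z}_{\mathscr T},\bar r_{\mathscr T},\bar{\mathbf u}_{\mathscr T})\in\mathbf V(\mathscr T)\times Q(\mathscr T)\times\mathbf V(\mathscr T)\times Q(\mathscr T)\times\mathbb U_{ad}(\mathscr T)$ solve the discrete optimality system, namely the same system with $\mathbf V(\mathscr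 T)$, $Q(\mathscr T)$, $\mathbb U_{ad}(\mathscr T)$ as trial and test spaces and with right-hand side $\sum_{t\in\mathcal D}(\bar{\mathbf y}_{\mathscr T}(t)-\mathbf y_t)\cdot\mathbf w_{\mathscr T}(t)$ in the adjoint equation. **Indicator.** For $T\in\mathscr T$ let $\mathcal N_T$ be the union of $T$ and all elements that share an internal side with $T$, and $$\mathcal E_{st,T}=h_T^2\|\bar{\mathbf u}_{\mathscr T}+\Delta\bar{\mathbf y}_{\mathscr T}-\nabla\bar p_{\mathscr T}\|_{\mathbf L^\infty(T)}+\tfrac{h_T}{2}\|[\![\nabla\bar{\mathbf y}_{\mathscr T}\cdot\boldsymbol\nu]\!]\|_{\mathbf L^\infty(\partial T\setminus\partial\Omega)}+h_T\|\mathrm{div}\,\bar{\mathbf y}_{\mathscr T}\|_{L^\infty(T)},$$ where $[\![\nabla\bar{\mathbf y}_{\mathscr T}\cdot\boldsymbol\nu]\!]=\nabla\bar{\mathbf y}_{\mathscr T}|_{T^+}\cdot\boldsymbol\nu^++\nabla\bar{\mathbf y}_{\mathscr T}|_{T^-}\cdot\boldsymbol\nu^-$ on the common side of $T^+$ and $T^-$,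 with $\boldsymbol\nu^\pm$ the unit normal pointing towards $T^\pm$. **Theorem (local efficiency of $\mathcal E_{st}$).** Let $\mathbf e_{\mathbf y}=\bar{\mathbf y}-\bar{\mathbf y}_{\mathscr T}$, $e_p=\bar p-\bar p_{\mathscr T}$ and $\mathbf e_{\mathbf u}=\bar{\mathbf u}-\bar{\mathbf u}_{\mathscr T}$, for any choice of representatives of the pressures modulo constants. There is a constant $C>0$, depending only on $\sigma$ (in particular not on the continuous and discrete solutions, the sizes of the elements or $\#\mathscr T$), such that for every $T\in\mathscr T$ $$\mathcal E_{st,T}\le C\Big(\|\mathbf e_{\mathbf y}\|_{\mathbf L^\infty(\mathcal N_T)}+h_T^{1-\frac d2}\|e_p\|_{L^2(\mathcal N_T)}+h_T^{2-\frac d2}\|\mathbf e_{\mathbf u}\|_{\mathbf L^2(\mathcal N_T)}\Big),\qquad d=2.$$ -/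

import Mathlib

open MeasureTheory Filter Topology
open scoped ENNReal NNReal ContDiff

noncomputable section

namespace StokesTracking

/-- Points of `ℝ^d`, with the Euclidean norm. -/
abbrev Pt (d : ℕ) := EuclideanSpace ℝ (Fin d)

/-! ### Domains -/

/-- Near each boundary point, `Ω` is the region strictly above the graph of a Lipschitz function,
in the direction of some unit vector `e`; `x - ⟪e, x⟫ e` is the projection of `x` onto the
hyperplane orthogonal to `e`. -/
def HasLipschitzBoundary {d : ℕ} (Ω : Set (Pt d)) : Prop :=
  ∀ x₀ ∈ frontier Ω, ∃ (e : Pt d) (γ : Pt d → ℝ) (L : ℝ≥0) (r : ℝ),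
    ‖e‖ = 1 ∧ LipschitzWith L γ ∧ 0 < r ∧
      ∀ x ∈ Metric.ball x₀ r, x ∈ Ω ↔ γ (x - inner ℝ e x • e) < inner ℝ e x

/-- A bounded Lipschitz domain (open and connected). -/
structure IsLipschitzDomain {d : ℕ} (Ω : Set (Pt d)) : Prop where
  isOpen : IsOpen Ω
  isConnected : IsConnected Ω
  isBounded : Bornology.IsBounded Ω
  lipschitz : HasLipschitzBoundary Ω

/-! ### Weighted Lebesgue and Sobolev spaces

Elements of the spaces are represented by functions on `ℝ^d`, of which only the values almost
everywhere in `Ω` matter. -/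

/-- The measure `κ dx` on `Ω`. The `L²(κ, Ω)`-norm of `v` is
`eLpNorm v 2 (weightedMeasure κ Ω)`. -/
def weightedMeasure {d : ℕ} (κ : Pt d → ℝ) (Ω : Set (Pt d)) : Measure (Pt d) :=
  (volume.restrict Ω).withDensity fun x => ENNReal.ofReal (κ x)

/-- `φ ∈ C_0^∞(Ω)`. -/
structure IsTestFunction {d : ℕ} (Ω : Set (Pt d)) (φ : Pt d → ℝ) : Prop where
  contDiff : ContDiff ℝ ∞ φ
  hasCompactSupport : HasCompactSupport φ
  tsupport_subset : tsupport φ ⊆ Ω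

/-- `g` is the weak gradient of `v` in `Ω`. -/
structure HasWeakGradient {d : ℕ} (Ω : Set (Pt d)) (v : Pt d → ℝ) (g : Pt d → Pt d) : Prop where
  locallyIntegrable : LocallyIntegrableOn v Ω
  locallyIntegrable_grad : LocallyIntegrableOn g Ω
  integral_eq : ∀ φ : Pt d → ℝ, IsTestFunction Ω φ →
    ∫ x in Ω, v x • gradient φ x = - ∫ x in Ω, φ x • g x

/-- The functions `φ n ∈ C_0^∞(Ω)` converge in `H¹(κ, Ω)` to `v`, whose weak gradient is `g`. -/
structure ApproximatesH10 {d : ℕ} (κ : Pt d → ℝ) (Ω : Set (Pt d)) (φ : ℕ → Pt d → ℝ)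
    (v : Pt d → ℝ) (g : Pt d → Pt d) : Prop where
  test : ∀ n, IsTestFunction Ω (φ n)
  tendsto : Tendsto (fun n => eLpNorm (fun x => φ n x - v x) 2 (weightedMeasure κ Ω)) atTop (𝓝 0)
  tendsto_grad : Tendsto
    (fun n => eLpNorm (fun x => gradient (φ n) x - g x) 2 (weightedMeasure κ Ω)) atTop (𝓝 0)

/-- `v ∈ H_0^1(κ, Ω)`, the closure of `C_0^∞(Ω)` in `H¹(κ, Ω)`, with weak gradient `g`. -/
structure MemH10 {d : ℕ} (κ : Pt d → ℝ) (Ω : Set (Pt d)) (v : Pt d → ℝ) (g : Pt d → Pt d) :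
    Prop where
  memLp : MemLp v 2 (weightedMeasure κ Ω)
  memLp_grad : MemLp g 2 (weightedMeasure κ Ω)
  weakGradient : HasWeakGradient Ω v g
  closure : ∃ φ : ℕ → Pt d → ℝ, ApproximatesH10 κ Ω φ v g

/-- `v ∈ [H_0^1(κ, Ω)]^d`, where `Dv i` is the weak gradient of the `i`-th component of `v`. -/
def MemVecH10 {d : ℕ} (κ : Pt d → ℝ) (Ω : Set (Pt d)) (v : Pt d → Pt d)
    (Dv : Fin d → Pt d → Pt d) : Prop :=
  ∀ i, MemH10 κ Ω (fun x => v x i) (Dv i)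

/-- The weight of the unweighted spaces. -/
def one {d : ℕ} : Pt d → ℝ := fun _ => 1

/-- `a(w, v) = ∫_Ω ∇w : ∇v`, as a function of the gradients of `w` and `v`. -/
def aForm {d : ℕ} (Ω : Set (Pt d)) (Dw Dv : Fin d → Pt d → Pt d) : ℝ :=
  ∫ x in Ω, ∑ i, inner ℝ (Dw i x) (Dv i x)

/-- `b(v, q) = - ∫_Ω q div v`, as a function of the gradient of `v` and of `q`. It does not
change when a constant is added to `q`, if `v` vanishes on the boundary. -/
def bForm {d : ℕ} (Ω : Set (Pt d)) (Dv : Fin d → Pt d → Pt d) (q : Pt d → ℝ) : ℝ :=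
  - ∫ x in Ω, q x * ∑ i, Dv i x i

/-! ### The pointwise tracking optimal control problem -/

/-- The data of the optimal control problem: the domain `Ω`, the observation points `𝒟`, the
desired states `target t` for `t ∈ 𝒟`, the regularization parameter `lam`, the control bounds
and the exponent `α` of the weight. -/
structure TrackingProblem (d : ℕ) where
  Ω : Set (Pt d)
  domain : IsLipschitzDomain Ω
  𝒟 : Finset (Pt d)
  nonempty : 𝒟.Nonempty
  subset : (𝒟 : Set (Pt d)) ⊆ Ω
  target : Pt d → Pt d
  lam : ℝ
  lam_pos : 0 < lam
  lower : Pt d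
  upper : Pt d
  lower_lt_upper : ∀ i, lower i < upper i
  α : ℝ
  lt_α : (d : ℝ) - 2 < α
  α_lt : α < 2

namespace TrackingProblem

/-- `d_𝒟`, the smallest distance from a point of `𝒟` to `∂Ω` or to another point of `𝒟`. -/
def separation {d : ℕ} (P : TrackingProblem d) : ℝ :=
  sInf ({s | ∃ t ∈ P.𝒟, ∃ x ∈ frontier P.Ω, s = dist t x} ∪
    {s | ∃ t ∈ P.𝒟, ∃ t' ∈ P.𝒟, t ≠ t' ∧ s = dist t t'})

open Classical in
/-- The weight `ρ`: if `𝒟 = {t}`, it is `|x - t|^α` everywhere; otherwise it is `|x - t|^α` in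
the ball of radius `d_𝒟 / 2` around each `t ∈ 𝒟` and `1` outside these balls. They are disjoint,
so that inside them `infDist x 𝒟` is the distance of `x` to the centre. -/
def weight {d : ℕ} (P : TrackingProblem d) (x : Pt d) : ℝ :=
  if P.𝒟.card = 1 ∨ Metric.infDist x (P.𝒟 : Set (Pt d)) < P.separation / 2 then
    Metric.infDist x (P.𝒟 : Set (Pt d)) ^ P.α
  else 1

/-- The admissible set `𝕌_ad`. -/
structure IsAdmissible {d : ℕ} (P : TrackingProblem d) (u : Pt d → Pt d) : Prop where
  memLp : MemLp u 2 (volume.restrict P.Ω)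
  bounds : ∀ᵐ x ∂(volume.restrict P.Ω), ∀ i, P.lower i ≤ u x i ∧ u x i ≤ P.upper i

/-- The weak state equations: `y ∈ H_0^1(Ω)^d`, `p` represents an element of `L²(Ω)/ℝ`, and
`(y, p)` solves the Stokes equations with right-hand side `u`. -/
def IsState {d : ℕ} (P : TrackingProblem d) (y : Pt d → Pt d) (p : Pt d → ℝ)
    (u : Pt d → Pt d) : Prop :=
  MemLp p 2 (volume.restrict P.Ω) ∧ ∃ Dy, MemVecH10 one P.Ω y Dy ∧
    (∀ v Dv, MemVecH10 one P.Ω v Dv →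
      aForm P.Ω Dy Dv + bForm P.Ω Dv p = ∫ x in P.Ω, inner ℝ (u x) (v x)) ∧
    ∀ q : Pt d → ℝ, MemLp q 2 (volume.restrict P.Ω) → bForm P.Ω Dy q = 0

/-- The point value at `t` of a locally integrable function, as the limit of its averages over
small balls: the value of the continuous representative whenever there is one near `t`. -/
def pointValue {d : ℕ} (y : Pt d → Pt d) (t : Pt d) : Pt d :=
  limUnder (𝓝[>] (0 : ℝ)) fun r => ⨍ x in Metric.ball t r, y x

/-- The weak adjoint equations: `z ∈ H_0^1(ρ, Ω)^d`, `r` represents an element of `L²(ρ, Ω)/ℝ`, and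
`a(w, z) - b(w, r) = ∑_t ⟨(y(t) - y_t) δ_t, w⟩` for all `w ∈ H_0^1(ρ⁻¹, Ω)^d`,
`b(z, s) = 0` for all `s ∈ L²(ρ⁻¹, Ω)`. The pairing of `δ_t` with `w` is the continuous extension of
the evaluation at `t`, that is, the limit of `φ n t` for test functions `φ n` that converge to `w`
in `H¹(ρ⁻¹, Ω)`. -/
def IsAdjoint {d : ℕ} (P : TrackingProblem d) (z : Pt d → Pt d) (r : Pt d → ℝ)
    (y : Pt d → Pt d) : Prop :=
  MemLp r 2 (weightedMeasure P.weight P.Ω) ∧ ∃ Dz, MemVecH10 P.weight P.Ω z Dz ∧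
    (∀ w Dw, MemVecH10 (fun x => (P.weight x)⁻¹) P.Ω w Dw →
      ∀ φ : ℕ → Pt d → Pt d,
        (∀ i, ApproximatesH10 (fun x => (P.weight x)⁻¹) P.Ω (fun n x => φ n x i)
          (fun x => w x i) (Dw i)) →
        Tendsto (fun n => ∑ t ∈ P.𝒟, inner ℝ (pointValue y t - P.target t) (φ n t)) atTop
          (𝓝 (aForm P.Ω Dw Dz - bForm P.Ω Dw r))) ∧
    ∀ s : Pt d → ℝ, MemLp s 2 (weightedMeasure (fun x => (P.weight x)⁻¹) P.Ω) →
      bForm P.Ω Dz s = 0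

/-- `(y, p, z, r, u)` solves the optimality system: state equations, adjoint equations and
variational inequality. -/
structure IsOptimal {d : ℕ} (P : TrackingProblem d) (y : Pt d → Pt d) (p : Pt d → ℝ)
    (z : Pt d → Pt d) (r : Pt d → ℝ) (u : Pt d → Pt d) : Prop where
  admissible : P.IsAdmissible u
  state : P.IsState y p u
  adjoint : P.IsAdjoint z r y
  variational : ∀ v, P.IsAdmissible v →
    0 ≤ ∫ x in P.Ω, inner ℝ (z x + P.lam • u x) (v x - u x)

end TrackingProblem

/-! ### Meshes and finite elements -/

/-- The closed simplex with vertex set `K`. -/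
abbrev simplex {d : ℕ} (K : Finset (Pt d)) : Set (Pt d) := convexHull ℝ (K : Set (Pt d))

/-- A conforming partition of `closure Ω` into simplices, which are given by their vertex sets:
two elements meet in the common face spanned by their common vertices (or not at all). -/
structure Mesh {d : ℕ} (Ω : Set (Pt d)) where
  cells : Finset (Finset (Pt d))
  card_eq : ∀ K ∈ cells, K.card = d + 1
  affineIndependent : ∀ K ∈ cells, AffineIndependent ℝ ((↑) : K → Pt d)
  conforming : ∀ K ∈ cells, ∀ L ∈ cells,
    simplex K ∩ simplex L = convexHull ℝ ((K : Set (Pt d)) ∩ L)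
  cover : ⋃ K ∈ cells, simplex K = closure Ω

/-- The element size `h_T = diam T`. -/
def size {d : ℕ} (K : Finset (Pt d)) : ℝ := Metric.diam (simplex K)

/-- Two distinct elements share a common (then internal) side. -/
def ShareSide {d : ℕ} (K L : Finset (Pt d)) : Prop :=
  K ≠ L ∧ ((K : Set (Pt d)) ∩ L).ncard = d

namespace Mesh

/-- Each element `T` contains a ball of some radius `r` with `h_T ≤ σ r`. -/
def IsShapeRegular {d : ℕ} {Ω : Set (Pt d)} (𝒯 : Mesh Ω) (σ : ℝ) : Prop :=
  ∀ K ∈ 𝒯.cells, ∃ (c : Pt d) (r : ℝ), 0 < r ∧ Metric.closedBall c r ⊆ simplex K ∧ size K ≤ σ * r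

/-- The patch `𝒩_T`: the union of `T` and the elements that share an internal side with it. -/
def patch {d : ℕ} {Ω : Set (Pt d)} (𝒯 : Mesh Ω) (K : Finset (Pt d)) : Set (Pt d) :=
  ⋃ L ∈ {L ∈ (𝒯.cells : Set (Finset (Pt d))) | L = K ∨ ShareSide K L}, simplex L

/-- `q` is continuous on `closure Ω` and a polynomial of degree at most `k` on each element. -/
structure IsPiecewisePolynomial {d : ℕ} {Ω : Set (Pt d)} (𝒯 : Mesh Ω) (k : ℕ) (q : Pt d → ℝ) :
    Prop where
  continuousOn : ContinuousOn q (closure Ω)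
  polynomial : ∀ K ∈ 𝒯.cells, ∃ f : MvPolynomial (Fin d) ℝ, f.totalDegree ≤ k ∧
    ∀ x ∈ simplex K, q x = MvPolynomial.eval (fun j => x j) f

/-- `v ∈ 𝐕(𝒯)`, with weak gradient `Dv`: the Taylor-Hood velocity space. -/
def MemV {d : ℕ} {Ω : Set (Pt d)} (𝒯 : Mesh Ω) (v : Pt d → Pt d) (Dv : Fin d → Pt d → Pt d) :
    Prop :=
  (∀ i, 𝒯.IsPiecewisePolynomial 2 fun x => v x i) ∧ MemVecH10 one Ω v Dv

/-- `q` represents an element of the Taylor-Hood pressure space `Q(𝒯)`, which is a space of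
functions modulo constants. -/
def MemQ {d : ℕ} {Ω : Set (Pt d)} (𝒯 : Mesh Ω) (q : Pt d → ℝ) : Prop :=
  𝒯.IsPiecewisePolynomial 1 q

end Mesh

namespace TrackingProblem

/-- The discrete admissible set `𝕌_ad(𝒯)`. -/
def IsDiscreteAdmissible {d : ℕ} (P : TrackingProblem d) (𝒯 : Mesh P.Ω) (u : Pt d → Pt d) : Prop :=
  (∀ i, 𝒯.IsPiecewisePolynomial 2 fun x => u x i) ∧ P.IsAdmissible u

/-- The discrete state equations. -/
def IsDiscreteState {d : ℕ} (P : TrackingProblem d) (𝒯 : Mesh P.Ω) (y : Pt d → Pt d)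
    (p : Pt d → ℝ) (u : Pt d → Pt d) : Prop :=
  𝒯.MemQ p ∧ ∃ Dy, 𝒯.MemV y Dy ∧
    (∀ v Dv, 𝒯.MemV v Dv →
      aForm P.Ω Dy Dv + bForm P.Ω Dv p = ∫ x in P.Ω, inner ℝ (u x) (v x)) ∧
    ∀ q, 𝒯.MemQ q → bForm P.Ω Dy q = 0

/-- The discrete adjoint equations. -/
def IsDiscreteAdjoint {d : ℕ} (P : TrackingProblem d) (𝒯 : Mesh P.Ω) (z : Pt d → Pt d)
    (r : Pt d → ℝ) (y : Pt d → Pt d) : Prop :=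
  𝒯.MemQ r ∧ ∃ Dz, 𝒯.MemV z Dz ∧
    (∀ w Dw, 𝒯.MemV w Dw →
      aForm P.Ω Dw Dz - bForm P.Ω Dw r = ∑ t ∈ P.𝒟, inner ℝ (y t - P.target t) (w t)) ∧
    ∀ s, 𝒯.MemQ s → bForm P.Ω Dz s = 0

/-- `(y, p, z, r, u)` solves the discrete optimality system. -/
structure IsDiscreteOptimal {d : ℕ} (P : TrackingProblem d) (𝒯 : Mesh P.Ω) (y : Pt d → Pt d)
    (p : Pt d → ℝ) (z : Pt d → Pt d) (r : Pt d → ℝ) (u : Pt d → Pt d) : Prop where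
  admissible : P.IsDiscreteAdmissible 𝒯 u
  state : P.IsDiscreteState 𝒯 y p u
  adjoint : P.IsDiscreteAdjoint 𝒯 z r y
  variational : ∀ v, P.IsDiscreteAdmissible 𝒯 v →
    0 ≤ ∫ x in P.Ω, inner ℝ (z x + P.lam • u x) (v x - u x)

end TrackingProblem

/-! ### The local error indicator -/

/-- `ν` is the unit normal, pointing towards the simplex `K`, on the side of `K` with vertices
`S`. -/
structure IsUnitNormal {d : ℕ} (K : Finset (Pt d)) (S : Set (Pt d)) (ν : Pt d) : Prop where
  norm_eq : ‖ν‖ = 1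
  orthogonal : ∀ x ∈ S, ∀ x' ∈ S, inner ℝ ν (x' - x) = 0
  towards : ∀ x ∈ S, ∀ x' ∈ K, 0 ≤ inner ℝ ν (x' - x)

/-- The unit normal, pointing towards `K`, on the side of `K` with vertices `S`. -/
def unitNormal {d : ℕ} (K : Finset (Pt d)) (S : Set (Pt d)) : Pt d :=
  Classical.epsilon (IsUnitNormal K S)

/-- The jump of `∇y · ν` at a point `x` of the common side of `K` and `L`. The gradients are the
one-sided ones, from within `K` and `L`. -/
def normalJump {d : ℕ} (K L : Finset (Pt d)) (y : Pt d → Pt d) (x : Pt d) : Pt d :=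
  fderivWithin ℝ y (simplex K) x (unitNormal K ((K : Set (Pt d)) ∩ L)) +
    fderivWithin ℝ y (simplex L) x (unitNormal L ((K : Set (Pt d)) ∩ L))

/-- The norm of the jump of `∇y · ν` in `L^∞(∂T \ ∂Ω)`: up to a null set, `∂T \ ∂Ω` is the union of
the sides that `T` shares with other elements. -/
def jumpNorm {d : ℕ} {Ω : Set (Pt d)} (𝒯 : Mesh Ω) (K : Finset (Pt d)) (y : Pt d → Pt d) : ℝ≥0∞ :=
  ⨆ L ∈ {L ∈ (𝒯.cells : Set (Finset (Pt d))) | ShareSide K L},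
    eLpNorm (normalJump K L y) ∞
      ((Measure.hausdorffMeasure ((d : ℝ) - 1)).restrict
        (convexHull ℝ ((K : Set (Pt d)) ∩ L)))

/-- The classical divergence. -/
def divergence {d : ℕ} (y : Pt d → Pt d) (x : Pt d) : ℝ :=
  ∑ i, gradient (fun x' => y x' i) x i

/-- The local indicator `ℰ_{st,T}(y, p, u)` in the maximum norm. The derivatives are the classical
ones, in the interior of the element. -/
def stateIndicator {d : ℕ} {Ω : Set (Pt d)} (𝒯 : Mesh Ω) (K : Finset (Pt d)) (y : Pt d → Pt d)
    (p : Pt d → ℝ) (u : Pt d → Pt d) : ℝ≥0∞ :=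
  ENNReal.ofReal (size K ^ 2) *
      eLpNorm (fun x => u x + Laplacian.laplacian y x - gradient p x) ∞
        (volume.restrict (simplex K)) +
    ENNReal.ofReal (size K / 2) * jumpNorm 𝒯 K y +
    ENNReal.ofReal (size K) * eLpNorm (divergence y) ∞ (volume.restrict (simplex K))

end StokesTracking

end

/-!
The efficiency estimate follows from the bubble function argument of residual a posteriori error
analysis, with all derivatives of the velocity error thrown onto smooth test functions, so that the
velocity error enters through its maximum norm only.

The data of the estimate are local: if `φ ∈ C_0^∞(B)` for a ball `B ⊆ Ω`, testing the momentum
equation with `φ eᵢ` gives `∫ yᵢ Δφ + ∫ p ∂ᵢφ + ∫ uᵢ φ = 0`. Subtracting the same integrals of the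
discrete functions and integrating these by parts piecewise, one obtains on the right the element
residuals and, if a side of the mesh crosses `B`, the integral of `φ` times the jump of the normal
derivative over that side (`TrackingProblem.IsState.error_equation`). The continuous discrete
pressure contributes no jump. The left-hand side is bounded by the three errors, with the powers of
the radius of `B` that the derivatives of `φ` dictate (`exists_bound_error_functional`).

The residual is a quadratic and the jump an affine polynomial. Instead of mapping elements to a
reference triangle, the argument uses that each element contains a ball `B` of a radius comparable
to its diameter, and that a polynomial on `B`, and on any fixed dilation of `B`, is controlled by
finitely many of its integrals against bump functions in `B`; by translation and dilation the
constants are those of the unit ball (`exists_bound_quadratic`). This gives the bounds for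
the residual and the divergence. For the jump, the ball is centred at the midpoint `m` of the side;
barycentric coordinates show that an element with inner radius `r` contains a half-disc of radius
`r` around `m` (`halfDisc_subset_simplex`), so that the two elements together contain a disc, and
on the side the jump is controlled by its integrals against test functions in this disc
(`exists_bound_affine_line`).
-/

noncomputable section

namespace StokesTracking

/-! ### Partial derivatives -/

/-- The partial derivative `∂ᵢ f`. -/
def partialDeriv (i : Fin 2) (f : Pt 2 → ℝ) (x : Pt 2) : ℝ :=
  fderiv ℝ f x (EuclideanSpace.single i 1)

theorem gradient_apply (f : Pt 2 → ℝ) (x : Pt 2) (i : Fin 2) :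
    gradient f x i = partialDeriv i f x := by
  rw [partialDeriv, ← inner_gradient_left, EuclideanSpace.inner_single_right]
  simp

theorem gradient_eq_toLp (f : Pt 2 → ℝ) (x : Pt 2) :
    gradient f x = WithLp.toLp 2 (fun i => partialDeriv i f x) := by
  ext i
  rw [gradient_apply]

theorem eq_sum_single (w : Pt 2) : w = ∑ i, w i • EuclideanSpace.single i (1 : ℝ) := by
  ext j
  simp [Fin.sum_univ_two]
  fin_cases j <;> simp

theorem fderiv_apply_eq_sum (f : Pt 2 → ℝ) (x w : Pt 2) :
    fderiv ℝ f x w = ∑ i, w i * partialDeriv i f x := by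
  conv_lhs => rw [eq_sum_single w]
  simp [partialDeriv]

theorem contDiff_partialDeriv {f : Pt 2 → ℝ} {n m : ℕ∞ω} (hf : ContDiff ℝ n f)
    (h : m + 1 ≤ n) (i : Fin 2) : ContDiff ℝ m (partialDeriv i f) :=
  (hf.fderiv_right h).clm_apply contDiff_const

theorem laplacian_apply {y : Pt 2 → Pt 2} (hy : ContDiff ℝ 2 y) (x : Pt 2) (i : Fin 2) :
    Laplacian.laplacian y x i =
      ∑ j, partialDeriv j (partialDeriv j fun x' => y x' i) x := by
  have h1 : Laplacian.laplacian y x i = Laplacian.laplacian (fun x' => y x' i) x := by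
    have := (hy.contDiffAt (x := x)).laplacian_CLM_comp_left
      (l := (EuclideanSpace.proj i : Pt 2 →L[ℝ] ℝ))
    exact this.symm
  rw [h1]
  rw [InnerProductSpace.laplacian_eq_iteratedFDeriv_orthonormalBasis 
    (v := EuclideanSpace.basisFun (Fin 2) ℝ)]
  refine Finset.sum_congr rfl fun j _ => ?_
  have hf : ContDiff ℝ 2 (fun x' => y x' i) :=
    (EuclideanSpace.proj i : Pt 2 →L[ℝ] ℝ).contDiff.comp hy
  have hd : DifferentiableAt ℝ (fderiv ℝ fun x' => y x' i) x :=
    ((hf.fderiv_right (m := 1) (by norm_num)).differentiable (by norm_num)) x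
  rw [iteratedFDeriv_two_apply, EuclideanSpace.basisFun_apply, partialDeriv]
  change _ = fderiv ℝ (fun x'' => fderiv ℝ (fun x' => y x' i) x'' (EuclideanSpace.single j 1)) x _
  rw [fderiv_clm_apply hd (differentiableAt_const _)]
  simp

/-! ### Integration over a half-plane -/

theorem exists_orthonormalBasis_frame {ν τ : Pt 2} (hν : ‖ν‖ = 1) (hτ : ‖τ‖ = 1)
    (h : inner ℝ ν τ = 0) : ∃ b : OrthonormalBasis (Fin 2) ℝ (Pt 2), b 0 = ν ∧ b 1 = τ := by
  have ho : Orthonormal ℝ ![ν, τ] := by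
    rw [orthonormal_vecCons_iff]
    refine ⟨hν, ?_, ?_⟩
    · intro i; fin_cases i; simpa using h
    · rw [orthonormal_vecCons_iff]
      exact ⟨hτ, fun i => i.elim0, by simp⟩
  have hs : ⊤ ≤ Submodule.span ℝ (Set.range ![ν, τ]) := by
    rw [ho.linearIndependent.span_eq_top_of_card_eq_finrank (by simp)]
  exact ⟨OrthonormalBasis.mk ho hs, by simp, by simp⟩

/-- The parametrization of the plane by the orthonormal frame `(ν, τ)` with origin `m` preserves
Lebesgue measure. -/
theorem measurePreserving_frame {ν τ : Pt 2} (hν : ‖ν‖ = 1) (hτ : ‖τ‖ = 1) (h : inner ℝ ν τ = 0)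
    (m : Pt 2) :
    MeasurePreserving (fun z : ℝ × ℝ => m + (z.1 • ν + z.2 • τ)) := by
  obtain ⟨b, h0, h1⟩ := exists_orthonormalBasis_frame hν hτ h
  have hb : MeasurePreserving (fun z : ℝ × ℝ => b.repr.symm
      (WithLp.toLp 2 (MeasurableEquiv.finTwoArrow.symm z))) :=
    (b.measurePreserving_repr_symm).comp ((PiLp.volume_preserving_toLp (Fin 2)).comp
      (volume_preserving_finTwoArrow ℝ).symm)
  have h2 := (measurePreserving_add_left volume m).comp hb
  have e : (fun z : ℝ × ℝ => m + (z.1 • ν + z.2 • τ)) = (fun x => m + x) ∘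
      fun z => b.repr.symm (WithLp.toLp 2 (MeasurableEquiv.finTwoArrow.symm z)) := by
    funext z
    simp only [Function.comp]
    congr 1
    rw [← b.sum_repr (b.repr.symm _)]
    simp [Fin.sum_univ_two, h0, h1, MeasurableEquiv.finTwoArrow]
  rw [e]
  exact h2

theorem measurableEmbedding_frame {ν τ : Pt 2} (hν : ‖ν‖ = 1) (hτ : ‖τ‖ = 1)
    (h : inner ℝ ν τ = 0) (m : Pt 2) :
    MeasurableEmbedding (fun z : ℝ × ℝ => m + (z.1 • ν + z.2 • τ)) := by
  refine Continuous.measurableEmbedding (by fun_prop) ?_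
  intro z z' hz
  have hz' : z.1 • ν + z.2 • τ = z'.1 • ν + z'.2 • τ := by simpa using hz
  have h' : inner ℝ τ ν = 0 := by rw [real_inner_comm]; exact h
  have e1 := congrArg (inner ℝ ν) hz'
  have e2 := congrArg (inner ℝ τ) hz'
  simp [inner_add_right, inner_smul_right, h, h', hν, hτ] at e1 e2
  exact Prod.ext e1 e2

theorem inner_frame {ν τ : Pt 2} (hν : ‖ν‖ = 1) (h : inner ℝ ν τ = 0) (s t : ℝ) :
    inner ℝ ν (s • ν + t • τ) = s := by
  simp [inner_add_right, inner_smul_right, h, hν]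

theorem eq_frame {ν τ : Pt 2} (hν : ‖ν‖ = 1) (hτ : ‖τ‖ = 1) (h : inner ℝ ν τ = 0) (w : Pt 2) :
    w = inner ℝ ν w • ν + inner ℝ τ w • τ := by
  obtain ⟨b, h0, h1⟩ := exists_orthonormalBasis_frame hν hτ h
  have := (b.sum_repr' w).symm
  simpa [Fin.sum_univ_two, h0, h1] using this

/-- The divergence theorem on the half-plane `{x | ⟪ν, x - m⟫ < 0}`. -/
theorem integral_halfPlane_fderiv {ν τ : Pt 2} (hν : ‖ν‖ = 1) (hτ : ‖τ‖ = 1)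
    (h : inner ℝ ν τ = 0) (m w : Pt 2) {F : Pt 2 → ℝ} (hF : ContDiff ℝ 1 F)
    (hc : HasCompactSupport F) :
    ∫ x in {x | inner ℝ ν (x - m) < 0}, fderiv ℝ F x w =
      inner ℝ ν w * ∫ t : ℝ, F (m + t • τ) := by
  set Φ : ℝ × ℝ → Pt 2 := fun z => m + (z.1 • ν + z.2 • τ) with hΦ
  have hmp := measurePreserving_frame hν hτ h m
  have hme := measurableEmbedding_frame hν hτ h m
  have hd : Differentiable ℝ F := hF.differentiable (by norm_num)
  have hpre : Φ ⁻¹' {x | inner ℝ ν (x - m) < 0} = Set.Iio 0 ×ˢ Set.univ := by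
    ext z
    simp [hΦ, inner_frame hν h]
  have key : ∀ w : Pt 2, ∫ x in {x | inner ℝ ν (x - m) < 0}, fderiv ℝ F x w =
      ∫ z in Set.Iio (0:ℝ) ×ˢ Set.univ, fderiv ℝ F (Φ z) w ∂((volume : Measure ℝ).prod volume) := by
    intro w
    rw [← hpre]
    exact (hmp.setIntegral_preimage_emb hme (fun x => fderiv ℝ F x w) _).symm
  have hint : ∀ w : Pt 2, Integrable (fun z => fderiv ℝ F (Φ z) w)
      ((volume : Measure ℝ).prod volume) := by
    intro w
    have : Integrable (fun x => fderiv ℝ F x w) :=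
      ((hF.continuous_fderiv_apply (by norm_num)).comp (continuous_id.prodMk
        continuous_const)).integrable_of_hasCompactSupport
        (hc.fderiv_apply ℝ w)
    exact (hmp.integrable_comp_emb hme).2 this
  -- in the direction `ν`, integrate first along the normal lines
  have hderν : ∀ s t, HasDerivAt (fun s => F (Φ (s, t))) (fderiv ℝ F (Φ (s, t)) ν) s := by
    intro s t
    have h1 : HasDerivAt (fun s : ℝ => Φ (s, t)) ν s := by
      have := (((hasDerivAt_id s).smul_const ν).add_const (t • τ)).const_add m
      simpa [hΦ] using this
    exact (hd _).hasFDerivAt.comp_hasDerivAt s h1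
  have hderτ : ∀ s t, HasDerivAt (fun t => F (Φ (s, t))) (fderiv ℝ F (Φ (s, t)) τ) t := by
    intro s t
    have h1 : HasDerivAt (fun t : ℝ => Φ (s, t)) τ t := by
      have := (((hasDerivAt_id t).smul_const τ).const_add (s • ν)).const_add m
      simpa [hΦ] using this
    exact (hd _).hasFDerivAt.comp_hasDerivAt t h1
  have hcΦ : HasCompactSupport (F ∘ Φ) := by
    have hi : Topology.IsClosedEmbedding Φ := by
      have hiso : Isometry (fun z : WithLp 2 (ℝ × ℝ) => Φ (z.fst, z.snd)) := by
        refine Isometry.of_dist_eq fun z z' => ?_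
        rw [dist_eq_norm, dist_eq_norm, WithLp.prod_norm_eq_of_L2]
        have : Φ (z.fst, z.snd) - Φ (z'.fst, z'.snd) =
            (z.fst - z'.fst) • ν + (z.snd - z'.snd) • τ := by
          simp [hΦ, sub_smul]; abel
        rw [this, ← Real.sqrt_sq (norm_nonneg _), norm_add_sq_real]
        simp [inner_smul_right, inner_smul_left, h, hν, hτ, norm_smul]
      have := hiso.isClosedEmbedding.comp (WithLp.homeomorphProd 2 ℝ ℝ).symm.isClosedEmbedding
      exact this
    exact hc.comp_isClosedEmbedding hi
  have hC1 : ∀ t, ContDiff ℝ 1 fun s => F (Φ (s, t)) := fun t =>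
    hF.comp (by simp only [hΦ]; fun_prop)
  have hC2 : ∀ s, ContDiff ℝ 1 fun t => F (Φ (s, t)) := fun s =>
    hF.comp (by simp only [hΦ]; fun_prop)
  have hK1 : ∀ t, HasCompactSupport fun s => F (Φ (s, t)) := fun t =>
    hcΦ.comp_isClosedEmbedding (g := fun s : ℝ => (s, t)) (Isometry.isClosedEmbedding (by
      refine Isometry.of_dist_eq fun a b => ?_
      simp [Prod.dist_eq]))
  have hK2 : ∀ s, HasCompactSupport fun t => F (Φ (s, t)) := fun s =>
    hcΦ.comp_isClosedEmbedding (g := fun t : ℝ => (s, t)) (Isometry.isClosedEmbedding (by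
      refine Isometry.of_dist_eq fun a b => ?_
      simp [Prod.dist_eq]))
  have hν' : ∫ z in Set.Iio (0:ℝ) ×ˢ Set.univ, fderiv ℝ F (Φ z) ν
      ∂((volume : Measure ℝ).prod volume) = ∫ t : ℝ, F (m + t • τ) := by
    rw [← Measure.prod_restrict, Measure.restrict_univ, integral_prod_symm]
    · refine integral_congr_ae (Eventually.of_forall fun t => ?_)
      have := (hK1 t).integral_Iic_deriv_eq (hC1 t) 0
      rw [integral_Iic_eq_integral_Iio] at this
      simp only [(hderν _ t).deriv] at this
      simpa [hΦ] using this
    · rw [← Measure.restrict_univ (μ := (volume : Measure ℝ)), Measure.restrict_univ]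
      have := (hint ν).integrableOn (s := Set.Iio (0:ℝ) ×ˢ Set.univ)
      rwa [IntegrableOn, ← Measure.prod_restrict, Measure.restrict_univ] at this
  have hτ' : ∫ z in Set.Iio (0:ℝ) ×ˢ Set.univ, fderiv ℝ F (Φ z) τ
      ∂((volume : Measure ℝ).prod volume) = 0 := by
    rw [← Measure.prod_restrict, Measure.restrict_univ, integral_prod]
    · have : ∀ s : ℝ, ∫ t : ℝ, fderiv ℝ F (Φ (s, t)) τ = 0 := by
        intro s
        have := integral_eq_zero_of_hasDerivAt_of_integrable (fun t => hderτ s t)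
          (by
            have := ((hC2 s).continuous_deriv (by norm_num)).integrable_of_hasCompactSupport
              (μ := volume) (hK2 s).deriv
            exact this.congr (Eventually.of_forall fun t => (hderτ s t).deriv))
          ((hC2 s).continuous.integrable_of_hasCompactSupport (hK2 s))
        exact this
      simp [this]
    · have := (hint τ).integrableOn (s := Set.Iio (0:ℝ) ×ˢ Set.univ)
      rwa [IntegrableOn, ← Measure.prod_restrict, Measure.restrict_univ] at this
  rw [key]
  have hw := eq_frame hν hτ h w
  have : ∀ z, fderiv ℝ F (Φ z) w =
      inner ℝ ν w * fderiv ℝ F (Φ z) ν + inner ℝ τ w * fderiv ℝ F (Φ z) τ := by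
    intro z
    conv_lhs => rw [hw]
    simp
  simp_rw [this]
  rw [integral_add ((hint ν).integrableOn.const_mul _) ((hint τ).integrableOn.const_mul _),
    integral_const_mul, integral_const_mul, hν', hτ']
  simp

/-! ### Green's identities on half-planes -/

theorem integrable_mul_of_hasCompactSupport {f g : Pt 2 → ℝ} (hf : Continuous f)
    (hg : Continuous g) (hc : HasCompactSupport g) (S : Set (Pt 2)) :
    IntegrableOn (fun x => f x * g x) S :=
  ((hf.mul hg).integrable_of_hasCompactSupport hc.mul_left).integrableOn

theorem partialDeriv_mul {f g : Pt 2 → ℝ} {x : Pt 2} (hf : DifferentiableAt ℝ f x)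
    (hg : DifferentiableAt ℝ g x) (i : Fin 2) :
    partialDeriv i (fun x => f x * g x) x =
      f x * partialDeriv i g x + partialDeriv i f x * g x := by
  rw [partialDeriv, fderiv_fun_mul hf hg]
  simp [partialDeriv]
  ring

theorem continuous_partialDeriv {f : Pt 2 → ℝ} (hf : ContDiff ℝ 1 f) (i : Fin 2) :
    Continuous (partialDeriv i f) :=
  (contDiff_partialDeriv (m := 0) hf (by norm_num) i).continuous

theorem tsupport_partialDeriv_subset (f : Pt 2 → ℝ) (i : Fin 2) :
    tsupport (partialDeriv i f) ⊆ tsupport f :=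
  tsupport_fderiv_apply_subset ℝ _

theorem tsupport_sum_partialDeriv_subset (φ : Pt 2 → ℝ) :
    tsupport (fun x => ∑ k, partialDeriv k (partialDeriv k φ) x) ⊆ tsupport φ := by
  refine closure_minimal (fun x hx => ?_) (isClosed_tsupport φ)
  by_contra hx'
  refine hx (Finset.sum_eq_zero fun k _ => image_eq_zero_of_notMem_tsupport fun h' => hx' ?_)
  exact tsupport_partialDeriv_subset φ k (tsupport_partialDeriv_subset _ k h')

theorem hasCompactSupport_partialDeriv {f : Pt 2 → ℝ} (hf : HasCompactSupport f) (i : Fin 2) :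
    HasCompactSupport (partialDeriv i f) :=
  hf.fderiv_apply ℝ _

theorem isClosedEmbedding_line {τ : Pt 2} (hτ : ‖τ‖ = 1) (m : Pt 2) :
    Topology.IsClosedEmbedding (fun t : ℝ => m + t • τ) :=
  Isometry.isClosedEmbedding (Isometry.of_dist_eq fun a b => by
    rw [dist_eq_norm, dist_eq_norm, add_sub_add_left_eq_sub, ← sub_smul, norm_smul, hτ, mul_one])

theorem integral_halfPlane_mul_partialDeriv {ν τ : Pt 2} (hν : ‖ν‖ = 1)
    (hτ : ‖τ‖ = 1) (h : inner ℝ ν τ = 0) (m : Pt 2)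
    {Q φ : Pt 2 → ℝ} (hQ : ContDiff ℝ 1 Q)
    (hφ : ContDiff ℝ 1 φ) (hc : HasCompactSupport φ) (i : Fin 2) :
    ∫ x in {x | inner ℝ ν (x - m) < 0}, Q x * partialDeriv i φ x =
      - (∫ x in {x | inner ℝ ν (x - m) < 0}, partialDeriv i Q x * φ x) +
        ν i * ∫ t : ℝ, Q (m + t • τ) * φ (m + t • τ) := by
  have key := integral_halfPlane_fderiv hν hτ h m (EuclideanSpace.single i 1) (hQ.mul hφ)
    hc.mul_left
  have e : ∀ x, fderiv ℝ (fun x => Q x * φ x) x (EuclideanSpace.single i 1) =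
      Q x * partialDeriv i φ x + partialDeriv i Q x * φ x := fun x =>
    partialDeriv_mul (hQ.differentiable (by norm_num) x) (hφ.differentiable (by norm_num) x) i
  simp_rw [e] at key
  rw [integral_add
    (integrable_mul_of_hasCompactSupport hQ.continuous (continuous_partialDeriv hφ i)
      (hasCompactSupport_partialDeriv hc i) _)
    (integrable_mul_of_hasCompactSupport (continuous_partialDeriv hQ i) hφ.continuous hc _),
    EuclideanSpace.inner_single_right] at key
  simp at key
  linarith

/-- Green's second identity on a half-plane. -/
theorem integral_halfPlane_mul_laplacian {ν τ : Pt 2} (hν : ‖ν‖ = 1)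
    (hτ : ‖τ‖ = 1) (h : inner ℝ ν τ = 0) (m : Pt 2)
    {Q φ : Pt 2 → ℝ} (hQ : ContDiff ℝ 2 Q)
    (hφ : ContDiff ℝ 2 φ) (hc : HasCompactSupport φ) :
    ∫ x in {x | inner ℝ ν (x - m) < 0}, Q x * ∑ i, partialDeriv i (partialDeriv i φ) x =
      (∫ x in {x | inner ℝ ν (x - m) < 0}, (∑ i, partialDeriv i (partialDeriv i Q) x) * φ x) +
        ∫ t : ℝ, (Q (m + t • τ) * fderiv ℝ φ (m + t • τ) ν -
          φ (m + t • τ) * fderiv ℝ Q (m + t • τ) ν) := by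
  have hφ1 : ContDiff ℝ 1 φ := hφ.of_le (by norm_num)
  have hQ1 : ContDiff ℝ 1 Q := hQ.of_le (by norm_num)
  have hφ' : ∀ i, ContDiff ℝ 1 (partialDeriv i φ) := fun i =>
    contDiff_partialDeriv hφ (by norm_num) i
  have hQ' : ∀ i, ContDiff ℝ 1 (partialDeriv i Q) := fun i =>
    contDiff_partialDeriv hQ (by norm_num) i
  have hcl := isClosedEmbedding_line hτ m
  have i1 : ∀ i, Integrable fun t : ℝ => Q (m + t • τ) * partialDeriv i φ (m + t • τ) := fun i =>
    Continuous.integrable_of_hasCompactSupport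
      ((hQ.continuous.mul (hφ' i).continuous).comp hcl.continuous)
      (((hasCompactSupport_partialDeriv hc i).mul_left (f := Q)).comp_isClosedEmbedding hcl)
  have i2 : ∀ i, Integrable fun t : ℝ => φ (m + t • τ) * partialDeriv i Q (m + t • τ) := fun i =>
    Continuous.integrable_of_hasCompactSupport
      ((hφ.continuous.mul (hQ' i).continuous).comp hcl.continuous)
      ((hc.mul_right (f' := partialDeriv i Q)).comp_isClosedEmbedding hcl)
  have step : ∀ i, ∫ x in {x | inner ℝ ν (x - m) < 0}, Q x * partialDeriv i (partialDeriv i φ) x =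
      (∫ x in {x | inner ℝ ν (x - m) < 0}, partialDeriv i (partialDeriv i Q) x * φ x) +
        ∫ t : ℝ, ν i * (Q (m + t • τ) * partialDeriv i φ (m + t • τ) -
          φ (m + t • τ) * partialDeriv i Q (m + t • τ)) := by
    intro i
    have h1 := integral_halfPlane_mul_partialDeriv hν hτ h m hQ1 (hφ' i)
      (hasCompactSupport_partialDeriv hc i) i
    have h2 := integral_halfPlane_mul_partialDeriv hν hτ h m (hQ' i) hφ1 hc i
    rw [integral_const_mul, integral_sub (i1 i) (i2 i), h1, h2]
    simp_rw [mul_comm (φ _)]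
    ring
  simp only [Fin.sum_univ_two] at step ⊢
  simp_rw [mul_add, add_mul]
  have c1 : ∀ i, IntegrableOn (fun x => Q x * partialDeriv i (partialDeriv i φ) x)
      {x | inner ℝ ν (x - m) < 0} := fun i =>
    integrable_mul_of_hasCompactSupport hQ.continuous (continuous_partialDeriv (hφ' i) i)
      (hasCompactSupport_partialDeriv (hasCompactSupport_partialDeriv hc i) i) _
  have c2 : ∀ i, IntegrableOn (fun x => partialDeriv i (partialDeriv i Q) x * φ x)
      {x | inner ℝ ν (x - m) < 0} := fun i =>
    integrable_mul_of_hasCompactSupport (continuous_partialDeriv (hQ' i) i) hφ.continuous hc _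
  have c3 : ∀ i, Integrable fun t : ℝ => ν i * (Q (m + t • τ) * partialDeriv i φ (m + t • τ) -
          φ (m + t • τ) * partialDeriv i Q (m + t • τ)) := fun i =>
    ((i1 i).sub (i2 i)).const_mul _
  rw [integral_add (c1 0) (c1 1), integral_add (c2 0) (c2 1), step, step]
  have : ∀ t : ℝ, Q (m + t • τ) * fderiv ℝ φ (m + t • τ) ν -
          φ (m + t • τ) * fderiv ℝ Q (m + t • τ) ν =
      ν 0 * (Q (m + t • τ) * partialDeriv 0 φ (m + t • τ) -
          φ (m + t • τ) * partialDeriv 0 Q (m + t • τ)) +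
      ν 1 * (Q (m + t • τ) * partialDeriv 1 φ (m + t • τ) -
          φ (m + t • τ) * partialDeriv 1 Q (m + t • τ)) := by
    intro t
    rw [fderiv_apply_eq_sum, fderiv_apply_eq_sum, Fin.sum_univ_two, Fin.sum_univ_two]
    ring
  simp_rw [this]
  rw [integral_add (c3 0) (c3 1)]
  ring

/-- Green's second identity for a function that is `Q₁` on one side of a line and `Q₂` on the other:
if the function is continuous, only the jump of its normal derivative remains on the line. -/
theorem integral_twoSided_mul_laplacian {ν τ : Pt 2} (hν : ‖ν‖ = 1)
    (hτ : ‖τ‖ = 1) (h : inner ℝ ν τ = 0) (m : Pt 2)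
    {Q₁ Q₂ φ : Pt 2 → ℝ} (hQ₁ : ContDiff ℝ 2 Q₁)
    (hQ₂ : ContDiff ℝ 2 Q₂) (hφ : ContDiff ℝ 2 φ) (hc : HasCompactSupport φ)
    (heq : ∀ t : ℝ, m + t • τ ∈ tsupport φ → Q₁ (m + t • τ) = Q₂ (m + t • τ)) :
    (∫ x in {x | inner ℝ (-ν) (x - m) < 0}, Q₁ x * ∑ i, partialDeriv i (partialDeriv i φ) x) +
      (∫ x in {x | inner ℝ ν (x - m) < 0}, Q₂ x * ∑ i, partialDeriv i (partialDeriv i φ) x) =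
      (∫ x in {x | inner ℝ (-ν) (x - m) < 0},
        (∑ i, partialDeriv i (partialDeriv i Q₁) x) * φ x) +
      (∫ x in {x | inner ℝ ν (x - m) < 0}, (∑ i, partialDeriv i (partialDeriv i Q₂) x) * φ x) +
        ∫ t : ℝ, φ (m + t • τ) * (fderiv ℝ Q₁ (m + t • τ) ν - fderiv ℝ Q₂ (m + t • τ) ν) := by
  rw [integral_halfPlane_mul_laplacian hν hτ h m hQ₂ hφ hc,
    integral_halfPlane_mul_laplacian (by simpa using hν) hτ (by simpa using h) m hQ₁ hφ hc]
  have hcl := isClosedEmbedding_line hτ m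
  have i0 : ∀ {Q : Pt 2 → ℝ} (_ : ContDiff ℝ 2 Q) (w : Pt 2), Integrable fun t : ℝ =>
      Q (m + t • τ) * fderiv ℝ φ (m + t • τ) w - φ (m + t • τ) * fderiv ℝ Q (m + t • τ) w := by
    intro Q hQ w
    have c1 : ∀ {f : Pt 2 → ℝ} (_ : ContDiff ℝ 2 f), Continuous fun x => fderiv ℝ f x w := fun hf =>
      (hf.continuous_fderiv (by norm_num)).clm_apply continuous_const
    refine Integrable.sub ?_ ?_
    · exact Continuous.integrable_of_hasCompactSupport
        ((hQ.continuous.mul (c1 hφ)).comp hcl.continuous)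
        (((hc.fderiv_apply ℝ w).mul_left (f := Q)).comp_isClosedEmbedding hcl)
    · exact Continuous.integrable_of_hasCompactSupport
        ((hφ.continuous.mul (c1 hQ)).comp hcl.continuous)
        ((hc.mul_right (f' := fun x => fderiv ℝ Q x w)).comp_isClosedEmbedding hcl)
  have key : (∫ t : ℝ, (Q₁ (m + t • τ) * fderiv ℝ φ (m + t • τ) (-ν) -
          φ (m + t • τ) * fderiv ℝ Q₁ (m + t • τ) (-ν))) +
      (∫ t : ℝ, (Q₂ (m + t • τ) * fderiv ℝ φ (m + t • τ) ν -
          φ (m + t • τ) * fderiv ℝ Q₂ (m + t • τ) ν)) =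
      ∫ t : ℝ, φ (m + t • τ) * (fderiv ℝ Q₁ (m + t • τ) ν - fderiv ℝ Q₂ (m + t • τ) ν) := by
    rw [← integral_add (i0 hQ₁ _) (i0 hQ₂ _)]
    refine integral_congr_ae (Eventually.of_forall fun t => ?_)
    by_cases ht : m + t • τ ∈ tsupport φ
    · simp only [heq t ht, map_neg]
      ring
    · have h1 : φ (m + t • τ) = 0 := image_eq_zero_of_notMem_tsupport ht
      have h2 : fderiv ℝ φ (m + t • τ) = 0 :=
        image_eq_zero_of_notMem_tsupport fun h' => ht (tsupport_fderiv_subset ℝ h')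
      simp [h1, h2]
  rw [← key]
  ring

theorem integral_twoSided_mul_partialDeriv {ν τ : Pt 2} (hν : ‖ν‖ = 1)
    (hτ : ‖τ‖ = 1) (h : inner ℝ ν τ = 0) (m : Pt 2)
    {Q₁ Q₂ φ : Pt 2 → ℝ} (hQ₁ : ContDiff ℝ 1 Q₁)
    (hQ₂ : ContDiff ℝ 1 Q₂) (hφ : ContDiff ℝ 1 φ) (hc : HasCompactSupport φ)
    (heq : ∀ t : ℝ, m + t • τ ∈ tsupport φ → Q₁ (m + t • τ) = Q₂ (m + t • τ)) (i : Fin 2) :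
    (∫ x in {x | inner ℝ (-ν) (x - m) < 0}, Q₁ x * partialDeriv i φ x) +
      (∫ x in {x | inner ℝ ν (x - m) < 0}, Q₂ x * partialDeriv i φ x) =
      - (∫ x in {x | inner ℝ (-ν) (x - m) < 0}, partialDeriv i Q₁ x * φ x) -
      (∫ x in {x | inner ℝ ν (x - m) < 0}, partialDeriv i Q₂ x * φ x) := by
  rw [integral_halfPlane_mul_partialDeriv hν hτ h m hQ₂ hφ hc,
    integral_halfPlane_mul_partialDeriv (by simpa using hν) hτ (by simpa using h) m hQ₁ hφ hc]
  have : ∫ t : ℝ, Q₁ (m + t • τ) * φ (m + t • τ) = ∫ t : ℝ, Q₂ (m + t • τ) * φ (m + t • τ) := by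
    refine integral_congr_ae (Eventually.of_forall fun t => ?_)
    by_cases ht : m + t • τ ∈ tsupport φ
    · simp only [heq t ht]
    · simp [image_eq_zero_of_notMem_tsupport ht]
  rw [this]
  simp
  ring

theorem volume_line {ν : Pt 2} (hν : ‖ν‖ = 1) (m : Pt 2) :
    volume {x : Pt 2 | inner ℝ ν (x - m) = 0} = 0 := by
  have e : {x : Pt 2 | inner ℝ ν (x - m) = 0} = (fun x => m + x) ''
      ((LinearMap.ker (innerSL ℝ ν : Pt 2 →L[ℝ] ℝ).toLinearMap : Submodule ℝ (Pt 2)) :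
        Set (Pt 2)) := by
    ext x
    constructor
    · intro hx
      exact ⟨x - m, by simpa using hx, by simp⟩
    · rintro ⟨z, hz, rfl⟩
      simpa using hz
  rw [e]
  simp only [Set.image_add_left, measure_preimage_add]
  refine Measure.addHaar_submodule _ _ fun htop => ?_
  have : ν ∈ LinearMap.ker (innerSL ℝ ν : Pt 2 →L[ℝ] ℝ).toLinearMap := by rw [htop]; trivial
  simp at this
  simp [this] at hν

/-- A line is a null set, so that an integral is the sum of the integrals over the half-planes
on its two sides. -/
theorem integral_eq_add_halfPlanes {ν : Pt 2} (hν : ‖ν‖ = 1) (m : Pt 2) {f : Pt 2 → ℝ}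
    (hf : Integrable f) :
    ∫ x, f x = (∫ x in {x | inner ℝ (-ν) (x - m) < 0}, f x) +
      ∫ x in {x | inner ℝ ν (x - m) < 0}, f x := by
  have hm : MeasurableSet {x : Pt 2 | inner ℝ ν (x - m) < 0} :=
    (isOpen_lt (by fun_prop) continuous_const).measurableSet
  rw [← integral_add_compl hm hf, add_comm]
  congr 1
  refine setIntegral_congr_set ?_
  have : ∀ᵐ x : Pt 2, inner ℝ ν (x - m) ≠ 0 := by
    rw [ae_iff]
    simpa using volume_line hν m
  filter_upwards [this] with x hx
  apply propext
  change x ∈ {x | inner ℝ ν (x - m) < 0}ᶜ ↔ x ∈ {x | inner ℝ (-ν) (x - m) < 0}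
  rw [Set.mem_compl_iff, Set.mem_ofPred_eq, Set.mem_ofPred_eq, inner_neg_left, neg_lt_zero, not_lt]
  exact ⟨fun h => lt_of_le_of_ne h hx.symm, le_of_lt⟩

/-! ### Quadratic polynomials -/

/-- The monomials of degree at most `2` in two variables. -/
def quadMonomial (k : Fin 6) (x : Pt 2) : ℝ :=
  ![1, x 0, x 1, x 0 ^ 2, x 0 * x 1, x 1 ^ 2] k

/-- `R` is a polynomial function of degree at most `2`. -/
def IsQuadratic (R : Pt 2 → ℝ) : Prop :=
  ∃ a : Fin 6 → ℝ, ∀ x, R x = ∑ k, a k * quadMonomial k x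

/-- `R` is a polynomial function of degree at most `1`. -/
def IsAffineFun (R : Pt 2 → ℝ) : Prop :=
  ∃ a₀ a₁ a₂ : ℝ, ∀ x, R x = a₀ + a₁ * x 0 + a₂ * x 1

theorem contDiff_quadMonomial (k : Fin 6) : ContDiff ℝ ∞ (quadMonomial k) := by
  unfold quadMonomial
  fin_cases k <;> simp <;> fun_prop

theorem IsQuadratic.contDiff {R : Pt 2 → ℝ} (hR : IsQuadratic R) : ContDiff ℝ ∞ R := by
  obtain ⟨a, ha⟩ := hR
  rw [funext ha]
  exact ContDiff.sum fun k _ => contDiff_const.mul (contDiff_quadMonomial k)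

theorem isQuadratic_iff {R : Pt 2 → ℝ} : IsQuadratic R ↔ ∃ a : Fin 6 → ℝ, ∀ x, R x =
    a 0 + a 1 * x 0 + a 2 * x 1 + a 3 * x 0 ^ 2 + a 4 * (x 0 * x 1) + a 5 * x 1 ^ 2 := by
  refine exists_congr fun a => forall_congr' fun x => ?_
  simp [quadMonomial, Fin.sum_univ_six]

theorem IsQuadratic.add {R S : Pt 2 → ℝ} (hR : IsQuadratic R) (hS : IsQuadratic S) :
    IsQuadratic fun x => R x + S x := by
  obtain ⟨a, ha⟩ := hR
  obtain ⟨b, hb⟩ := hS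
  exact ⟨a + b, fun x => by simp [ha, hb, add_mul, Finset.sum_add_distrib]⟩

theorem IsQuadratic.const_mul {R : Pt 2 → ℝ} (hR : IsQuadratic R) (c : ℝ) :
    IsQuadratic fun x => c * R x := by
  obtain ⟨a, ha⟩ := hR
  exact ⟨fun k => c * a k, fun x => by simp [ha, Finset.mul_sum, mul_assoc]⟩

theorem IsQuadratic.sub {R S : Pt 2 → ℝ} (hR : IsQuadratic R) (hS : IsQuadratic S) :
    IsQuadratic fun x => R x - S x := by
  simpa [sub_eq_add_neg] using hR.add (hS.const_mul (-1))

theorem IsAffineFun.isQuadratic {R : Pt 2 → ℝ} (hR : IsAffineFun R) : IsQuadratic R := by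
  obtain ⟨a₀, a₁, a₂, h⟩ := hR
  exact isQuadratic_iff.2 ⟨![a₀, a₁, a₂, 0, 0, 0], fun x => by simp [h]⟩

theorem IsAffineFun.add {R S : Pt 2 → ℝ} (hR : IsAffineFun R) (hS : IsAffineFun S) :
    IsAffineFun fun x => R x + S x := by
  obtain ⟨a₀, a₁, a₂, ha⟩ := hR
  obtain ⟨b₀, b₁, b₂, hb⟩ := hS
  exact ⟨a₀ + b₀, a₁ + b₁, a₂ + b₂, fun x => by simp only [ha, hb]; ring⟩

theorem IsAffineFun.const_mul {R : Pt 2 → ℝ} (hR : IsAffineFun R) (c : ℝ) :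
    IsAffineFun fun x => c * R x := by
  obtain ⟨a₀, a₁, a₂, ha⟩ := hR
  exact ⟨c * a₀, c * a₁, c * a₂, fun x => by simp only [ha]; ring⟩

theorem IsAffineFun.sub {R S : Pt 2 → ℝ} (hR : IsAffineFun R) (hS : IsAffineFun S) :
    IsAffineFun fun x => R x - S x := by
  simpa [sub_eq_add_neg] using hR.add (hS.const_mul (-1))

theorem hasFDerivAt_coord (i : Fin 2) (x : Pt 2) :
    HasFDerivAt (fun x : Pt 2 => x i) (EuclideanSpace.proj i : Pt 2 →L[ℝ] ℝ) x :=
  (EuclideanSpace.proj i : Pt 2 →L[ℝ] ℝ).hasFDerivAt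

theorem IsQuadratic.isAffineFun_partialDeriv {R : Pt 2 → ℝ} (hR : IsQuadratic R) (i : Fin 2) :
    IsAffineFun (partialDeriv i R) := by
  obtain ⟨a, ha⟩ := isQuadratic_iff.1 hR
  have key : ∀ x, HasFDerivAt R
      ((a 1 + 2 * a 3 * x 0 + a 4 * x 1) • (EuclideanSpace.proj 0 : Pt 2 →L[ℝ] ℝ) +
        (a 2 + a 4 * x 0 + 2 * a 5 * x 1) • (EuclideanSpace.proj 1 : Pt 2 →L[ℝ] ℝ)) x := by
    intro x
    rw [funext ha]
    have h0 := hasFDerivAt_coord 0 x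
    have h1 := hasFDerivAt_coord 1 x
    refine ((((((hasFDerivAt_const (a 0) x).add (h0.const_mul (a 1))).add
      (h1.const_mul (a 2))).add ((h0.pow 2).const_mul (a 3))).add
      ((h0.mul h1).const_mul (a 4))).add ((h1.pow 2).const_mul (a 5))).congr_fderiv ?_
    ext w
    simp
    ring
  fin_cases i
  · refine ⟨a 1, 2 * a 3, a 4, fun x => ?_⟩
    rw [partialDeriv, (key x).fderiv]
    simp
  · refine ⟨a 2, a 4, 2 * a 5, fun x => ?_⟩
    rw [partialDeriv, (key x).fderiv]
    simp

theorem IsQuadratic.fderiv_apply {R : Pt 2 → ℝ} (hR : IsQuadratic R) (w : Pt 2) :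
    IsAffineFun fun x => fderiv ℝ R x w := by
  simp_rw [fderiv_apply_eq_sum, Fin.sum_univ_two]
  exact ((hR.isAffineFun_partialDeriv 0).const_mul _).add
    ((hR.isAffineFun_partialDeriv 1).const_mul _)

theorem IsQuadratic.sum_partialDeriv_partialDeriv {R : Pt 2 → ℝ} (hR : IsQuadratic R) :
    IsQuadratic fun x => ∑ j, partialDeriv j (partialDeriv j R) x := by
  simp_rw [Fin.sum_univ_two]
  exact ((hR.isAffineFun_partialDeriv 0).isQuadratic.isAffineFun_partialDeriv 0).isQuadratic.add
    ((hR.isAffineFun_partialDeriv 1).isQuadratic.isAffineFun_partialDeriv 1).isQuadratic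

theorem isQuadratic_eval {f : MvPolynomial (Fin 2) ℝ} (hf : f.totalDegree ≤ 2) :
    IsQuadratic fun x => MvPolynomial.eval (fun j => x j) f := by
  have e : (fun x : Pt 2 => MvPolynomial.eval (fun j => x j) f) =
      fun x => ∑ s ∈ f.support, MvPolynomial.coeff s f * (x 0 ^ s 0 * x 1 ^ s 1) := by
    funext x
    rw [MvPolynomial.eval_eq']
    simp [Fin.prod_univ_two]
  rw [e]
  have hs : ∀ s ∈ f.support, s 0 + s 1 ≤ 2 := by
    intro s hs
    have := (MvPolynomial.le_totalDegree hs).trans hf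
    rwa [Finsupp.sum_fintype _ _ (by simp), Fin.sum_univ_two] at this
  have : ∀ T : Finset (Fin 2 →₀ ℕ), (∀ s ∈ T, s 0 + s 1 ≤ 2) → IsQuadratic fun x : Pt 2 =>
      ∑ s ∈ T, MvPolynomial.coeff s f * (x 0 ^ s 0 * x 1 ^ s 1) := by
    intro T hT
    induction T using Finset.induction_on with
    | empty => exact ⟨0, fun x => by simp⟩
    | insert s T hsT ih =>
      simp_rw [Finset.sum_insert hsT]
      refine IsQuadratic.add (IsQuadratic.const_mul ?_ _) (ih fun s' hs' => hT s' (by simp [hs']))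
      have h2 := hT s (by simp)
      generalize s 0 = p at h2
      generalize s 1 = q at h2
      rw [isQuadratic_iff]
      have hp : p ≤ 2 := by omega
      have hq : q ≤ 2 := by omega
      interval_cases p <;> interval_cases q <;> first
        | omega
        | (refine ⟨![1, 0, 0, 0, 0, 0], fun x => ?_⟩; simp; done)
        | (refine ⟨![0, 1, 0, 0, 0, 0], fun x => ?_⟩; simp; done)
        | (refine ⟨![0, 0, 1, 0, 0, 0], fun x => ?_⟩; simp; done)
        | (refine ⟨![0, 0, 0, 1, 0, 0], fun x => ?_⟩; simp; done)
        | (refine ⟨![0, 0, 0, 0, 1, 0], fun x => ?_⟩; simp; done)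
        | (refine ⟨![0, 0, 0, 0, 0, 1], fun x => ?_⟩; simp; done)
  exact this _ hs

theorem IsQuadratic.rescale {R : Pt 2 → ℝ} (hR : IsQuadratic R) (m : Pt 2) {ρ : ℝ} (hρ : ρ ≠ 0) :
    ∃ a : Fin 6 → ℝ, ∀ x, R x = ∑ k, a k * quadMonomial k (ρ⁻¹ • (x - m)) := by
  obtain ⟨a, ha⟩ := isQuadratic_iff.1 hR
  refine ⟨![R m, ρ * (a 1 + 2 * a 3 * m 0 + a 4 * m 1), ρ * (a 2 + a 4 * m 0 + 2 * a 5 * m 1),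
    ρ ^ 2 * a 3, ρ ^ 2 * a 4, ρ ^ 2 * a 5], fun x => ?_⟩
  simp [quadMonomial, Fin.sum_univ_six, ha]
  field_simp
  ring

theorem abs_quadMonomial_le (k : Fin 6) {x : Pt 2} {s : ℝ} (hs : 1 ≤ s) (hx : ‖x‖ ≤ s) :
    |quadMonomial k x| ≤ s ^ 2 := by
  have h0 : |x 0| ≤ s := (by simpa using PiLp.norm_apply_le x 0 : |x 0| ≤ ‖x‖).trans hx
  have h1 : |x 1| ≤ s := (by simpa using PiLp.norm_apply_le x 1 : |x 1| ≤ ‖x‖).trans hx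
  have hss : s ≤ s ^ 2 := by nlinarith
  fin_cases k <;> simp [quadMonomial, abs_mul]
  · rw [abs_of_nonneg (by linarith)]; exact hs
  · linarith
  · linarith
  · rw [sq_le_sq, abs_of_nonneg (by linarith : (0:ℝ) ≤ s)]; exact h0
  · rw [sq]; exact mul_le_mul h0 h1 (abs_nonneg _) (by linarith)
  · rw [sq_le_sq, abs_of_nonneg (by linarith : (0:ℝ) ≤ s)]; exact h1

/-! ### Reference bump functions -/

/-- A radial bump function, positive exactly where `2 * ‖x‖ ^ 2 < 1`. -/
def bump (x : Pt 2) : ℝ := Real.smoothTransition (1 - 2 * ‖x‖ ^ 2)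

/-- The products of the bump function with the monomials of degree at most `2`. -/
def refFun (k : Fin 6) (x : Pt 2) : ℝ := bump x * quadMonomial k x

theorem bump_nonneg (x : Pt 2) : 0 ≤ bump x := Real.smoothTransition.nonneg _

theorem bump_pos {x : Pt 2} (hx : 2 * ‖x‖ ^ 2 < 1) : 0 < bump x :=
  Real.smoothTransition.pos_of_pos (by linarith)

theorem contDiff_bump : ContDiff ℝ ∞ bump :=
  Real.smoothTransition.contDiff.comp
    (contDiff_const.sub (contDiff_const.mul (contDiff_norm_sq ℝ)))

theorem tsupport_bump_subset : tsupport bump ⊆ {x | 2 * ‖x‖ ^ 2 ≤ 1} := by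
  refine closure_minimal (fun x hx => ?_) (isClosed_le (by fun_prop) continuous_const)
  by_contra h
  have : 1 < 2 * ‖x‖ ^ 2 := not_le.1 h
  exact hx (Real.smoothTransition.zero_of_nonpos (by linarith))

theorem hasCompactSupport_bump : HasCompactSupport bump := by
  refine HasCompactSupport.of_support_subset_isCompact (isCompact_closedBall (0 : Pt 2) 1) ?_
  refine (subset_tsupport _).trans (tsupport_bump_subset.trans fun x hx => ?_)
  have hx' : 2 * ‖x‖ ^ 2 ≤ 1 := hx
  rw [mem_closedBall_zero_iff]
  nlinarith [norm_nonneg x]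

theorem contDiff_refFun (k : Fin 6) : ContDiff ℝ ∞ (refFun k) :=
  contDiff_bump.mul (contDiff_quadMonomial k)

theorem hasCompactSupport_refFun (k : Fin 6) : HasCompactSupport (refFun k) :=
  hasCompactSupport_bump.mul_right

theorem refFun_eq_zero (k : Fin 6) {x : Pt 2} (hx : 1 ≤ 2 * ‖x‖ ^ 2) : refFun k x = 0 := by
  rw [refFun, bump, Real.smoothTransition.zero_of_nonpos (by linarith), zero_mul]

theorem exists_bound_refFun : ∃ M : ℝ, 0 < M ∧ ∀ k x, |refFun k x| ≤ M ∧
    ∀ i, |partialDeriv i (refFun k) x| ≤ M ∧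
      |partialDeriv i (partialDeriv i (refFun k)) x| ≤ M := by
  have hb : ∀ {f : Pt 2 → ℝ}, Continuous f → HasCompactSupport f → ∃ M : ℝ, ∀ x, |f x| ≤ M := by
    intro f hf hc
    obtain ⟨M, hM⟩ := hc.exists_bound_of_continuous hf
    exact ⟨M, fun x => by simpa using hM x⟩
  have c0 := fun k => hb (contDiff_refFun k).continuous (hasCompactSupport_refFun k)
  have d1 : ∀ k i, ContDiff ℝ ∞ (partialDeriv i (refFun k)) := fun k i =>
    contDiff_partialDeriv (contDiff_refFun k) (by simp) i
  have d2 : ∀ k i, ContDiff ℝ ∞ (partialDeriv i (partialDeriv i (refFun k))) := fun k i =>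
    contDiff_partialDeriv (d1 k i) (by simp) i
  have c1 := fun k i => hb (d1 k i).continuous
    (hasCompactSupport_partialDeriv (hasCompactSupport_refFun k) i)
  have c2 := fun k i => hb (d2 k i).continuous (hasCompactSupport_partialDeriv
    (hasCompactSupport_partialDeriv (hasCompactSupport_refFun k) i) i)
  choose M0 h0 using c0
  choose M1 h1 using c1
  choose M2 h2 using c2
  refine ⟨1 + (∑ k, |M0 k| + ∑ k, ∑ i, |M1 k i| + ∑ k, ∑ i, |M2 k i|), by positivity,
    fun k x => ⟨?_, fun i => ⟨?_, ?_⟩⟩⟩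
  · have : |M0 k| ≤ ∑ k, |M0 k| :=
      Finset.single_le_sum (f := fun k => |M0 k|) (fun _ _ => abs_nonneg _) (Finset.mem_univ k)
    have p1 : 0 ≤ ∑ k, ∑ i, |M1 k i| := by positivity
    have p2 : 0 ≤ ∑ k, ∑ i, |M2 k i| := by positivity
    linarith [h0 k x, le_abs_self (M0 k)]
  · have e1 : |M1 k i| ≤ ∑ i, |M1 k i| :=
      Finset.single_le_sum (f := fun i => |M1 k i|) (fun _ _ => abs_nonneg _) (Finset.mem_univ i)
    have e2 : ∑ i, |M1 k i| ≤ ∑ k, ∑ i, |M1 k i| :=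
      Finset.single_le_sum (f := fun k => ∑ i, |M1 k i|) (fun _ _ => by positivity)
        (Finset.mem_univ k)
    have p1 : 0 ≤ ∑ k, |M0 k| := by positivity
    have p2 : 0 ≤ ∑ k, ∑ i, |M2 k i| := by positivity
    linarith [h1 k i x, le_abs_self (M1 k i)]
  · have e1 : |M2 k i| ≤ ∑ i, |M2 k i| :=
      Finset.single_le_sum (f := fun i => |M2 k i|) (fun _ _ => abs_nonneg _) (Finset.mem_univ i)
    have e2 : ∑ i, |M2 k i| ≤ ∑ k, ∑ i, |M2 k i| :=
      Finset.single_le_sum (f := fun k => ∑ i, |M2 k i|) (fun _ _ => by positivity)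
        (Finset.mem_univ k)
    have p1 : 0 ≤ ∑ k, |M0 k| := by positivity
    have p2 : 0 ≤ ∑ k, ∑ i, |M1 k i| := by positivity
    linarith [h2 k i x, le_abs_self (M2 k i)]

/-- The Gram matrix of the monomials with respect to the weight `bump` is invertible. Its inverse
yields the basis dual to the monomials. -/
theorem exists_dual_refFun : ∃ G : Fin 6 → Fin 6 → ℝ, ∀ k l,
    ∫ x, (∑ j, G k j * refFun j x) * quadMonomial l x = if k = l then 1 else 0 := by
  let A : Matrix (Fin 6) (Fin 6) ℝ := fun j l => ∫ x, refFun j x * quadMonomial l x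
  have hint : ∀ j l, Integrable fun x => refFun j x * quadMonomial l x := fun j l =>
    ((contDiff_refFun j).continuous.mul
      (contDiff_quadMonomial l).continuous).integrable_of_hasCompactSupport
      (hasCompactSupport_refFun j).mul_right
  have hdet : A.det ≠ 0 := by
    intro h0
    obtain ⟨v, hv, hAv⟩ := Matrix.exists_mulVec_eq_zero_iff.2 h0
    obtain ⟨q, hq⟩ : ∃ q : Pt 2 → ℝ, q = fun x => ∑ k, v k * quadMonomial k x := ⟨_, rfl⟩
    have hqc : Continuous q := (IsQuadratic.contDiff ⟨v, fun x => by rw [hq]⟩).continuous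
    have e : ∫ x, bump x * q x ^ 2 = 0 := by
      have e1 : ∀ x, bump x * q x ^ 2 = ∑ j, v j * ∑ l, v l * (refFun j x * quadMonomial l x) := by
        intro x
        simp only [hq, refFun, sq, Finset.mul_sum, Finset.sum_mul]
        refine Finset.sum_comm.trans (Finset.sum_congr rfl fun j _ =>
          Finset.sum_congr rfl fun l _ => by ring)
      simp_rw [e1]
      rw [integral_finsetSum _ fun j _ => (integrable_finsetSum _ fun l _ =>
        (hint j l).const_mul _).const_mul _]
      refine Finset.sum_eq_zero fun j _ => ?_
      rw [integral_const_mul, integral_finsetSum _ fun l _ => (hint j l).const_mul _]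
      simp_rw [integral_const_mul]
      have := congrFun hAv j
      simp only [Matrix.mulVec, dotProduct, Pi.zero_apply] at this
      have e2 : ∑ l, v l * ∫ x, refFun j x * quadMonomial l x = 0 := by
        rw [← this]
        exact Finset.sum_congr rfl fun l _ => mul_comm _ _
      rw [e2, mul_zero]
    have hz : ∀ x : Pt 2, 2 * ‖x‖ ^ 2 < 1 → q x = 0 := by
      intro x hx
      by_contra hqx
      have hcs : HasCompactSupport fun x => bump x * q x ^ 2 :=
        hasCompactSupport_bump.mono fun x hx h0 => hx (by
          change bump x * q x ^ 2 = 0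
          rw [h0, zero_mul])
      have hne : bump x * q x ^ 2 ≠ 0 := mul_ne_zero (bump_pos hx).ne' (pow_ne_zero 2 hqx)
      have := Continuous.integral_pos_of_hasCompactSupport_nonneg_nonzero (μ := volume)
        (f := fun x => bump x * q x ^ 2) (x := x)
        (contDiff_bump.continuous.mul (hqc.pow 2))
        hcs
        (fun x => mul_nonneg (bump_nonneg x) (sq_nonneg (q x)))
        hne
      linarith
    have hp : ∀ a b : ℝ, 2 * (a ^ 2 + b ^ 2) < 1 →
        v 0 + v 1 * a + v 2 * b + v 3 * a ^ 2 + v 4 * (a * b) + v 5 * b ^ 2 = 0 := by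
      intro a b hab
      have := hz !₂[a, b] (by rw [EuclideanSpace.norm_sq_eq]; simpa [Fin.sum_univ_two] using hab)
      simpa [hq, quadMonomial, Fin.sum_univ_six] using this
    have p1 := hp 0 0 (by norm_num)
    have p2 := hp (1/4) 0 (by norm_num)
    have p3 := hp (-1/4) 0 (by norm_num)
    have p4 := hp 0 (1/4) (by norm_num)
    have p5 := hp 0 (-1/4) (by norm_num)
    have p6 := hp (1/4) (1/4) (by norm_num)
    refine hv (funext fun k => ?_)
    fin_cases k <;> simp <;> linarith
  refine ⟨fun k j => A⁻¹ k j, fun k l => ?_⟩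
  simp_rw [Finset.sum_mul, mul_assoc]
  rw [integral_finsetSum _ fun j _ => (hint j l).const_mul _]
  simp_rw [integral_const_mul]
  have := congrFun (congrFun (Matrix.nonsing_inv_mul A (isUnit_iff_ne_zero.2 hdet)) k) l
  rw [Matrix.mul_apply, Matrix.one_apply] at this
  exact this

/-! ### Scaled test functions -/

/-- The test function with coefficients `c`, supported in the ball of radius `ρ` around `m`. -/
def testFun (c : Fin 6 → ℝ) (m : Pt 2) (ρ : ℝ) (x : Pt 2) : ℝ :=
  ∑ k, c k * refFun k (ρ⁻¹ • (x - m))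

theorem contDiff_testFun (c : Fin 6 → ℝ) (m : Pt 2) (ρ : ℝ) : ContDiff ℝ ∞ (testFun c m ρ) := by
  refine ContDiff.sum fun k _ => contDiff_const.mul ((contDiff_refFun k).comp ?_)
  fun_prop

theorem tsupport_testFun_subset (c : Fin 6 → ℝ) (m : Pt 2) {ρ : ℝ} (hρ : 0 < ρ) :
    tsupport (testFun c m ρ) ⊆ Metric.ball m ρ := by
  have h1 : tsupport (testFun c m ρ) ⊆ {x | 2 * ‖x - m‖ ^ 2 ≤ ρ ^ 2} := by
    refine closure_minimal (fun x hx => ?_) (isClosed_le (by fun_prop) continuous_const)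
    by_contra h
    have h' : ρ ^ 2 < 2 * ‖x - m‖ ^ 2 := not_le.1 h
    refine hx (Finset.sum_eq_zero fun k _ => ?_)
    rw [refFun_eq_zero, mul_zero]
    rw [norm_smul, mul_pow, norm_inv, inv_pow, Real.norm_eq_abs, sq_abs]
    rw [show 2 * ((ρ ^ 2)⁻¹ * ‖x - m‖ ^ 2) = (2 * ‖x - m‖ ^ 2) / ρ ^ 2 by field_simp,
      le_div_iff₀ (by positivity)]
    linarith
  refine h1.trans fun x hx => ?_
  have hx' : 2 * ‖x - m‖ ^ 2 ≤ ρ ^ 2 := hx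
  rw [mem_ball_iff_norm]
  nlinarith [norm_nonneg (x - m)]

theorem hasCompactSupport_testFun (c : Fin 6 → ℝ) (m : Pt 2) {ρ : ℝ} (hρ : 0 < ρ) :
    HasCompactSupport (testFun c m ρ) :=
  HasCompactSupport.of_support_subset_isCompact (isCompact_closedBall m ρ)
    ((subset_tsupport _).trans ((tsupport_testFun_subset c m hρ).trans
      Metric.ball_subset_closedBall))

theorem partialDeriv_sum_scaled (f : Fin 6 → Pt 2 → ℝ) (hf : ∀ k, ContDiff ℝ ∞ (f k))
    (c : Fin 6 → ℝ) (m : Pt 2) (ρ : ℝ) (i : Fin 2) (x : Pt 2) :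
    partialDeriv i (fun x => ∑ k, c k * f k (ρ⁻¹ • (x - m))) x =
      ∑ k, (ρ⁻¹ * c k) * partialDeriv i (f k) (ρ⁻¹ • (x - m)) := by
  have h1 : HasFDerivAt (fun x : Pt 2 => ρ⁻¹ • (x - m)) (ρ⁻¹ • ContinuousLinearMap.id ℝ (Pt 2)) x :=
    ((hasFDerivAt_id x).sub_const m).const_smul ρ⁻¹
  have h2 : HasFDerivAt (fun x => ∑ k, c k * f k (ρ⁻¹ • (x - m)))
      (∑ k, c k • (fderiv ℝ (f k) (ρ⁻¹ • (x - m))).comp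
        (ρ⁻¹ • ContinuousLinearMap.id ℝ (Pt 2))) x :=
    HasFDerivAt.fun_sum fun k _ =>
      ((((hf k).differentiable (by simp)) _).hasFDerivAt.comp x h1).const_mul _
  rw [partialDeriv, h2.fderiv]
  simp only [FunLike.coe_sum, Finset.sum_apply]
  refine Finset.sum_congr rfl fun k _ => ?_
  simp [partialDeriv]
  ring

theorem partialDeriv_testFun (c : Fin 6 → ℝ) (m : Pt 2) (ρ : ℝ) (i : Fin 2) (x : Pt 2) :
    partialDeriv i (testFun c m ρ) x =
      ∑ k, (ρ⁻¹ * c k) * partialDeriv i (refFun k) (ρ⁻¹ • (x - m)) :=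
  partialDeriv_sum_scaled refFun contDiff_refFun c m ρ i x

theorem partialDeriv_partialDeriv_testFun (c : Fin 6 → ℝ) (m : Pt 2) (ρ : ℝ) (i : Fin 2)
    (x : Pt 2) :
    partialDeriv i (partialDeriv i (testFun c m ρ)) x =
      ∑ k, (ρ⁻¹ * (ρ⁻¹ * c k)) * partialDeriv i (partialDeriv i (refFun k)) (ρ⁻¹ • (x - m)) := by
  rw [funext (partialDeriv_testFun c m ρ i)]
  exact partialDeriv_sum_scaled (fun k => partialDeriv i (refFun k))
    (fun k => contDiff_partialDeriv (contDiff_refFun k) (by simp) i) _ m ρ i x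

theorem exists_bound_testFun : ∃ M : ℝ, 0 < M ∧ ∀ (c : Fin 6 → ℝ) (Γ : ℝ) (m : Pt 2) (ρ : ℝ),
    (∀ k, |c k| ≤ Γ) → 0 < ρ → ∀ x, |testFun c m ρ x| ≤ M * Γ ∧
      ∀ i, |partialDeriv i (testFun c m ρ) x| ≤ M * Γ / ρ ∧
        |partialDeriv i (partialDeriv i (testFun c m ρ)) x| ≤ M * Γ / ρ ^ 2 := by
  obtain ⟨M, hM, h⟩ := exists_bound_refFun
  refine ⟨6 * M, by positivity, fun c Γ m ρ hc hρ x => ?_⟩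
  have hΓ : 0 ≤ Γ := (abs_nonneg _).trans (hc 0)
  have key : ∀ (g : Fin 6 → ℝ) (s : ℝ), 0 < s → (∀ k, |g k| ≤ M) →
      |∑ k, (s * c k) * g k| ≤ 6 * M * Γ * s := by
    intro g s hs hg
    refine (Finset.abs_sum_le_sum_abs _ _).trans ?_
    have : ∀ k ∈ Finset.univ, |(s * c k) * g k| ≤ s * Γ * M := by
      intro k _
      rw [abs_mul, abs_mul, abs_of_pos hs]
      exact mul_le_mul (mul_le_mul_of_nonneg_left (hc k) hs.le) (hg k) (abs_nonneg _)
          (by positivity)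
    refine (Finset.sum_le_sum this).trans (le_of_eq ?_)
    simp
    ring
  refine ⟨?_, fun i => ⟨?_, ?_⟩⟩
  · simpa [testFun] using key (fun k => refFun k (ρ⁻¹ • (x - m))) 1 one_pos fun k => (h k _).1
  · rw [partialDeriv_testFun]
    exact key _ ρ⁻¹ (by positivity) fun k => ((h k _).2 i).1
  · rw [partialDeriv_partialDeriv_testFun]
    have := key (fun k => partialDeriv i (partialDeriv i (refFun k)) (ρ⁻¹ • (x - m))) (ρ ^ 2)⁻¹
      (by positivity) fun k => ((h k _).2 i).2
    rw [div_eq_mul_inv]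
    convert this using 4
    rw [sq, mul_inv, mul_assoc]

/-- A quadratic polynomial is controlled, on a ball and on its dilations, by its integrals against
the test functions supported in the ball. -/
theorem exists_bound_quadratic : ∃ Γ : ℝ, 0 < Γ ∧ ∀ R, IsQuadratic R → ∀ (m : Pt 2) (ρ s E : ℝ),
    0 < ρ → 1 ≤ s →
    (∀ c : Fin 6 → ℝ, (∀ k, |c k| ≤ Γ) → |∫ x, R x * testFun c m ρ x| ≤ E) →
    ∀ x, ‖x - m‖ ≤ s * ρ → ρ ^ 2 * |R x| ≤ 6 * s ^ 2 * E := by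
  obtain ⟨G, hG⟩ := exists_dual_refFun
  refine ⟨1 + ∑ k, ∑ j, |G k j|, by positivity, fun R hR m ρ s E hρ hs hE x hx => ?_⟩
  obtain ⟨a, ha⟩ := hR.rescale m hρ.ne'
  have hcoef : ∀ k, ρ ^ 2 * |a k| ≤ E := by
    intro k
    have hGk : ∀ j, |G k j| ≤ 1 + ∑ k, ∑ j, |G k j| := by
      intro j
      have e1 : |G k j| ≤ ∑ j, |G k j| :=
        Finset.single_le_sum (f := fun j => |G k j|) (fun _ _ => abs_nonneg _) (Finset.mem_univ j)
      have e2 : ∑ j, |G k j| ≤ ∑ k, ∑ j, |G k j| :=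
        Finset.single_le_sum (f := fun k => ∑ j, |G k j|) (fun _ _ => by positivity)
          (Finset.mem_univ k)
      linarith
    have e : ∫ x, R x * testFun (G k) m ρ x = ρ ^ 2 * a k := by
      let H : Pt 2 → ℝ := fun ξ => (∑ l, a l * quadMonomial l ξ) * ∑ j, G k j * refFun j ξ
      have e1 : ∀ x, R x * testFun (G k) m ρ x = H (ρ⁻¹ • (x - m)) := fun x => by
        rw [ha x, testFun]
      simp_rw [e1]
      rw [integral_sub_right_eq_self (fun x => H (ρ⁻¹ • x)) m,
        Measure.integral_comp_inv_smul_of_nonneg _ _ hρ.le]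
      simp only [finrank_euclideanSpace, Fintype.card_fin, smul_eq_mul]
      congr 1
      have e2 : ∀ ξ, H ξ = ∑ l, a l * ((∑ j, G k j * refFun j ξ) * quadMonomial l ξ) := fun ξ => by
        simp only [H, Finset.sum_mul (s := Finset.univ) (f := fun l => a l * quadMonomial l ξ)]
        exact Finset.sum_congr rfl fun l _ => by ring
      have hi : ∀ l, Integrable fun ξ => (∑ j, G k j * refFun j ξ) * quadMonomial l ξ := by
        intro l
        simp_rw [Finset.sum_mul, mul_assoc]
        exact integrable_finsetSum _ fun j _ => Integrable.const_mul
          (((contDiff_refFun j).continuous.mul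
            (contDiff_quadMonomial l).continuous).integrable_of_hasCompactSupport
            (hasCompactSupport_refFun j).mul_right) _
      simp_rw [e2]
      rw [integral_finsetSum _ fun l _ => (hi l).const_mul _]
      simp_rw [integral_const_mul, hG]
      simp
    have := hE (G k) hGk
    rwa [e, abs_mul, abs_of_pos (by positivity)] at this
  have hξ : ‖ρ⁻¹ • (x - m)‖ ≤ s := by
    rw [norm_smul, norm_inv, Real.norm_eq_abs, abs_of_pos hρ, inv_mul_le_iff₀ hρ]
    linarith
  rw [ha x]
  calc ρ ^ 2 * |∑ k, a k * quadMonomial k (ρ⁻¹ • (x - m))|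
      ≤ ρ ^ 2 * ∑ k, |a k| * s ^ 2 := by
        refine mul_le_mul_of_nonneg_left ((Finset.abs_sum_le_sum_abs _ _).trans
          (Finset.sum_le_sum fun k _ => ?_)) (by positivity)
        rw [abs_mul]
        exact mul_le_mul_of_nonneg_left (abs_quadMonomial_le k hs hξ) (abs_nonneg _)
    _ = ∑ k, s ^ 2 * (ρ ^ 2 * |a k|) := by
        rw [Finset.mul_sum]
        exact Finset.sum_congr rfl fun k _ => by ring
    _ ≤ ∑ k : Fin 6, s ^ 2 * E :=
        Finset.sum_le_sum fun k _ => mul_le_mul_of_nonneg_left (hcoef k) (by positivity)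
    _ = 6 * s ^ 2 * E := by simp; ring

/-- An affine function on a line is controlled, on a segment and on its dilations, by its integrals
against the restrictions of the test functions. The two test functions used are an even and an odd
one, which separate the value at the midpoint from the slope. -/
theorem exists_bound_affine_line : ∃ Γ : ℝ, 0 < Γ ∧ ∀ J, IsAffineFun J →
    ∀ (m τ : Pt 2) (ρ s E : ℝ), ‖τ‖ = 1 → 0 < ρ → 1 ≤ s →
    (∀ c : Fin 6 → ℝ, (∀ k, |c k| ≤ s * Γ) →
      |∫ t : ℝ, testFun c m ρ (m + t • τ) * J (m + t • τ)| ≤ E) →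
    ∀ t : ℝ, |t| ≤ s * ρ → ρ * |J (m + t • τ)| ≤ E := by
  set g : ℝ → ℝ := fun t => Real.smoothTransition (1 - 2 * t ^ 2) with hg
  have hgc : Continuous g := Real.smoothTransition.continuous.comp (by fun_prop)
  have hgs : HasCompactSupport g := by
    refine HasCompactSupport.of_support_subset_isCompact (isCompact_Icc (a := (-1:ℝ)) (b := 1)) ?_
    intro t ht
    by_contra h
    refine ht (Real.smoothTransition.zero_of_nonpos ?_)
    have : 1 < |t| := by
      by_contra h'
      exact h (abs_le.1 (not_lt.1 h'))
    nlinarith [sq_abs t]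
  have hgn : ∀ t, 0 ≤ g t := fun t => Real.smoothTransition.nonneg _
  have hgp : ∀ t, 2 * t ^ 2 < 1 → 0 < g t := fun t ht =>
    Real.smoothTransition.pos_of_pos (by linarith)
  have hint : ∀ n : ℕ, Integrable fun t => t ^ n * g t := fun n =>
    ((continuous_pow n).mul hgc).integrable_of_hasCompactSupport
      (hgs.mul_left (f := fun t : ℝ => t ^ n))
  set μ₀ := ∫ t, g t with hμ₀
  set μ₂ := ∫ t, t ^ 2 * g t with hμ₂
  have h0 : 0 < μ₀ := hgc.integral_pos_of_hasCompactSupport_nonneg_nonzero hgs hgn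
    (x := 0) (hgp 0 (by norm_num)).ne'
  have h2 : 0 < μ₂ := Continuous.integral_pos_of_hasCompactSupport_nonneg_nonzero
    ((continuous_pow 2).mul hgc) (hgs.mul_left (f := fun t : ℝ => t ^ 2))
    (fun t => mul_nonneg (sq_nonneg t) (hgn t)) (x := 1 / 2)
    (mul_pos (by norm_num) (hgp (1 / 2) (by norm_num))).ne'
  have h1 : ∫ t, t * g t = 0 := by
    have := integral_neg_eq_self (fun t => t * g t) volume
    simp only [hg, neg_sq, neg_mul, integral_neg] at this ⊢
    linarith
  refine ⟨1 / μ₀ + 1 / μ₂, by positivity, fun J hJ m τ ρ s E hτ hρ hs hE t ht => ?_⟩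
  obtain ⟨b₀, b₁, b₂, hb⟩ := hJ
  set t₀ := ρ⁻¹ * t with ht₀
  have ht₀s : |t₀| ≤ s := by
    rw [ht₀, abs_mul, abs_of_pos (inv_pos.2 hρ), inv_mul_le_iff₀ hρ]
    linarith
  have hττ : τ 0 ^ 2 + τ 1 ^ 2 = 1 := by
    have := EuclideanSpace.norm_sq_eq τ
    rw [hτ] at this
    simpa [Fin.sum_univ_two] using this.symm
  have hτ0 : |τ 0| ≤ 1 := by simpa [hτ] using PiLp.norm_apply_le τ 0
  have hτ1 : |τ 1| ≤ 1 := by simpa [hτ] using PiLp.norm_apply_le τ 1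
  have hc : ∀ k, |![1 / μ₀, t₀ / μ₂ * τ 0, t₀ / μ₂ * τ 1, 0, 0, 0] k| ≤ s * (1 / μ₀ + 1 / μ₂) := by
    have e0 : 1 / μ₀ ≤ s * (1 / μ₀ + 1 / μ₂) := by
      have : 0 < 1 / μ₂ := by positivity
      have : 0 < 1 / μ₀ := by positivity
      nlinarith
    have e2 : ∀ z : ℝ, |z| ≤ 1 → |t₀ / μ₂ * z| ≤ s * (1 / μ₀ + 1 / μ₂) := by
      intro z hz
      rw [abs_mul, abs_div, abs_of_pos h2]
      have : |t₀| / μ₂ ≤ s * (1 / μ₂) := by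
        rw [mul_one_div]
        gcongr
      have h3 : 0 < s * (1 / μ₀) := by positivity
      have h4 : 0 ≤ |t₀| / μ₂ := by positivity
      nlinarith [abs_nonneg z]
    intro k
    have hp : 0 ≤ s * (1 / μ₀ + 1 / μ₂) := by positivity
    fin_cases k
    · simpa [abs_of_pos h0] using e0
    · exact e2 _ hτ0
    · exact e2 _ hτ1
    all_goals simpa using hp
  have hE' := hE _ hc
  set J₀ := b₀ + b₁ * m 0 + b₂ * m 1 with hJ₀
  set J₁ := ρ * (b₁ * τ 0 + b₂ * τ 1) with hJ₁
  have e1 : ∀ t : ℝ, testFun ![1 / μ₀, t₀ / μ₂ * τ 0, t₀ / μ₂ * τ 1, 0, 0, 0] m ρ (m + t • τ) *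
      J (m + t • τ) = (fun t => g t * (1 / μ₀ + t₀ / μ₂ * t) * (J₀ + J₁ * t)) (ρ⁻¹ * t) := by
    intro t
    have eb : bump ((ρ⁻¹ * t) • τ) = g (ρ⁻¹ * t) := by
      rw [bump, norm_smul, hτ, mul_one, Real.norm_eq_abs, sq_abs]
    have eJ : J (m + t • τ) = J₀ + J₁ * (ρ⁻¹ * t) := by
      rw [hb, hJ₀, hJ₁]
      simp
      field_simp
      ring
    have eT : testFun ![1 / μ₀, t₀ / μ₂ * τ 0, t₀ / μ₂ * τ 1, 0, 0, 0] m ρ (m + t • τ) =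
        g (ρ⁻¹ * t) * (1 / μ₀ + t₀ / μ₂ * (ρ⁻¹ * t)) := by
      rw [testFun]
      simp only [add_sub_cancel_left, smul_smul, refFun, eb]
      simp [Fin.sum_univ_six, quadMonomial]
      linear_combination (t₀ / μ₂ * g (ρ⁻¹ * t) * (ρ⁻¹ * t)) * hττ
    simp only [eT, eJ]
  rw [funext e1] at hE'
  rw [Measure.integral_comp_inv_mul_left (fun t => g t * (1 / μ₀ + t₀ / μ₂ * t) * (J₀ + J₁ * t)),
    abs_of_pos hρ, smul_eq_mul] at hE'
  have e2 : ∫ t, g t * (1 / μ₀ + t₀ / μ₂ * t) * (J₀ + J₁ * t) = J₀ + J₁ * t₀ := by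
    have : ∀ t, g t * (1 / μ₀ + t₀ / μ₂ * t) * (J₀ + J₁ * t) =
        (J₀ / μ₀) * (t ^ 0 * g t) + (J₁ / μ₀ + J₀ * t₀ / μ₂) * (t ^ 1 * g t) +
          (J₁ * t₀ / μ₂) * (t ^ 2 * g t) := fun t => by ring
    simp_rw [this]
    have i01 : Integrable fun t => (J₀ / μ₀) * (t ^ 0 * g t) +
        (J₁ / μ₀ + J₀ * t₀ / μ₂) * (t ^ 1 * g t) :=
      ((hint 0).const_mul _).add ((hint 1).const_mul _)
    rw [integral_add i01 ((hint 2).const_mul _),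
      integral_add ((hint 0).const_mul _) ((hint 1).const_mul _), integral_const_mul,
      integral_const_mul, integral_const_mul]
    simp only [pow_zero, one_mul, pow_one, h1]
    rw [← hμ₀, ← hμ₂]
    field_simp
    ring
  have e3 : J (m + t • τ) = J₀ + J₁ * t₀ := by
    rw [hb, hJ₀, hJ₁, ht₀]
    simp
    field_simp
    ring
  rw [e2] at hE'
  rw [e3, ← abs_of_pos hρ, ← abs_mul]
  exact hE'

/-! ### Test functions in the weak equations -/

theorem weightedMeasure_one (Ω : Set (Pt 2)) : weightedMeasure one Ω = volume.restrict Ω := by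
  simp [weightedMeasure, one]

theorem IsTestFunction.of_tsupport_subset_ball {Ω : Set (Pt 2)} {φ : Pt 2 → ℝ} {m : Pt 2} {ρ : ℝ}
    (hφ : ContDiff ℝ ∞ φ) (h : tsupport φ ⊆ Metric.ball m ρ) (hB : Metric.ball m ρ ⊆ Ω) :
    IsTestFunction Ω φ where
  contDiff := hφ
  hasCompactSupport := HasCompactSupport.of_support_subset_isCompact (isCompact_closedBall m ρ)
    ((subset_tsupport _).trans (h.trans Metric.ball_subset_closedBall))
  tsupport_subset := h.trans hB

theorem IsTestFunction.partialDeriv {Ω : Set (Pt 2)} {φ : Pt 2 → ℝ} (hφ : IsTestFunction Ω φ)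
    (i : Fin 2) : IsTestFunction Ω (partialDeriv i φ) where
  contDiff := contDiff_partialDeriv hφ.contDiff (by simp) i
  hasCompactSupport := hasCompactSupport_partialDeriv hφ.hasCompactSupport i
  tsupport_subset := (tsupport_partialDeriv_subset φ i).trans hφ.tsupport_subset

theorem IsTestFunction.const_mul {Ω : Set (Pt 2)} {φ : Pt 2 → ℝ} (hφ : IsTestFunction Ω φ)
    (c : ℝ) : IsTestFunction Ω fun x => φ x * c where
  contDiff := hφ.contDiff.mul contDiff_const
  hasCompactSupport := hφ.hasCompactSupport.mul_right
  tsupport_subset := (tsupport_mul_subset_left (f := φ) (g := fun _ => c)).trans hφ.tsupport_subset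

theorem IsTestFunction.continuous {Ω : Set (Pt 2)} {φ : Pt 2 → ℝ} (hφ : IsTestFunction Ω φ) :
    Continuous φ := hφ.contDiff.continuous

theorem IsTestFunction.memLp {Ω : Set (Pt 2)} {φ : Pt 2 → ℝ} (hφ : IsTestFunction Ω φ)
    (μ : Measure (Pt 2)) [IsFiniteMeasureOnCompacts μ] : MemLp φ 2 μ :=
  hφ.continuous.memLp_of_hasCompactSupport hφ.hasCompactSupport

theorem IsTestFunction.eq_zero {Ω : Set (Pt 2)} {φ : Pt 2 → ℝ} (hφ : IsTestFunction Ω φ)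
    {x : Pt 2} (hx : x ∉ Ω) : φ x = 0 :=
  image_eq_zero_of_notMem_tsupport fun h => hx (hφ.tsupport_subset h)

theorem continuous_gradient {φ : Pt 2 → ℝ} (hφ : ContDiff ℝ ∞ φ) : Continuous (gradient φ) := by
  rw [show gradient φ = fun x => WithLp.toLp 2 (fun i => partialDeriv i φ x) from
    funext (gradient_eq_toLp φ)]
  have : ∀ i, Continuous (partialDeriv i φ) := fun i =>
    continuous_partialDeriv (hφ.of_le (by simp)) i
  fun_prop

theorem hasCompactSupport_gradient {φ : Pt 2 → ℝ} (hφ : HasCompactSupport φ) :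
    HasCompactSupport (gradient φ) := by
  refine (hφ.fderiv ℝ).mono' fun x hx => subset_tsupport _ ?_
  rw [Function.mem_support] at hx ⊢
  intro h
  exact hx (by simp [gradient, h])

theorem IsTestFunction.memH10 {Ω : Set (Pt 2)} {φ : Pt 2 → ℝ} (hφ : IsTestFunction Ω φ) :
    MemH10 one Ω φ (gradient φ) where
  memLp := by
    rw [weightedMeasure_one]
    exact hφ.memLp _
  memLp_grad := by
    rw [weightedMeasure_one]
    exact (continuous_gradient hφ.contDiff).memLp_of_hasCompactSupport
      (hasCompactSupport_gradient hφ.hasCompactSupport)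
  weakGradient :=
    { locallyIntegrable := hφ.continuous.locallyIntegrable.locallyIntegrableOn _
      locallyIntegrable_grad :=
        (continuous_gradient hφ.contDiff).locallyIntegrable.locallyIntegrableOn _
      integral_eq := by
        intro η hη
        rw [setIntegral_eq_integral_of_forall_compl_eq_zero
            (fun x hx => by rw [hφ.eq_zero hx, zero_smul]),
          setIntegral_eq_integral_of_forall_compl_eq_zero
            (fun x hx => by rw [hη.eq_zero hx, zero_smul])]
        have i1 : Integrable fun x => φ x • gradient η x :=
          (hφ.continuous.smul (continuous_gradient hη.contDiff)).integrable_of_hasCompactSupport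
            hφ.hasCompactSupport.smul_right
        have i2 : Integrable fun x => η x • gradient φ x :=
          (hη.continuous.smul (continuous_gradient hφ.contDiff)).integrable_of_hasCompactSupport
            hη.hasCompactSupport.smul_right
        ext i
        have e1 := (EuclideanSpace.proj i : Pt 2 →L[ℝ] ℝ).integral_comp_comm i1
        have e2 := (EuclideanSpace.proj i : Pt 2 →L[ℝ] ℝ).integral_comp_comm i2
        simp only [PiLp.proj_apply, PiLp.smul_apply, smul_eq_mul, gradient_apply] at e1 e2
        rw [PiLp.neg_apply, ← e1, ← e2]
        have := integral_mul_fderiv_eq_neg_fderiv_mul_of_integrable (μ := volume)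
          (f := φ) (g := η) (v := EuclideanSpace.single i 1)
          (by
            have := integrable_mul_of_hasCompactSupport (continuous_partialDeriv
              (hφ.contDiff.of_le (by simp)) i) hη.continuous hη.hasCompactSupport Set.univ
            rwa [integrableOn_univ] at this)
          (by
            have := integrable_mul_of_hasCompactSupport hφ.continuous
              (continuous_partialDeriv (hη.contDiff.of_le (by simp)) i)
              (hasCompactSupport_partialDeriv hη.hasCompactSupport i) Set.univ
            rwa [integrableOn_univ] at this)
          (by
            have := integrable_mul_of_hasCompactSupport hφ.continuous hη.continuous
              hη.hasCompactSupport Set.univ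
            rwa [integrableOn_univ] at this)
          (fun x _ => hφ.contDiff.differentiable (by simp) x)
          (fun x _ => hη.contDiff.differentiable (by simp) x)
        refine this.trans ?_
        congr 1
        exact integral_congr_ae (Eventually.of_forall fun x => mul_comm _ _) }
  closure := ⟨fun _ => φ,
    { test := fun _ => hφ
      tendsto := by simp
      tendsto_grad := by simp }⟩

theorem integrableOn_mul_test {Ω : Set (Pt 2)} {f g : Pt 2 → ℝ}
    (hf : MemLp f 2 (volume.restrict Ω)) (hg : IsTestFunction Ω g) :
    IntegrableOn (fun x => f x * g x) Ω :=
  hf.integrable_mul (hg.memLp _)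

theorem HasWeakGradient.integral_mul_partialDeriv {Ω : Set (Pt 2)} {v : Pt 2 → ℝ}
    {g : Pt 2 → Pt 2} (h : HasWeakGradient Ω v g) (hv : MemLp v 2 (volume.restrict Ω))
    (hg : MemLp g 2 (volume.restrict Ω)) {φ : Pt 2 → ℝ} (hφ : IsTestFunction Ω φ) (i : Fin 2) :
    ∫ x in Ω, v x * partialDeriv i φ x = - ∫ x in Ω, φ x * g x i := by
  have i1 : IntegrableOn (fun x => v x • gradient φ x) Ω := by
    have : MemLp (gradient φ) 2 (volume.restrict Ω) :=
      (continuous_gradient hφ.contDiff).memLp_of_hasCompactSupport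
        (hasCompactSupport_gradient hφ.hasCompactSupport)
    exact memLp_one_iff_integrable.1 (this.smul hv)
  have i2 : IntegrableOn (fun x => φ x • g x) Ω :=
    memLp_one_iff_integrable.1 (hg.smul (hφ.memLp _))
  have e1 := (EuclideanSpace.proj i : Pt 2 →L[ℝ] ℝ).integral_comp_comm i1
  have e2 := (EuclideanSpace.proj i : Pt 2 →L[ℝ] ℝ).integral_comp_comm i2
  simp only [PiLp.proj_apply, PiLp.smul_apply, smul_eq_mul, gradient_apply] at e1 e2
  rw [e1, e2, h.integral_eq φ hφ, PiLp.neg_apply]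

/-- The momentum equation, tested with `φ eᵢ`, with all derivatives on the test function. -/
theorem TrackingProblem.IsState.integral_test {P : TrackingProblem 2} {y u : Pt 2 → Pt 2}
    {p : Pt 2 → ℝ} (h : P.IsState y p u) {φ : Pt 2 → ℝ}
    (hφ : IsTestFunction P.Ω φ) (i : Fin 2) :
    (∫ x in P.Ω, y x i * ∑ k, partialDeriv k (partialDeriv k φ) x) +
      (∫ x in P.Ω, p x * partialDeriv i φ x) + (∫ x in P.Ω, u x i * φ x) = 0 := by
  obtain ⟨-, Dy, hy, heq, -⟩ := h
  have hv : MemVecH10 one P.Ω (fun x => φ x • EuclideanSpace.single i (1 : ℝ))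
      (fun j => gradient fun x => φ x * (EuclideanSpace.single i (1 : ℝ) : Pt 2) j) := by
    intro j
    exact (hφ.const_mul _).memH10
  have key := heq _ _ hv
  have hgr : ∀ j k x, gradient (fun x => φ x * (EuclideanSpace.single i (1 : ℝ) : Pt 2) j) x k =
      partialDeriv k φ x * (EuclideanSpace.single i (1 : ℝ) : Pt 2) j := by
    intro j k x
    rw [gradient_apply, StokesTracking.partialDeriv,
      fderiv_mul_const (hφ.contDiff.differentiable (by simp) x)]
    simp only [PiLp.single_apply, StokesTracking.partialDeriv]
    split_ifs <;> simp
  have hyi := hy i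
  have mL := hyi.memLp
  have mG := hyi.memLp_grad
  rw [weightedMeasure_one] at mL mG
  have mGk : ∀ k, MemLp (fun x => Dy i x k) 2 (volume.restrict P.Ω) := fun k =>
    (EuclideanSpace.proj k : Pt 2 →L[ℝ] ℝ).comp_memLp' mG
  have ha : aForm P.Ω Dy
      (fun j => gradient fun x => φ x * (EuclideanSpace.single i (1 : ℝ) : Pt 2) j) =
      - ∫ x in P.Ω, y x i * ∑ k, partialDeriv k (partialDeriv k φ) x := by
    have e1 : ∀ x, ∑ j, inner ℝ (Dy j x)
        (gradient (fun x => φ x * (EuclideanSpace.single i (1 : ℝ) : Pt 2) j) x) =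
        ∑ k, Dy i x k * StokesTracking.partialDeriv k φ x := by
      intro x
      simp only [PiLp.inner_apply, hgr]
      rw [Finset.sum_eq_single i]
      · simp [mul_comm]
      · intro j _ hj
        simp [hj]
      · simp
    rw [aForm]
    simp_rw [e1, Finset.mul_sum]
    rw [integral_finsetSum _ fun k _ => integrableOn_mul_test (mGk k) (hφ.partialDeriv k),
      integral_finsetSum _ fun k _ =>
        integrableOn_mul_test mL ((hφ.partialDeriv k).partialDeriv k), ← Finset.sum_neg_distrib]
    refine Finset.sum_congr rfl fun k _ => ?_
    rw [hyi.weakGradient.integral_mul_partialDeriv mL mG (hφ.partialDeriv k) k, neg_neg]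
    exact integral_congr_ae (Eventually.of_forall fun x => mul_comm _ _)
  have hb : bForm P.Ω
      (fun j => gradient fun x => φ x * (EuclideanSpace.single i (1 : ℝ) : Pt 2) j) p =
      - ∫ x in P.Ω, p x * partialDeriv i φ x := by
    rw [bForm]
    congr 1
    refine integral_congr_ae (Eventually.of_forall fun x => ?_)
    simp only [hgr]
    rw [Finset.sum_eq_single i]
    · simp
    · intro j _ hj
      simp [hj]
    · simp
  have hu : ∫ x in P.Ω, inner ℝ (u x) (φ x • EuclideanSpace.single i (1 : ℝ)) =
      ∫ x in P.Ω, u x i * φ x := by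
    refine integral_congr_ae (Eventually.of_forall fun x => ?_)
    simp [inner_smul_right, EuclideanSpace.inner_single_right, mul_comm]
  rw [ha, hb, hu] at key
  linarith

/-- The incompressibility condition with the derivatives on the test function. -/
theorem TrackingProblem.IsState.integral_div_test {P : TrackingProblem 2} {y u : Pt 2 → Pt 2}
    {p : Pt 2 → ℝ} (h : P.IsState y p u) {φ : Pt 2 → ℝ} (hφ : IsTestFunction P.Ω φ) :
    ∑ k, ∫ x in P.Ω, y x k * partialDeriv k φ x = 0 := by
  obtain ⟨-, Dy, hy, -, hdiv⟩ := h
  have key := hdiv φ (hφ.memLp _)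
  have mL : ∀ k, MemLp (fun x => y x k) 2 (volume.restrict P.Ω) := fun k => by
    have := (hy k).memLp
    rwa [weightedMeasure_one] at this
  have mG : ∀ k, MemLp (Dy k) 2 (volume.restrict P.Ω) := fun k => by
    have := (hy k).memLp_grad
    rwa [weightedMeasure_one] at this
  have e : ∀ k, ∫ x in P.Ω, y x k * partialDeriv k φ x = - ∫ x in P.Ω, φ x * Dy k x k := fun k =>
    (hy k).weakGradient.integral_mul_partialDeriv (mL k) (mG k) hφ k
  rw [bForm, neg_eq_zero] at key
  simp_rw [Finset.mul_sum] at key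
  rw [integral_finsetSum] at key
  · simp_rw [e, Finset.sum_neg_distrib, key, neg_zero]
  · intro k _
    have := integrableOn_mul_test ((EuclideanSpace.proj k : Pt 2 →L[ℝ] ℝ).comp_memLp' (mG k)) hφ
    exact this.congr (Eventually.of_forall fun x => mul_comm _ _)

/-! ### The error equation -/

/-- In the ball of radius `ρ` around `m`, the function `f` is a quadratic polynomial `Q₁` on the
side of the line through `m` to which `ν` points, and `Q₂` on the other side, and the two agree
on the line. -/
structure IsTwoSided (m ν : Pt 2) (ρ : ℝ) (f Q₁ Q₂ : Pt 2 → ℝ) : Prop where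
  quad₁ : IsQuadratic Q₁
  quad₂ : IsQuadratic Q₂
  eq₁ : ∀ x ∈ Metric.ball m ρ, 0 < inner ℝ ν (x - m) → f x = Q₁ x
  eq₂ : ∀ x ∈ Metric.ball m ρ, inner ℝ ν (x - m) < 0 → f x = Q₂ x
  eq_line : ∀ x ∈ Metric.ball m ρ, inner ℝ ν (x - m) = 0 → Q₁ x = Q₂ x

theorem IsTwoSided.of_eqOn {m ν : Pt 2} {ρ : ℝ} {f Q : Pt 2 → ℝ} (hQ : IsQuadratic Q)
    (h : ∀ x ∈ Metric.ball m ρ, f x = Q x) : IsTwoSided m ν ρ f Q Q :=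
  ⟨hQ, hQ, fun x hx _ => h x hx, fun x hx _ => h x hx, fun _ _ _ => rfl⟩

theorem IsTwoSided.integral_mul {m ν : Pt 2} {ρ : ℝ} {f Q₁ Q₂ : Pt 2 → ℝ}
    (h : IsTwoSided m ν ρ f Q₁ Q₂) (hν : ‖ν‖ = 1) {g : Pt 2 → ℝ} (hg : Continuous g)
    (hgs : tsupport g ⊆ Metric.ball m ρ) {Ω : Set (Pt 2)} (hB : Metric.ball m ρ ⊆ Ω) :
    IntegrableOn (fun x => f x * g x) Ω ∧ ∫ x in Ω, f x * g x =
      (∫ x in {x | inner ℝ (-ν) (x - m) < 0}, Q₁ x * g x) +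
        ∫ x in {x | inner ℝ ν (x - m) < 0}, Q₂ x * g x := by
  have hc : HasCompactSupport g := HasCompactSupport.of_support_subset_isCompact
    (isCompact_closedBall m ρ) ((subset_tsupport _).trans (hgs.trans Metric.ball_subset_closedBall))
  have hz : ∀ x, x ∉ Metric.ball m ρ → g x = 0 := fun x hx =>
    image_eq_zero_of_notMem_tsupport fun h' => hx (hgs h')
  have hm₁ : MeasurableSet {x : Pt 2 | inner ℝ (-ν) (x - m) < 0} :=
    (isOpen_lt (by fun_prop) continuous_const).measurableSet
  have hm₂ : MeasurableSet {x : Pt 2 | inner ℝ ν (x - m) < 0} :=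
    (isOpen_lt (by fun_prop) continuous_const).measurableSet
  have i₁ := integrable_mul_of_hasCompactSupport h.quad₁.contDiff.continuous hg hc
    {x : Pt 2 | inner ℝ (-ν) (x - m) < 0}
  have i₂ := integrable_mul_of_hasCompactSupport h.quad₂.contDiff.continuous hg hc
    {x : Pt 2 | inner ℝ ν (x - m) < 0}
  have hae : (fun x => f x * g x) =ᵐ[volume]
      fun x => Set.indicator {x : Pt 2 | inner ℝ (-ν) (x - m) < 0} (fun x => Q₁ x * g x) x +
        Set.indicator {x : Pt 2 | inner ℝ ν (x - m) < 0} (fun x => Q₂ x * g x) x := by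
    have hline : ∀ᵐ x : Pt 2, inner ℝ ν (x - m) ≠ 0 := by
      rw [ae_iff]
      simpa using volume_line hν m
    filter_upwards [hline] with x hx
    by_cases hxB : x ∈ Metric.ball m ρ
    · rcases lt_or_gt_of_ne hx with hlt | hgt
      · have h1 : x ∉ {x : Pt 2 | inner ℝ (-ν) (x - m) < 0} := by
          rw [Set.mem_ofPred_eq, inner_neg_left]
          linarith
        have h2 : x ∈ {x : Pt 2 | inner ℝ ν (x - m) < 0} := hlt
        rw [Set.indicator_of_notMem h1, Set.indicator_of_mem h2,
          h.eq₂ x hxB hlt, zero_add]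
      · have h1 : x ∈ {x : Pt 2 | inner ℝ (-ν) (x - m) < 0} := by
          rw [Set.mem_ofPred_eq, inner_neg_left]
          linarith
        have h2 : x ∉ {x : Pt 2 | inner ℝ ν (x - m) < 0} := by
          rw [Set.mem_ofPred_eq]
          linarith
        rw [Set.indicator_of_notMem h2, Set.indicator_of_mem h1, h.eq₁ x hxB hgt, add_zero]
    · simp [Set.indicator_apply, hz x hxB]
  have hi := (i₁.integrable_indicator hm₁).add (i₂.integrable_indicator hm₂)
  refine ⟨(hi.congr hae.symm).integrableOn, ?_⟩
  rw [setIntegral_eq_integral_of_forall_compl_eq_zero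
    (fun x hx => by rw [hz x fun h' => hx (hB h'), mul_zero]), integral_congr_ae hae,
    integral_add (i₁.integrable_indicator hm₁) (i₂.integrable_indicator hm₂),
    integral_indicator hm₁, integral_indicator hm₂]

/-- The error equation: tested against `φ eᵢ`, the errors yield the element residuals on the two
sides of the line and the jump of the normal derivative of the discrete velocity on the line.
The pressure does not jump. -/
theorem TrackingProblem.IsState.error_equation {P : TrackingProblem 2} {y u : Pt 2 → Pt 2}
    {p : Pt 2 → ℝ} (h : P.IsState y p u) (hu : MemLp u 2 (volume.restrict P.Ω))
    {m ν τ : Pt 2} {ρ : ℝ} (hν : ‖ν‖ = 1) (hτ : ‖τ‖ = 1) (hντ : inner ℝ ν τ = 0)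
    (hB : Metric.ball m ρ ⊆ P.Ω) (i : Fin 2)
    {yh uh : Pt 2 → Pt 2} {ph Y₁ Y₂ U₁ U₂ P₁ P₂ : Pt 2 → ℝ}
    (hY : IsTwoSided m ν ρ (fun x => yh x i) Y₁ Y₂) (hP : IsTwoSided m ν ρ ph P₁ P₂)
    (hU : IsTwoSided m ν ρ (fun x => uh x i) U₁ U₂)
    {φ : Pt 2 → ℝ} (hφ : ContDiff ℝ ∞ φ) (hφs : tsupport φ ⊆ Metric.ball m ρ) :
    (∫ x in P.Ω, (y x i - yh x i) * ∑ k, partialDeriv k (partialDeriv k φ) x) +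
      (∫ x in P.Ω, (p x - ph x) * partialDeriv i φ x) +
      (∫ x in P.Ω, (u x i - uh x i) * φ x) =
      - (∫ x in {x | inner ℝ (-ν) (x - m) < 0},
          (U₁ x + ∑ k, partialDeriv k (partialDeriv k Y₁) x - partialDeriv i P₁ x) * φ x) -
        (∫ x in {x | inner ℝ ν (x - m) < 0},
          (U₂ x + ∑ k, partialDeriv k (partialDeriv k Y₂) x - partialDeriv i P₂ x) * φ x) -
        ∫ t : ℝ, φ (m + t • τ) * (fderiv ℝ Y₁ (m + t • τ) ν - fderiv ℝ Y₂ (m + t • τ) ν) := by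
  have hφT := IsTestFunction.of_tsupport_subset_ball hφ hφs hB
  have hc := hφT.hasCompactSupport
  have htest := h.integral_test hφT i
  have hmem : ∀ t : ℝ, m + t • τ ∈ tsupport φ → m + t • τ ∈ Metric.ball m ρ ∧
      inner ℝ ν (m + t • τ - m) = 0 := fun t ht => ⟨hφs ht, by simp [inner_smul_right, hντ]⟩
  have d1 : ∀ k, ContDiff ℝ ∞ (partialDeriv k φ) := fun k => contDiff_partialDeriv hφ (by simp) k
  have d2 : ∀ k, ContDiff ℝ ∞ (partialDeriv k (partialDeriv k φ)) := fun k =>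
    contDiff_partialDeriv (d1 k) (by simp) k
  have hlapc : Continuous fun x => ∑ k, partialDeriv k (partialDeriv k φ) x :=
    continuous_finsetSum _ fun k _ => (d2 k).continuous
  have hlaps : tsupport (fun x => ∑ k, partialDeriv k (partialDeriv k φ) x) ⊆
      Metric.ball m ρ := (tsupport_sum_partialDeriv_subset φ).trans hφs
  obtain ⟨iY, eY⟩ := hY.integral_mul hν hlapc hlaps hB
  obtain ⟨iP, eP⟩ := hP.integral_mul hν (d1 i).continuous
    ((tsupport_partialDeriv_subset φ i).trans hφs) hB
  obtain ⟨iU, eU⟩ := hU.integral_mul hν hφ.continuous hφs hB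
  obtain ⟨hp, Dy, hy, -, -⟩ := h
  have mL : MemLp (fun x => y x i) 2 (volume.restrict P.Ω) := by
    have := (hy i).memLp
    rwa [weightedMeasure_one] at this
  have jY : IntegrableOn (fun x => y x i * ∑ k, partialDeriv k (partialDeriv k φ) x) P.Ω := by
    simp_rw [Finset.mul_sum]
    exact integrable_finsetSum _ fun k _ =>
      integrableOn_mul_test mL ((hφT.partialDeriv k).partialDeriv k)
  have jP := integrableOn_mul_test hp (hφT.partialDeriv i)
  have jU := integrableOn_mul_test ((EuclideanSpace.proj i : Pt 2 →L[ℝ] ℝ).comp_memLp' hu) hφT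
  simp only [Function.comp_def, PiLp.proj_apply] at jU
  have h2 : (2 : ℕ∞ω) ≤ ((⊤ : ℕ∞) : ℕ∞ω) :=
    WithTop.coe_le_coe.2 (le_top : (2 : ℕ∞) ≤ ⊤)
  have gY := integral_twoSided_mul_laplacian hν hτ hντ m (hY.quad₁.contDiff.of_le h2)
    (hY.quad₂.contDiff.of_le h2) (hφ.of_le h2) hc
    fun t ht => hY.eq_line _ (hmem t ht).1 (hmem t ht).2
  have gP := integral_twoSided_mul_partialDeriv hν hτ hντ m (hP.quad₁.contDiff.of_le (by simp))
    (hP.quad₂.contDiff.of_le (by simp)) (hφ.of_le (by simp)) hc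
    (fun t ht => hP.eq_line _ (hmem t ht).1 (hmem t ht).2) i
  have hR : ∀ {U Y Q : Pt 2 → ℝ} (S : Set (Pt 2)), IsQuadratic U → IsQuadratic Y → IsQuadratic Q →
      ∫ x in S, (U x + ∑ k, partialDeriv k (partialDeriv k Y) x - partialDeriv i Q x) * φ x =
      (∫ x in S, U x * φ x) + (∫ x in S, (∑ k, partialDeriv k (partialDeriv k Y) x) * φ x) -
        ∫ x in S, partialDeriv i Q x * φ x := by
    intro U Y Q S hU hY hQ
    have c1 := integrable_mul_of_hasCompactSupport hU.contDiff.continuous hφ.continuous hc S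
    have c2 := integrable_mul_of_hasCompactSupport
      hY.sum_partialDeriv_partialDeriv.contDiff.continuous hφ.continuous hc S
    have c3 := integrable_mul_of_hasCompactSupport
      (hQ.isAffineFun_partialDeriv i).isQuadratic.contDiff.continuous hφ.continuous hc S
    simp_rw [sub_mul, add_mul]
    have c12 : IntegrableOn (fun x => U x * φ x +
      (∑ k, partialDeriv k (partialDeriv k Y) x) * φ x) S := c1.add c2
    rw [integral_sub c12 c3, integral_add c1 c2]
  simp_rw [sub_mul (y _ i), sub_mul (p _), sub_mul (u _ i)]
  rw [integral_sub jY iY, integral_sub jP iP, integral_sub jU iU, eY, eP, eU, gY, gP,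
    hR _ hU.quad₁ hY.quad₁ hP.quad₁, hR _ hU.quad₂ hY.quad₂ hP.quad₂]
  linarith

/-- The error equation for the divergence. -/
theorem TrackingProblem.IsState.divergence_equation {P : TrackingProblem 2} {y u : Pt 2 → Pt 2}
    {p : Pt 2 → ℝ} (h : P.IsState y p u) {m : Pt 2} {ρ : ℝ}
    (hB : Metric.ball m ρ ⊆ P.Ω) {yh : Pt 2 → Pt 2} {Y : Fin 2 → Pt 2 → ℝ}
    (hY : ∀ k, IsQuadratic (Y k)) (hyh : ∀ k, ∀ x ∈ Metric.ball m ρ, yh x k = Y k x)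
    {φ : Pt 2 → ℝ} (hφ : ContDiff ℝ ∞ φ) (hφs : tsupport φ ⊆ Metric.ball m ρ) :
    ∑ k, ∫ x in P.Ω, (y x k - yh x k) * partialDeriv k φ x =
      ∫ x, (∑ k, partialDeriv k (Y k) x) * φ x := by
  have hφT := IsTestFunction.of_tsupport_subset_ball hφ hφs hB
  have hc := hφT.hasCompactSupport
  have htest := h.integral_div_test hφT
  obtain ⟨hp, Dy, hy, -, -⟩ := h
  -- the line through `m` is artificial here: the same polynomial is used on both sides
  have hν : ‖(EuclideanSpace.single 0 1 : Pt 2)‖ = 1 := by simp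
  have hτ : ‖(EuclideanSpace.single 1 1 : Pt 2)‖ = 1 := by simp
  have hντ : inner ℝ (EuclideanSpace.single 0 1 : Pt 2) (EuclideanSpace.single 1 1) = 0 := by
    simp [EuclideanSpace.inner_single_left]
  have d1 : ∀ k, ContDiff ℝ ∞ (partialDeriv k φ) := fun k => contDiff_partialDeriv hφ (by simp) k
  have hi : ∀ k, Integrable fun x => partialDeriv k (Y k) x * φ x := fun k => by
    have := integrable_mul_of_hasCompactSupport
      ((hY k).isAffineFun_partialDeriv k).isQuadratic.contDiff.continuous hφ.continuous hc Set.univ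
    rwa [integrableOn_univ] at this
  have key : ∀ k, ∫ x in P.Ω, (y x k - yh x k) * partialDeriv k φ x =
      (∫ x in P.Ω, y x k * partialDeriv k φ x) + ∫ x, partialDeriv k (Y k) x * φ x := by
    intro k
    have mL : MemLp (fun x => y x k) 2 (volume.restrict P.Ω) := by
      have := (hy k).memLp
      rwa [weightedMeasure_one] at this
    obtain ⟨iY, eY⟩ := (IsTwoSided.of_eqOn (ν := EuclideanSpace.single 0 1) (hY k)
      (hyh k)).integral_mul hν (d1 k).continuous ((tsupport_partialDeriv_subset φ k).trans hφs) hB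
    have g := integral_twoSided_mul_partialDeriv hν hτ hντ m ((hY k).contDiff.of_le (by simp))
      ((hY k).contDiff.of_le (by simp)) (hφ.of_le (by simp)) hc (fun _ _ => rfl) k
    simp_rw [sub_mul]
    rw [integral_sub (integrableOn_mul_test mL (hφT.partialDeriv k)) iY, eY, g,
      integral_eq_add_halfPlanes hν m (hi k)]
    ring
  simp_rw [key, Finset.sum_add_distrib, htest, zero_add, Finset.sum_mul]
  rw [integral_finsetSum _ fun k _ => hi k]

/-! ### Estimates on a ball -/

theorem abs_integral_mul_le {Ω N : Set (Pt 2)} {f g : Pt 2 → ℝ} {q : ℝ≥0∞} (hq : 1 ≤ q)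
    {m : Pt 2} {ρ A D : ℝ} (hBΩ : Metric.ball m ρ ⊆ Ω) (hBN : Metric.ball m ρ ⊆ N)
    (hf : AEStronglyMeasurable f (volume.restrict Ω))
    (hfA : eLpNorm f q (volume.restrict N) ≤ ENNReal.ofReal A) (hA : 0 ≤ A) (hρ : 0 < ρ)
    (hg : ∀ x, |g x| ≤ D) (hgs : tsupport g ⊆ Metric.ball m ρ) :
    |∫ x in Ω, f x * g x| ≤ D * (A * (ρ ^ 2 * Real.pi) ^ (1 - 1 / q.toReal)) := by
  have hD : 0 ≤ D := (abs_nonneg _).trans (hg m)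
  have hexp : 0 ≤ 1 - 1 / q.toReal := by
    rcases eq_or_ne q ∞ with rfl | hqt
    · simp
    · have h1 : 1 ≤ q.toReal := by
        rw [← ENNReal.toReal_one]
        exact (ENNReal.toReal_le_toReal ENNReal.one_ne_top hqt).2 hq
      rw [sub_nonneg, div_le_one (by linarith)]
      exact h1
  have hvol : volume (Metric.ball m ρ) = ENNReal.ofReal (ρ ^ 2 * Real.pi) := by
    rw [EuclideanSpace.volume_ball_fin_two, ENNReal.ofReal_mul (by positivity),
      ENNReal.ofReal_pow hρ.le]
  have hz : ∀ x, x ∉ Metric.ball m ρ → g x = 0 := fun x hx =>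
    image_eq_zero_of_notMem_tsupport fun h' => hx (hgs h')
  have e1 : ∫ x in Ω, f x * g x = ∫ x in Metric.ball m ρ, f x * g x := by
    rw [setIntegral_eq_integral_of_forall_compl_eq_zero
        (fun x hx => by rw [hz x fun h => hx (hBΩ h), mul_zero]),
      setIntegral_eq_integral_of_forall_compl_eq_zero (fun x hx => by rw [hz x hx, mul_zero])]
  have hE : ‖∫ x in Metric.ball m ρ, f x * g x‖ₑ ≤
      ENNReal.ofReal (D * (A * (ρ ^ 2 * Real.pi) ^ (1 - 1 / q.toReal))) := by
    calc ‖∫ x in Metric.ball m ρ, f x * g x‖ₑ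
        ≤ ∫⁻ x in Metric.ball m ρ, ‖f x * g x‖ₑ := enorm_integral_le_lintegral_enorm _
      _ ≤ ∫⁻ x in Metric.ball m ρ, ENNReal.ofReal D * ‖f x‖ₑ := by
          refine lintegral_mono fun x => ?_
          rw [enorm_mul, mul_comm]
          gcongr
          rw [← ofReal_norm]
          exact ENNReal.ofReal_le_ofReal (hg x)
      _ = ENNReal.ofReal D * eLpNorm f 1 (volume.restrict (Metric.ball m ρ)) := by
          rw [lintegral_const_mul' _ _ ENNReal.ofReal_ne_top, eLpNorm_one_eq_lintegral_enorm]
      _ ≤ ENNReal.ofReal D * (ENNReal.ofReal A *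
            ENNReal.ofReal (ρ ^ 2 * Real.pi) ^ (1 - 1 / q.toReal)) := by
          gcongr
          refine (eLpNorm_le_eLpNorm_mul_rpow_measure_univ hq
            (hf.mono_measure (Measure.restrict_mono hBΩ le_rfl))).trans ?_
          rw [Measure.restrict_apply_univ, hvol, ENNReal.toReal_one, div_one]
          gcongr
          exact (eLpNorm_mono_measure _ (Measure.restrict_mono hBN le_rfl)).trans hfA
      _ = _ := by
          rw [ENNReal.ofReal_rpow_of_nonneg (by positivity) hexp, ← ENNReal.ofReal_mul hA,
            ← ENNReal.ofReal_mul hD]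
  rw [e1]
  rw [← ofReal_norm, ENNReal.ofReal_le_ofReal_iff (by positivity)] at hE
  exact hE

theorem eLpNorm_coord_le (v : Pt 2 → Pt 2) (i : Fin 2) (q : ℝ≥0∞) (μ : Measure (Pt 2)) :
    eLpNorm (fun x => v x i) q μ ≤ eLpNorm v q μ :=
  eLpNorm_mono fun x => PiLp.norm_apply_le (v x) i

/-- The errors on a set `N`, measured in the norms of the efficiency estimate. -/
structure ErrorBounds (Ω N : Set (Pt 2)) (ey : Pt 2 → Pt 2) (ep : Pt 2 → ℝ) (eu : Pt 2 → Pt 2)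
    (A B C : ℝ) : Prop where
  nonneg_A : 0 ≤ A
  nonneg_B : 0 ≤ B
  nonneg_C : 0 ≤ C
  meas_y : ∀ i, AEStronglyMeasurable (fun x => ey x i) (volume.restrict Ω)
  meas_p : AEStronglyMeasurable ep (volume.restrict Ω)
  meas_u : ∀ i, AEStronglyMeasurable (fun x => eu x i) (volume.restrict Ω)
  le_A : eLpNorm ey ∞ (volume.restrict N) ≤ ENNReal.ofReal A
  le_B : eLpNorm ep 2 (volume.restrict N) ≤ ENNReal.ofReal B
  le_C : eLpNorm eu 2 (volume.restrict N) ≤ ENNReal.ofReal C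

/-- The errors tested against a scaled test function and its derivatives. A derivative costs a
factor `ρ⁻¹` and the Hölder inequality on the ball gains a power of its measure: `ρ²` for the
maximum norm and `ρ` for the `L²` norms. -/
theorem exists_bound_error_functional : ∃ M : ℝ, 0 < M ∧ ∀ (Ω N : Set (Pt 2)) (ey : Pt 2 → Pt 2)
    (ep : Pt 2 → ℝ) (eu : Pt 2 → Pt 2) (A B C : ℝ), ErrorBounds Ω N ey ep eu A B C →
    ∀ (m : Pt 2) (ρ Γ : ℝ) (c : Fin 6 → ℝ), 0 < ρ → Metric.ball m ρ ⊆ Ω → Metric.ball m ρ ⊆ N →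
    (∀ k, |c k| ≤ Γ) →
    (∀ i, |(∫ x in Ω, ey x i * ∑ k, partialDeriv k (partialDeriv k (testFun c m ρ)) x) +
        (∫ x in Ω, ep x * partialDeriv i (testFun c m ρ) x) +
        (∫ x in Ω, eu x i * testFun c m ρ x)| ≤ M * Γ * (A + B + ρ * C)) ∧
      (|∑ k, ∫ x in Ω, ey x k * partialDeriv k (testFun c m ρ) x| ≤ M * Γ * (ρ * A)) ∧
      ∀ x, |testFun c m ρ x| ≤ M * Γ := by
  obtain ⟨M, hM, h⟩ := exists_bound_testFun
  refine ⟨8 * M, by positivity, fun Ω N ey ep eu A B C he m ρ Γ c hρ hBΩ hBN hc => ?_⟩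
  have hΓ : 0 ≤ Γ := (abs_nonneg _).trans (hc 0)
  have hb := h c Γ m ρ hc hρ
  have hts := tsupport_testFun_subset c m hρ
  have hA := he.nonneg_A
  have hB := he.nonneg_B
  have hC := he.nonneg_C
  have hMΓ : 0 ≤ M * Γ := by positivity
  have hpi : Real.pi ≤ 4 := Real.pi_le_four
  have hsq : (ρ ^ 2 * Real.pi) ^ (1 - 1 / (2 : ℝ≥0∞).toReal) ≤ 2 * ρ := by
    have e : (1 - 1 / (2 : ℝ≥0∞).toReal) = 1 / 2 := by norm_num
    rw [e, ← Real.sqrt_eq_rpow]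
    refine Real.sqrt_le_iff.2 ⟨by positivity, ?_⟩
    nlinarith [sq_nonneg ρ]
  have htop : (ρ ^ 2 * Real.pi) ^ (1 - 1 / (∞ : ℝ≥0∞).toReal) ≤ 4 * ρ ^ 2 := by
    simp only [ENNReal.toReal_top, div_zero, sub_zero, Real.rpow_one]
    nlinarith [sq_nonneg ρ]
  have hlap : ∀ x, |∑ k, partialDeriv k (partialDeriv k (testFun c m ρ)) x| ≤
      2 * (M * Γ / ρ ^ 2) := by
    intro x
    rw [Fin.sum_univ_two]
    have h0 := ((hb x).2 0).2
    have h1 := ((hb x).2 1).2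
    exact (abs_add_le _ _).trans (by linarith)
  refine ⟨fun i => ?_, ?_, fun x => (hb x).1.trans (by nlinarith)⟩
  · have t1 := abs_integral_mul_le (q := ∞) (by simp) hBΩ hBN (he.meas_y i)
      ((eLpNorm_coord_le ey i _ _).trans he.le_A) hA hρ hlap
      ((tsupport_sum_partialDeriv_subset _).trans hts)
    have t2 := abs_integral_mul_le (q := 2) (by norm_num) hBΩ hBN he.meas_p he.le_B hB hρ
      (fun x => ((hb x).2 i).1) ((tsupport_partialDeriv_subset _ i).trans hts)
    have t3 := abs_integral_mul_le (q := 2) (by norm_num) hBΩ hBN (he.meas_u i)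
      ((eLpNorm_coord_le eu i _ _).trans he.le_C) hC hρ (fun x => (hb x).1) hts
    have s1 : 2 * (M * Γ / ρ ^ 2) * (A * (ρ ^ 2 * Real.pi) ^ (1 - 1 / (∞ : ℝ≥0∞).toReal)) ≤
        8 * (M * Γ) * A := by
      calc _ ≤ 2 * (M * Γ / ρ ^ 2) * (A * (4 * ρ ^ 2)) := by gcongr
        _ = _ := by field_simp; ring
    have s2 : M * Γ / ρ * (B * (ρ ^ 2 * Real.pi) ^ (1 - 1 / (2 : ℝ≥0∞).toReal)) ≤
        2 * (M * Γ) * B := by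
      calc _ ≤ M * Γ / ρ * (B * (2 * ρ)) := by gcongr
        _ = _ := by field_simp
    have s3 : M * Γ * (C * (ρ ^ 2 * Real.pi) ^ (1 - 1 / (2 : ℝ≥0∞).toReal)) ≤
        2 * (M * Γ) * (ρ * C) := by
      calc _ ≤ M * Γ * (C * (2 * ρ)) := by gcongr
        _ = _ := by ring
    have p2 : 0 ≤ M * Γ * B := by positivity
    have p3 : 0 ≤ M * Γ * (ρ * C) := by positivity
    refine (abs_add_le _ _).trans ((add_le_add_left (abs_add_le _ _) _).trans ?_)
    linarith
  · have t1 : ∀ k, |∫ x in Ω, ey x k * partialDeriv k (testFun c m ρ) x| ≤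
        4 * (M * Γ) * (ρ * A) := by
      intro k
      have t := abs_integral_mul_le (q := ∞) (by simp) hBΩ hBN (he.meas_y k)
        ((eLpNorm_coord_le ey k _ _).trans he.le_A) hA hρ (fun x => ((hb x).2 k).1)
        ((tsupport_partialDeriv_subset _ k).trans hts)
      refine t.trans ?_
      calc _ ≤ M * Γ / ρ * (A * (4 * ρ ^ 2)) := by gcongr
        _ = _ := by field_simp
    rw [Fin.sum_univ_two]
    refine (abs_add_le _ _).trans ?_
    linarith [t1 0, t1 1]

/-- The element residual is bounded by the error: tested with a bump function supported in a
ball, all derivatives fall on the test function. -/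
theorem exists_bound_elementResidual : ∃ M : ℝ, 0 < M ∧ ∀ (P : TrackingProblem 2)
    (y u : Pt 2 → Pt 2) (p : Pt 2 → ℝ), P.IsState y p u → MemLp u 2 (volume.restrict P.Ω) →
    ∀ (N : Set (Pt 2)) (yh uh : Pt 2 → Pt 2) (ph : Pt 2 → ℝ) (A B C : ℝ),
    ErrorBounds P.Ω N (fun x => y x - yh x) (fun x => p x - ph x) (fun x => u x - uh x) A B C →
    ∀ (m : Pt 2) (ρ s : ℝ), 0 < ρ → 1 ≤ s → Metric.ball m ρ ⊆ P.Ω → Metric.ball m ρ ⊆ N →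
    ∀ (i : Fin 2) (Y U Q : Pt 2 → ℝ), IsQuadratic Y → IsQuadratic U → IsQuadratic Q →
    (∀ x ∈ Metric.ball m ρ, yh x i = Y x) → (∀ x ∈ Metric.ball m ρ, uh x i = U x) →
    (∀ x ∈ Metric.ball m ρ, ph x = Q x) →
    ∀ x, ‖x - m‖ ≤ s * ρ →
      ρ ^ 2 * |U x + ∑ k, partialDeriv k (partialDeriv k Y) x - partialDeriv i Q x| ≤
        M * s ^ 2 * (A + B + ρ * C) := by
  obtain ⟨M, hM, hfun⟩ := exists_bound_error_functional
  obtain ⟨Γ, hΓ, hquad⟩ := exists_bound_quadratic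
  refine ⟨6 * (M * Γ), by positivity, fun P y u p hst hu N yh uh ph A B C he m ρ s hρ hs hBΩ hBN
    i Y U Q hY hU hQ eY eU eQ x hx => ?_⟩
  have hν : ‖(EuclideanSpace.single 0 1 : Pt 2)‖ = 1 := by simp
  have hτ : ‖(EuclideanSpace.single 1 1 : Pt 2)‖ = 1 := by simp
  have hντ : inner ℝ (EuclideanSpace.single 0 1 : Pt 2) (EuclideanSpace.single 1 1) = 0 := by
    simp [EuclideanSpace.inner_single_left]
  have hR : IsQuadratic fun x => U x + ∑ k, partialDeriv k (partialDeriv k Y) x -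
      partialDeriv i Q x :=
    (hU.add hY.sum_partialDeriv_partialDeriv).sub (hQ.isAffineFun_partialDeriv i).isQuadratic
  refine (hquad _ hR m ρ s (M * Γ * (A + B + ρ * C)) hρ hs (fun c hc => ?_) x hx).trans
    (le_of_eq (by ring))
  have hφ := contDiff_testFun c m ρ
  have hφs := tsupport_testFun_subset c m hρ
  have eq := hst.error_equation hu hν hτ hντ hBΩ i (.of_eqOn hY eY) (.of_eqOn hQ eQ)
    (.of_eqOn hU eU) hφ hφs
  have hint : Integrable fun x => (U x + ∑ k, partialDeriv k (partialDeriv k Y) x -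
      partialDeriv i Q x) * testFun c m ρ x := by
    have := integrable_mul_of_hasCompactSupport hR.contDiff.continuous hφ.continuous
      (hasCompactSupport_testFun c m hρ) Set.univ
    rwa [integrableOn_univ] at this
  rw [integral_eq_add_halfPlanes hν m hint]
  have := ((hfun P.Ω N _ _ _ A B C he m ρ Γ c hρ hBΩ hBN hc).1 i)
  simp only [PiLp.sub_apply] at this
  rw [eq] at this
  simp only [sub_self, mul_zero, integral_zero, sub_zero] at this
  rw [← abs_neg, neg_add, ← sub_eq_add_neg]
  exact this

/-- The divergence of the discrete velocity on a dilated ball: its integrals against test functions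
equal those of the velocity error against their gradients, as the exact velocity is solenoidal. -/
theorem exists_bound_divergence : ∃ M : ℝ, 0 < M ∧ ∀ (P : TrackingProblem 2)
    (y u : Pt 2 → Pt 2) (p : Pt 2 → ℝ), P.IsState y p u →
    ∀ (N : Set (Pt 2)) (yh uh : Pt 2 → Pt 2) (ph : Pt 2 → ℝ) (A B C : ℝ),
    ErrorBounds P.Ω N (fun x => y x - yh x) (fun x => p x - ph x) (fun x => u x - uh x) A B C →
    ∀ (m : Pt 2) (ρ s : ℝ), 0 < ρ → 1 ≤ s → Metric.ball m ρ ⊆ P.Ω → Metric.ball m ρ ⊆ N →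
    ∀ (Y : Fin 2 → Pt 2 → ℝ), (∀ k, IsQuadratic (Y k)) →
    (∀ k, ∀ x ∈ Metric.ball m ρ, yh x k = Y k x) →
    ∀ x, ‖x - m‖ ≤ s * ρ → ρ * |∑ k, partialDeriv k (Y k) x| ≤ M * s ^ 2 * A := by
  obtain ⟨M, hM, hfun⟩ := exists_bound_error_functional
  obtain ⟨Γ, hΓ, hquad⟩ := exists_bound_quadratic
  refine ⟨6 * (M * Γ), by positivity, fun P y u p hst N yh uh ph A B C he m ρ s hρ hs hBΩ hBN
    Y hY eY x hx => ?_⟩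
  have hR : IsQuadratic fun x => ∑ k, partialDeriv k (Y k) x := by
    simp_rw [Fin.sum_univ_two]
    exact (((hY 0).isAffineFun_partialDeriv 0).add ((hY 1).isAffineFun_partialDeriv 1)).isQuadratic
  have key := hquad _ hR m ρ s (M * Γ * (ρ * A)) hρ hs (fun c hc => ?_) x hx
  · refine le_of_mul_le_mul_left ?_ hρ
    calc ρ * (ρ * |∑ k, partialDeriv k (Y k) x|) = ρ ^ 2 * |∑ k, partialDeriv k (Y k) x| := by ring
      _ ≤ _ := key
      _ = _ := by ring
  · have := (hfun P.Ω N _ _ _ A B C he m ρ Γ c hρ hBΩ hBN hc).2.1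
    simp only [PiLp.sub_apply] at this
    rwa [hst.divergence_equation hBΩ hY eY (contDiff_testFun c m ρ)
      (tsupport_testFun_subset c m hρ)] at this

/-- The jump of the normal derivative is bounded by the error and by the element residuals on the
two sides, which are at most `δ`. -/
theorem exists_bound_jump : ∃ M : ℝ, 0 < M ∧ ∀ (P : TrackingProblem 2)
    (y u : Pt 2 → Pt 2) (p : Pt 2 → ℝ), P.IsState y p u → MemLp u 2 (volume.restrict P.Ω) →
    ∀ (N : Set (Pt 2)) (yh uh : Pt 2 → Pt 2) (ph : Pt 2 → ℝ) (A B C : ℝ),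
    ErrorBounds P.Ω N (fun x => y x - yh x) (fun x => p x - ph x) (fun x => u x - uh x) A B C →
    ∀ (m ν τ : Pt 2) (ρ s : ℝ), ‖ν‖ = 1 → ‖τ‖ = 1 → inner ℝ ν τ = 0 → 0 < ρ → 1 ≤ s →
    Metric.ball m ρ ⊆ P.Ω → Metric.ball m ρ ⊆ N →
    ∀ (i : Fin 2) (Y₁ Y₂ U₁ U₂ Q₁ Q₂ : Pt 2 → ℝ), IsTwoSided m ν ρ (fun x => yh x i) Y₁ Y₂ →
    IsTwoSided m ν ρ (fun x => uh x i) U₁ U₂ → IsTwoSided m ν ρ ph Q₁ Q₂ →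
    ∀ δ : ℝ, (∀ x ∈ Metric.ball m ρ, 0 < inner ℝ ν (x - m) →
      |U₁ x + ∑ k, partialDeriv k (partialDeriv k Y₁) x - partialDeriv i Q₁ x| ≤ δ) →
    (∀ x ∈ Metric.ball m ρ, inner ℝ ν (x - m) < 0 →
      |U₂ x + ∑ k, partialDeriv k (partialDeriv k Y₂) x - partialDeriv i Q₂ x| ≤ δ) → 0 ≤ δ →
    ∀ t : ℝ, |t| ≤ s * ρ → ρ * |fderiv ℝ Y₁ (m + t • τ) ν - fderiv ℝ Y₂ (m + t • τ) ν| ≤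
      M * s * (A + B + ρ * C + ρ ^ 2 * δ) := by
  obtain ⟨M, hM, hfun⟩ := exists_bound_error_functional
  obtain ⟨Γ, hΓ, hline⟩ := exists_bound_affine_line
  refine ⟨8 * (M * Γ), by positivity, fun P y u p hst hu N yh uh ph A B C he m ν τ ρ s hν hτ hντ
    hρ hs hBΩ hBN i Y₁ Y₂ U₁ U₂ Q₁ Q₂ hY hU hQ δ h₁ h₂ hδ t ht => ?_⟩
  have hJ : IsAffineFun fun x => fderiv ℝ Y₁ x ν - fderiv ℝ Y₂ x ν :=
    (hY.quad₁.fderiv_apply ν).sub (hY.quad₂.fderiv_apply ν)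
  have hA := he.nonneg_A
  have hB := he.nonneg_B
  have hC := he.nonneg_C
  refine hline _ hJ m τ ρ s (8 * (M * Γ) * s * (A + B + ρ * C + ρ ^ 2 * δ)) hτ hρ hs
    (fun c hc => ?_) t ht
  have hφ := contDiff_testFun c m ρ
  have hφs := tsupport_testFun_subset c m hρ
  have eq := hst.error_equation hu hν hτ hντ hBΩ i hY hQ hU hφ hφs
  obtain ⟨hf1, -, hf3⟩ := hfun P.Ω N _ _ _ A B C he m ρ _ c hρ hBΩ hBN hc
  have hf := hf1 i
  simp only [PiLp.sub_apply] at hf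
  rw [eq] at hf
  have hvol : volume.real (Metric.ball m ρ) = ρ ^ 2 * Real.pi := by
    rw [measureReal_def, EuclideanSpace.volume_ball_fin_two, ENNReal.toReal_mul,
      ENNReal.toReal_pow, ENNReal.toReal_ofReal hρ.le, ENNReal.toReal_ofReal Real.pi_pos.le]
  -- integrals over a half-plane only see the part inside the ball
  have hres : ∀ (S : Set (Pt 2)) (R : Pt 2 → ℝ), MeasurableSet S →
      (∀ x ∈ Metric.ball m ρ, x ∈ S → |R x| ≤ δ) →
      |∫ x in S, R x * testFun c m ρ x| ≤ 4 * (M * (s * Γ)) * (ρ ^ 2 * δ) := by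
    intro S R hS hR
    have e : ∫ x in S, R x * testFun c m ρ x =
        ∫ x in S ∩ Metric.ball m ρ, R x * testFun c m ρ x := by
      refine setIntegral_eq_of_subset_of_forall_sdiff_eq_zero hS Set.inter_subset_left ?_
      intro x hx
      rw [image_eq_zero_of_notMem_tsupport fun h' => hx.2 ⟨hx.1, hφs h'⟩, mul_zero]
    rw [e]
    have hlt : volume (S ∩ Metric.ball m ρ) < (⊤ : ℝ≥0∞) :=
      (measure_mono Set.inter_subset_right).trans_lt measure_ball_lt_top
    have := norm_setIntegral_le_of_norm_le_const (μ := volume) hlt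
      (f := fun x => R x * testFun c m ρ x) (C := δ * (M * (s * Γ))) (fun x hx => by
        rw [norm_mul]
        exact mul_le_mul (hR x hx.2 hx.1) (hf3 x) (norm_nonneg _) hδ)
    refine this.trans ?_
    have hle : volume.real (S ∩ Metric.ball m ρ) ≤ ρ ^ 2 * Real.pi := by
      rw [← hvol]
      exact measureReal_mono Set.inter_subset_right measure_ball_lt_top.ne
    calc _ ≤ δ * (M * (s * Γ)) * (ρ ^ 2 * 4) := by
          have hpi : Real.pi ≤ 4 := Real.pi_le_four
          have : 0 ≤ δ * (M * (s * Γ)) := by positivity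
          refine mul_le_mul_of_nonneg_left (hle.trans ?_) this
          gcongr
      _ = _ := by ring
  have r₁ := hres {x | inner ℝ (-ν) (x - m) < 0} _
    (isOpen_lt (by fun_prop) continuous_const).measurableSet (fun x hx hxS => h₁ x hx (by
      have : inner ℝ (-ν) (x - m) < 0 := hxS
      rw [inner_neg_left] at this
      linarith))
  have r₂ := hres {x | inner ℝ ν (x - m) < 0} _
    (isOpen_lt (by fun_prop) continuous_const).measurableSet (fun x hx hxS => h₂ x hx hxS)
  rw [abs_le] at hf r₁ r₂ ⊢
  have p1 : 0 ≤ M * (s * Γ) * (A + B + ρ * C) := by positivity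
  constructor <;> nlinarith [hf.1, hf.2, r₁.1, r₁.2, r₂.1, r₂.2, p1]

/-! ### Geometry of the mesh -/

/-- A Lipschitz domain is the interior of its closure: below each boundary point, in the direction
in which the boundary is a graph, there is an open set disjoint from the domain. -/
theorem IsLipschitzDomain.interior_closure_subset {Ω : Set (Pt 2)} (h : IsLipschitzDomain Ω) :
    interior (closure Ω) ⊆ Ω := by
  intro x hx
  by_contra hxΩ
  have hfr : x ∈ frontier Ω := by
    rw [frontier, h.isOpen.interior_eq]
    exact ⟨interior_subset hx, hxΩ⟩
  obtain ⟨e, γ, L, r, he, hγ, hr, hg⟩ := h.lipschitz x hfr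
  have hle : inner ℝ e x ≤ γ (x - inner ℝ e x • e) := by
    by_contra h'
    exact hxΩ ((hg x (Metric.mem_ball_self hr)).2 (not_le.1 h'))
  set V : Set (Pt 2) := Metric.ball x r ∩ {z | inner ℝ e z < γ (z - inner ℝ e z • e)} with hV
  have hVo : IsOpen V := by
    refine Metric.isOpen_ball.inter (isOpen_lt (by fun_prop) ?_)
    have := hγ.continuous
    fun_prop
  have hVd : Disjoint V (closure Ω) := by
    refine Disjoint.closure_right ?_ hVo
    rw [Set.disjoint_left]
    rintro z ⟨hz1, hz2⟩ hzΩ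
    exact lt_asymm hz2 ((hg z hz1).1 hzΩ)
  obtain ⟨ε, hε, hball⟩ := Metric.isOpen_iff.1 isOpen_interior x hx
  set s := min ε r / 2 with hs
  have hs0 : 0 < s := by positivity
  have hsε : s < ε := by
    have := min_le_left ε r
    have : 0 < min ε r := by positivity
    linarith
  have hsr : s < r := by
    have := min_le_right ε r
    have : 0 < min ε r := by positivity
    linarith
  have hdist : dist (x - s • e) x = s := by
    rw [dist_eq_norm, sub_sub_cancel_left, norm_neg, norm_smul, he, mul_one, Real.norm_eq_abs,
      abs_of_pos hs0]
  have hin : inner ℝ e (x - s • e) = inner ℝ e x - s := by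
    simp [inner_sub_right, inner_smul_right, he]
  have hmem : x - s • e ∈ closure Ω :=
    interior_subset (hball (by rw [Metric.mem_ball, hdist]; exact hsε))
  refine Set.disjoint_right.1 hVd hmem ⟨?_, ?_⟩
  · rw [Metric.mem_ball, hdist]
    exact hsr
  · change inner ℝ e (x - s • e) < γ (x - s • e - inner ℝ e (x - s • e) • e)
    rw [hin, show x - s • e - (inner ℝ e x - s) • e = x - inner ℝ e x • e by
      rw [sub_smul]; abel]
    linarith

theorem exists_eq_triple {K : Finset (Pt 2)} (hK : K.card = 3) {a b : Pt 2} (ha : a ∈ K)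
    (hb : b ∈ K) (hab : a ≠ b) : ∃ c, c ≠ a ∧ c ≠ b ∧ c ∈ K ∧ ∀ x ∈ K, x = a ∨ x = b ∨ x = c := by
  have h1 : ((K.erase a).erase b).card = 1 := by
    rw [Finset.card_erase_of_mem (Finset.mem_erase.2 ⟨hab.symm, hb⟩), Finset.card_erase_of_mem ha,
      hK]
  obtain ⟨c, hc⟩ := Finset.card_eq_one.1 h1
  have hc' : c ∈ (K.erase a).erase b := by simp [hc]
  simp only [Finset.mem_erase] at hc'
  refine ⟨c, hc'.2.1, hc'.1, hc'.2.2, fun x hx => ?_⟩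
  by_cases hxa : x = a
  · exact Or.inl hxa
  by_cases hxb : x = b
  · exact Or.inr (Or.inl hxb)
  have : x ∈ (K.erase a).erase b := by simp [hxa, hxb, hx]
  rw [hc, Finset.mem_singleton] at this
  exact Or.inr (Or.inr this)

/-- The barycentric coordinates of a nondegenerate triangle. -/
theorem exists_barycentric {K : Finset (Pt 2)} (hK : K.card = 3)
    (hA : AffineIndependent ℝ ((↑) : K → Pt 2)) :
    ∃ l : Pt 2 → (Pt 2 →ᵃ[ℝ] ℝ), (∀ v ∈ K, ∀ w ∈ K, l v w = if v = w then 1 else 0) ∧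
      (∀ x ∈ simplex K, ∀ v ∈ K, 0 ≤ l v x ∧ l v x ≤ 1) ∧
      ∀ x, (∀ v ∈ K, 0 ≤ l v x) → x ∈ simplex K := by
  have htot : affineSpan ℝ (Set.range ((↑) : K → Pt 2)) = ⊤ := by
    rw [hA.affineSpan_eq_top_iff_card_eq_finrank_add_one]
    simp [hK]
  let b : AffineBasis K ℝ (Pt 2) := ⟨(↑), hA, htot⟩
  have hr : Set.range b = (K : Set (Pt 2)) := Subtype.range_coe
  have hconv : simplex K = {x | ∀ v, 0 ≤ b.coord v x} := by
    rw [← b.convexHull_eq_nonneg_coord, hr]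
  classical
  refine ⟨fun v => if h : v ∈ K then b.coord ⟨v, h⟩ else 0, ?_, ?_, ?_⟩
  · intro v hv w hw
    simp only [hv, dif_pos]
    have := b.coord_apply ⟨v, hv⟩ ⟨w, hw⟩
    rw [show b ⟨w, hw⟩ = w from rfl] at this
    rw [this]
    simp
  · intro x hx v hv
    rw [hconv] at hx
    simp only [hv, dif_pos]
    refine ⟨hx _, ?_⟩
    rw [← b.sum_coord_apply_eq_one x]
    exact Finset.single_le_sum (f := fun v => b.coord v x) (fun v _ => hx v) (Finset.mem_univ _)
  · intro x hx
    rw [hconv]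
    intro v
    have := hx v v.2
    simpa [v.2] using this

theorem convexHull_inner_nonneg {S : Set (Pt 2)} {ν m : Pt 2} (h : ∀ x ∈ S, 0 ≤ inner ℝ ν (x - m))
    {x : Pt 2} (hx : x ∈ convexHull ℝ S) : 0 ≤ inner ℝ ν (x - m) := by
  have hc : Convex ℝ {x : Pt 2 | 0 ≤ inner ℝ ν (x - m)} := by
    have : {x : Pt 2 | 0 ≤ inner ℝ ν (x - m)} = {x : Pt 2 | inner ℝ ν m ≤ inner ℝ ν x} := by
      ext x
      simp [inner_sub_right]
    rw [this]
    exact convex_halfSpace_ge (innerSL ℝ ν : Pt 2 →L[ℝ] ℝ).toLinearMap.isLinear _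
  exact convexHull_min (fun x hx => h x hx) hc hx

theorem mem_simplex {K : Finset (Pt 2)} {v : Pt 2} (hv : v ∈ K) : v ∈ simplex K :=
  subset_convexHull ℝ _ hv

theorem isCompact_simplex (K : Finset (Pt 2)) : IsCompact (simplex K) :=
  K.finite_toSet.isCompact_convexHull (𝕜 := ℝ)

theorem dist_le_size {K : Finset (Pt 2)} {x y : Pt 2} (hx : x ∈ simplex K) (hy : y ∈ simplex K) :
    ‖x - y‖ ≤ size K := by
  rw [← dist_eq_norm]
  exact Metric.dist_le_diam_of_mem (isCompact_simplex K).isBounded hx hy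

theorem radius_le_size {K : Finset (Pt 2)} {c : Pt 2} {r : ℝ} (hr : 0 < r)
    (hB : Metric.closedBall c r ⊆ simplex K) : r ≤ size K := by
  have h1 : c + r • EuclideanSpace.single 0 1 ∈ Metric.closedBall c r := by
    rw [mem_closedBall_iff_norm]
    simp [norm_smul, abs_of_pos hr]
  have := dist_le_size (hB h1) (hB (Metric.mem_closedBall_self hr.le))
  simpa [norm_smul, abs_of_pos hr] using this

/-- Barycentric coordinates take values in `[0, 1]` on a ball of diameter `2 * r`, so their slope is
at most `1 / (2 * r)`. -/
theorem abs_linear_le_of_closedBall {K : Finset (Pt 2)} {c : Pt 2} {r : ℝ} (hr : 0 < r)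
    (hB : Metric.closedBall c r ⊆ simplex K) {l : Pt 2 →ᵃ[ℝ] ℝ}
    (hl : ∀ x ∈ simplex K, 0 ≤ l x ∧ l x ≤ 1) (w : Pt 2) : 2 * r * |l.linear w| ≤ ‖w‖ := by
  rcases eq_or_ne w 0 with rfl | hw
  · simp
  have hw0 : 0 < ‖w‖ := norm_pos_iff.2 hw
  have key : ∀ z : Pt 2, ‖z‖ = r → 2 * l.linear z ≤ 1 := by
    intro z hz
    have h1 := hl (c + z) (hB (by simp [hz]))
    have h2 := hl (c - z) (hB (by simp [hz]))
    have e1 : l (c + z) = l.linear z + l c := by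
      have := l.map_vadd c z
      simpa [add_comm] using this
    have e2 : l (c - z) = - l.linear z + l c := by
      have := l.map_vadd c (-z)
      simpa [add_comm, sub_eq_add_neg] using this
    linarith [h1.2, h2.1]
  have hn : ‖(r / ‖w‖) • w‖ = r := by
    rw [norm_smul, Real.norm_eq_abs, abs_of_pos (by positivity), div_mul_cancel₀ _ hw0.ne']
  have k1 := key _ hn
  have k2 := key (-((r / ‖w‖) • w)) (by rw [norm_neg, hn])
  rw [map_neg] at k2
  rw [map_smul, smul_eq_mul] at k1 k2
  have k3 : 2 * (r / ‖w‖ * |l.linear w|) ≤ 1 := by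
    rcases abs_cases (l.linear w) with ⟨h, _⟩ | ⟨h, _⟩ <;> rw [h] <;> linarith
  have : 2 * (r / ‖w‖ * |l.linear w|) = (2 * r * |l.linear w|) / ‖w‖ := by ring
  rwa [this, div_le_one hw0] at k3

/-- A triangle that contains a ball of radius `r` contains the half-discs of radius `r` around the
midpoints of its sides. -/
theorem halfDisc_subset_simplex {K : Finset (Pt 2)} (hK : K.card = 3)
    (hA : AffineIndependent ℝ ((↑) : K → Pt 2)) {a b : Pt 2} (ha : a ∈ K) (hb : b ∈ K)
    (hab : a ≠ b) {ν : Pt 2} (hν : ‖ν‖ = 1) (hνab : inner ℝ ν (b - a) = 0)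
    (htow : ∀ x ∈ K, 0 ≤ inner ℝ ν (x - a)) {c : Pt 2} {r : ℝ} (hr : 0 < r)
    (hB : Metric.closedBall c r ⊆ simplex K) :
    2 * r ≤ ‖b - a‖ ∧ ∀ x, ‖x - midpoint ℝ a b‖ ≤ r → 0 ≤ inner ℝ ν (x - midpoint ℝ a b) →
      x ∈ simplex K := by
  obtain ⟨v, hva, hvb, hvK, htri⟩ := exists_eq_triple hK ha hb hab
  obtain ⟨l, hl1, hl2, hl3⟩ := exists_barycentric hK hA
  have hslope : ∀ z ∈ K, ∀ w, 2 * r * |(l z).linear w| ≤ ‖w‖ := fun z hz w =>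
    abs_linear_le_of_closedBall hr hB (fun x hx => hl2 x hx z hz) w
  have hlin : ∀ (z x y : Pt 2), (l z).linear (x - y) = l z x - l z y := fun z x y =>
    (l z).linearMap_vsub x y
  have hmid : ∀ z, l z (midpoint ℝ a b) = (l z a + l z b) / 2 := by
    intro z
    rw [(l z).map_midpoint, midpoint_eq_smul_add]
    simp
    ring
  refine ⟨?_, fun x hx hx0 => hl3 x fun z hz => ?_⟩
  · have := hslope b hb (b - a)
    rw [hlin, hl1 b hb b hb, hl1 b hb a ha, if_pos rfl, if_neg hab.symm] at this
    simpa using this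
  have hval : l z x = l z (midpoint ℝ a b) + (l z).linear (x - midpoint ℝ a b) := by
    rw [hlin]; ring
  have hhalf : ∀ z ∈ K, |(l z).linear (x - midpoint ℝ a b)| ≤ 1 / 2 := by
    intro z hz
    have h1 := (hslope z hz (x - midpoint ℝ a b)).trans hx
    by_contra h'
    nlinarith [not_le.1 h']
  rcases htri z hz with rfl | rfl | rfl
  · rw [hval, hmid, hl1 _ ha _ ha, hl1 _ ha _ hb, if_pos rfl, if_neg hab]
    linarith [(abs_le.1 (hhalf _ ha)).1]
  · rw [hval, hmid, hl1 _ hb _ ha, hl1 _ hb _ hb, if_pos rfl, if_neg hab.symm]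
    linarith [(abs_le.1 (hhalf _ hb)).1]
  · rw [hval, hmid, hl1 _ hvK _ ha, hl1 _ hvK _ hb, if_neg hva, if_neg hvb]
    -- the coordinate of the opposite vertex vanishes along the side and grows in the direction `ν`
    have hn : 0 < ‖b - a‖ := norm_pos_iff.2 (sub_ne_zero.2 hab.symm)
    set τ : Pt 2 := ‖b - a‖⁻¹ • (b - a) with hτdef
    have hτ : ‖τ‖ = 1 := by
      rw [hτdef, norm_smul, norm_inv, norm_norm, inv_mul_cancel₀ hn.ne']
    have hντ : inner ℝ ν τ = 0 := by rw [hτdef, inner_smul_right, hνab, mul_zero]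
    have hlτ : (l z).linear τ = 0 := by
      rw [hτdef, map_smul, hlin, hl1 _ hvK _ ha, hl1 _ hvK _ hb, if_neg hva, if_neg hvb]
      simp
    have hw : ∀ w : Pt 2, (l z).linear w = inner ℝ ν w * (l z).linear ν := by
      intro w
      conv_lhs => rw [eq_frame hν hτ hντ w]
      rw [map_add, map_smul, map_smul, hlτ]
      simp
    have hone : inner ℝ ν (z - a) * (l z).linear ν = 1 := by
      rw [← hw, hlin, hl1 _ hvK _ hvK, hl1 _ hvK _ ha, if_pos rfl, if_neg hva, sub_zero]
    have hpos : 0 ≤ (l z).linear ν := by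
      by_contra h'
      nlinarith [htow z hvK, not_le.1 h']
    rw [hw]
    have := mul_nonneg hx0 hpos
    linarith

theorem exists_isUnitNormal {K : Finset (Pt 2)} (hK : K.card = 3) {a b : Pt 2} (ha : a ∈ K)
    (hb : b ∈ K) (hab : a ≠ b) : ∃ ν, IsUnitNormal K {a, b} ν := by
  obtain ⟨c, hca, hcb, hcK, htri⟩ := exists_eq_triple hK ha hb hab
  have hn : 0 < ‖b - a‖ := norm_pos_iff.2 (sub_ne_zero.2 hab.symm)
  set n : Pt 2 := ‖b - a‖⁻¹ • !₂[-(b - a) 1, (b - a) 0] with hndef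
  have hn1 : ‖n‖ = 1 := by
    have e : ‖(!₂[-(b - a) 1, (b - a) 0] : Pt 2)‖ = ‖b - a‖ := by
      rw [EuclideanSpace.norm_eq, EuclideanSpace.norm_eq]
      simp [Fin.sum_univ_two]
      congr 1
      ring
    rw [hndef, norm_smul, e, norm_inv, norm_norm, inv_mul_cancel₀ hn.ne']
  have hnab : inner ℝ n (b - a) = 0 := by
    rw [hndef, inner_smul_left]
    simp [PiLp.inner_apply, Fin.sum_univ_two]
    right
    ring
  have main : ∀ ν : Pt 2, ‖ν‖ = 1 → inner ℝ ν (b - a) = 0 → 0 ≤ inner ℝ ν (c - a) →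
      IsUnitNormal K {a, b} ν := by
    intro ν h1 h2 h3
    have h2' : inner ℝ ν (a - b) = 0 := by rw [← neg_sub, inner_neg_right, h2, neg_zero]
    have h3' : inner ℝ ν (c - b) = inner ℝ ν (c - a) := by
      rw [← sub_add_sub_cancel c a b, inner_add_right, h2', add_zero]
    refine ⟨h1, ?_, ?_⟩
    · rintro x (rfl | rfl) x' (rfl | rfl) <;> simp [h2, h2']
    · rintro x (rfl | rfl) x' hx' <;> rcases htri x' hx' with rfl | rfl | rfl <;>
        simp [h2, h2', h3, h3']
  rcases le_total 0 (inner ℝ n (c - a)) with h | h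
  · exact ⟨n, main n hn1 hnab h⟩
  · refine ⟨-n, main (-n) (by rwa [norm_neg]) ?_ ?_⟩
    · rw [inner_neg_left, hnab, neg_zero]
    · rw [inner_neg_left]
      linarith

theorem isUnitNormal_unitNormal {K : Finset (Pt 2)} (hK : K.card = 3) {a b : Pt 2} (ha : a ∈ K)
    (hb : b ∈ K) (hab : a ≠ b) : IsUnitNormal K {a, b} (unitNormal K {a, b}) :=
  Classical.epsilon_spec (exists_isUnitNormal hK ha hb hab)

/-- The configuration of two triangles with a common side: `m` is the midpoint of the side, `τ` is
tangential to it, and `ℓ` is its length. The triangles lie on opposite sides of it, because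
otherwise they would overlap in a half-disc. -/
theorem Mesh.exists_side_frame {Ω : Set (Pt 2)} (𝒯 : Mesh Ω) {K L : Finset (Pt 2)}
    (hK : K ∈ 𝒯.cells) (hL : L ∈ 𝒯.cells) (hKL : ShareSide K L) {cK cL : Pt 2} {rK rL : ℝ}
    (hrK : 0 < rK) (hrL : 0 < rL) (hBK : Metric.closedBall cK rK ⊆ simplex K)
    (hBL : Metric.closedBall cL rL ⊆ simplex L) :
    ∃ (m τ : Pt 2) (ℓ : ℝ), ‖unitNormal K ((K : Set (Pt 2)) ∩ L)‖ = 1 ∧ ‖τ‖ = 1 ∧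
      inner ℝ (unitNormal K ((K : Set (Pt 2)) ∩ L)) τ = 0 ∧
      unitNormal L ((K : Set (Pt 2)) ∩ L) = - unitNormal K ((K : Set (Pt 2)) ∩ L) ∧
      2 * rK ≤ ℓ ∧ 2 * rL ≤ ℓ ∧ ℓ ≤ size K ∧ ℓ ≤ size L ∧
      (∀ x, ‖x - m‖ ≤ rK → 0 ≤ inner ℝ (unitNormal K ((K : Set (Pt 2)) ∩ L)) (x - m) →
        x ∈ simplex K) ∧
      (∀ x, ‖x - m‖ ≤ rL → inner ℝ (unitNormal K ((K : Set (Pt 2)) ∩ L)) (x - m) ≤ 0 →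
        x ∈ simplex L) ∧
      ∀ x ∈ convexHull ℝ ((K : Set (Pt 2)) ∩ L), ∃ t : ℝ, |t| ≤ ℓ ∧ x = m + t • τ := by
  obtain ⟨a, b, hab, hS⟩ := Set.ncard_eq_two.1 hKL.2
  have hconf := 𝒯.conforming K hK L hL
  rw [hS] at hconf ⊢
  have hmem : ∀ x ∈ ({a, b} : Set (Pt 2)), x ∈ K ∧ x ∈ L := fun x hx => by
    rw [← hS] at hx
    exact hx
  obtain ⟨haK, haL⟩ := hmem a (by simp)
  obtain ⟨hbK, hbL⟩ := hmem b (by simp)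
  have nK := isUnitNormal_unitNormal (𝒯.card_eq K hK) haK hbK hab
  have nL := isUnitNormal_unitNormal (𝒯.card_eq L hL) haL hbL hab
  set ν := unitNormal K {a, b}
  set ν' := unitNormal L {a, b}
  have hn : 0 < ‖b - a‖ := norm_pos_iff.2 (sub_ne_zero.2 hab.symm)
  set τ : Pt 2 := ‖b - a‖⁻¹ • (b - a) with hτdef
  have hτ : ‖τ‖ = 1 := by
    rw [hτdef, norm_smul, norm_inv, norm_norm, inv_mul_cancel₀ hn.ne']
  have hba : b - a = ‖b - a‖ • τ := by
    rw [hτdef, smul_smul, mul_inv_cancel₀ hn.ne', one_smul]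
  have o1 : inner ℝ ν (b - a) = 0 := nK.orthogonal a (by simp) b (by simp)
  have o2 : inner ℝ ν' (b - a) = 0 := nL.orthogonal a (by simp) b (by simp)
  have hντ : inner ℝ ν τ = 0 := by rw [hτdef, inner_smul_right, o1, mul_zero]
  have hντ' : inner ℝ τ ν' = 0 := by
    rw [hτdef, real_inner_comm, inner_smul_right, o2, mul_zero]
  obtain ⟨lK, dK⟩ := halfDisc_subset_simplex (𝒯.card_eq K hK) (𝒯.affineIndependent K hK) haK hbK
    hab nK.norm_eq o1 (nK.towards a (by simp)) hrK hBK
  obtain ⟨lL, dL⟩ := halfDisc_subset_simplex (𝒯.card_eq L hL) (𝒯.affineIndependent L hL) haL hbL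
    hab nL.norm_eq o2 (nL.towards a (by simp)) hrL hBL
  have hopp : ν' = -ν := by
    have e1 : ν' = inner ℝ ν ν' • ν := by
      conv_lhs => rw [eq_frame nK.norm_eq hτ hντ ν', hντ', zero_smul, add_zero]
    have e2 : |inner ℝ ν ν'| = 1 := by
      have := congrArg norm e1
      rw [norm_smul, nK.norm_eq, nL.norm_eq, mul_one, Real.norm_eq_abs] at this
      exact this.symm
    rcases (abs_eq zero_le_one).1 e2 with h | h
    · exfalso
      rw [h, one_smul] at e1
      rw [e1] at dL
      set ρ := min rK rL with hρ
      have hρ0 : 0 < ρ := lt_min hrK hrL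
      have hx1 : midpoint ℝ a b + ρ • ν - midpoint ℝ a b = ρ • ν := by abel
      have hxn : ‖ρ • ν‖ = ρ := by
        rw [norm_smul, nK.norm_eq, mul_one, Real.norm_eq_abs, abs_of_pos hρ0]
      have hxi : inner ℝ ν (ρ • ν) = ρ := by
        simp [inner_smul_right, nK.norm_eq]
      have mK := dK (midpoint ℝ a b + ρ • ν) (by rw [hx1, hxn]; exact min_le_left _ _)
        (by rw [hx1, hxi]; exact hρ0.le)
      have mL := dL (midpoint ℝ a b + ρ • ν) (by rw [hx1, hxn]; exact min_le_right _ _)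
        (by rw [hx1, hxi]; exact hρ0.le)
      have mS : midpoint ℝ a b + ρ • ν ∈ convexHull ℝ ({a, b} : Set (Pt 2)) := by
        rw [← hconf]
        exact ⟨mK, mL⟩
      have hneg := convexHull_inner_nonneg (ν := -ν) (m := midpoint ℝ a b) (fun x hx => ?_) mS
      · rw [hx1, inner_neg_left, hxi] at hneg
        linarith
      · rcases hx with rfl | rfl
        · rw [left_sub_midpoint, inner_smul_right, inner_neg_left, ← neg_sub, inner_neg_right, o1]
          simp
        · rw [right_sub_midpoint, inner_smul_right, inner_neg_left, o1]
          simp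
    · rw [h, neg_one_smul] at e1
      exact e1
  refine ⟨midpoint ℝ a b, τ, ‖b - a‖, nK.norm_eq, hτ, hντ, hopp, lK, lL,
    dist_le_size (mem_simplex hbK) (mem_simplex haK),
    dist_le_size (mem_simplex hbL) (mem_simplex haL), dK, ?_, ?_⟩
  · intro x hx hx0
    refine dL x hx ?_
    rw [hopp, inner_neg_left]
    linarith
  · intro x hx
    rw [convexHull_pair, segment_eq_image_lineMap] at hx
    obtain ⟨θ, ⟨h0, h1⟩, rfl⟩ := hx
    refine ⟨(θ - 1 / 2) * ‖b - a‖, ?_, ?_⟩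
    · rw [abs_mul, abs_of_pos hn]
      have : |θ - 1 / 2| ≤ 1 := by rw [abs_le]; constructor <;> linarith
      nlinarith
    · rw [mul_smul, ← hba, AffineMap.lineMap_apply, midpoint_eq_smul_add]
      simp
      module

/-! ### Classical derivatives of the discrete functions -/

theorem Mesh.IsPiecewisePolynomial.exists_isQuadratic {Ω : Set (Pt 2)} {𝒯 : Mesh Ω} {k : ℕ}
    {q : Pt 2 → ℝ} (hq : 𝒯.IsPiecewisePolynomial k q) (hk : k ≤ 2) {K : Finset (Pt 2)}
    (hK : K ∈ 𝒯.cells) : ∃ Q, IsQuadratic Q ∧ ∀ x ∈ simplex K, q x = Q x := by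
  obtain ⟨f, hf, h⟩ := hq.polynomial K hK
  exact ⟨_, isQuadratic_eval (hf.trans hk), h⟩

theorem Mesh.simplex_subset_closure {Ω : Set (Pt 2)} (𝒯 : Mesh Ω) {K : Finset (Pt 2)}
    (hK : K ∈ 𝒯.cells) : simplex K ⊆ closure Ω := by
  rw [← 𝒯.cover]
  exact Set.subset_biUnion_of_mem (u := fun K : Finset (Pt 2) => simplex K) hK

theorem Mesh.simplex_subset_patch {Ω : Set (Pt 2)} (𝒯 : Mesh Ω) {K L : Finset (Pt 2)}
    (hL : L ∈ 𝒯.cells) (h : L = K ∨ ShareSide K L) : simplex L ⊆ 𝒯.patch K :=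
  Set.subset_biUnion_of_mem (u := fun K : Finset (Pt 2) => simplex K)
    (show L ∈ {L ∈ (𝒯.cells : Set (Finset (Pt 2))) | L = K ∨ ShareSide K L} from ⟨hL, h⟩)

/-- The vector field with components `Y i`. -/
def ofComponents (Y : Fin 2 → Pt 2 → ℝ) (x : Pt 2) : Pt 2 := WithLp.toLp 2 fun i => Y i x

theorem contDiff_ofComponents {Y : Fin 2 → Pt 2 → ℝ} (hY : ∀ i, IsQuadratic (Y i)) {n : ℕ} :
    ContDiff ℝ n (ofComponents Y) := by
  rw [contDiff_euclidean]
  exact fun i => contDiff_infty.1 (hY i).contDiff n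

theorem eqOn_ofComponents {S : Set (Pt 2)} {y : Pt 2 → Pt 2} {Y : Fin 2 → Pt 2 → ℝ}
    (h : ∀ i, ∀ x ∈ S, y x i = Y i x) : Set.EqOn y (ofComponents Y) S := by
  intro x hx
  ext i
  exact h i x hx

theorem fderiv_ofComponents_apply {Y : Fin 2 → Pt 2 → ℝ} (hY : ∀ i, IsQuadratic (Y i))
    (x w : Pt 2) (i : Fin 2) : fderiv ℝ (ofComponents Y) x w i = fderiv ℝ (Y i) x w := by
  have h : HasFDerivAt (ofComponents Y) (fderiv ℝ (ofComponents Y) x) x :=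
    ((contDiff_ofComponents hY (n := 1)).differentiable (by norm_num) x).hasFDerivAt
  have := ((EuclideanSpace.proj i : Pt 2 →L[ℝ] ℝ).hasFDerivAt.comp x h).fderiv
  have e : (EuclideanSpace.proj i : Pt 2 →L[ℝ] ℝ) ∘ ofComponents Y = Y i := rfl
  rw [e] at this
  rw [this]
  rfl

theorem norm_le_abs_add_abs (v : Pt 2) : ‖v‖ ≤ |v 0| + |v 1| := by
  rw [EuclideanSpace.norm_eq, Fin.sum_univ_two]
  refine Real.sqrt_le_iff.2 ⟨by positivity, ?_⟩
  simp only [Real.norm_eq_abs]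
  nlinarith [abs_nonneg (v 0), abs_nonneg (v 1)]

theorem ofReal_mul_eLpNorm_top_le {E : Type*} [NormedAddCommGroup E] {f : Pt 2 → E}
    {μ : Measure (Pt 2)} {k X : ℝ} (hk : 0 < k) (h : ∀ᵐ x ∂μ, k * ‖f x‖ ≤ X) :
    ENNReal.ofReal k * eLpNorm f ∞ μ ≤ ENNReal.ofReal X := by
  have h1 : eLpNorm f ∞ μ ≤ ENNReal.ofReal (X / k) := by
    rw [eLpNorm_exponent_top]
    refine eLpNormEssSup_le_of_ae_bound ?_
    filter_upwards [h] with x hx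
    rw [le_div_iff₀ hk]
    linarith
  calc _ ≤ ENNReal.ofReal k * ENNReal.ofReal (X / k) := by gcongr
    _ = ENNReal.ofReal X := by rw [← ENNReal.ofReal_mul hk.le, mul_div_cancel₀ _ hk.ne']

theorem ae_mem_interior_simplex (K : Finset (Pt 2)) :
    ∀ᵐ x ∂(volume.restrict (simplex K)), x ∈ interior (simplex K) := by
  have hm : MeasurableSet (simplex K) := (isCompact_simplex K).isClosed.measurableSet
  have h0 : ∀ᵐ x : Pt 2, x ∉ frontier (simplex K) := by
    rw [ae_iff]
    simpa using (convex_convexHull ℝ (K : Set (Pt 2))).addHaar_frontier volume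
  filter_upwards [ae_restrict_mem hm, ae_restrict_of_ae h0] with x hx hxf
  by_contra h
  exact hxf ⟨subset_closure hx, h⟩

/-- The vector of element residuals in terms of the polynomials that represent the discrete
functions on the element. -/
theorem residual_apply {K : Finset (Pt 2)} {yh uh : Pt 2 → Pt 2} {ph Q : Pt 2 → ℝ}
    {Y U : Fin 2 → Pt 2 → ℝ} (hY : ∀ i, IsQuadratic (Y i))
    (eY : ∀ i, ∀ x ∈ simplex K, yh x i = Y i x) (eU : ∀ i, ∀ x ∈ simplex K, uh x i = U i x)
    (eQ : ∀ x ∈ simplex K, ph x = Q x) {x : Pt 2} (hx : x ∈ interior (simplex K)) (i : Fin 2) :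
    (uh x + Laplacian.laplacian yh x - gradient ph x) i =
      U i x + ∑ k, partialDeriv k (partialDeriv k (Y i)) x - partialDeriv i Q x := by
  have hn : simplex K ∈ 𝓝 x := mem_interior_iff_mem_nhds.1 hx
  have h1 : yh =ᶠ[𝓝 x] ofComponents Y := (eqOn_ofComponents eY).eventuallyEq_of_mem hn
  have h2 : ph =ᶠ[𝓝 x] Q := Set.EqOn.eventuallyEq_of_mem (fun x hx => eQ x hx) hn
  have h3 : gradient ph x = gradient Q x := by
    simp only [gradient, h2.fderiv_eq]
  have h4 : Laplacian.laplacian yh x = Laplacian.laplacian (ofComponents Y) x :=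
    (InnerProductSpace.laplacian_congr_nhds h1).eq_of_nhds
  rw [h3, h4, PiLp.sub_apply, PiLp.add_apply, gradient_apply,
    laplacian_apply (contDiff_ofComponents hY (n := 2)), eU i x (interior_subset hx)]
  rfl

theorem divergence_eq {K : Finset (Pt 2)} {yh : Pt 2 → Pt 2} {Y : Fin 2 → Pt 2 → ℝ}
    (eY : ∀ i, ∀ x ∈ simplex K, yh x i = Y i x) {x : Pt 2} (hx : x ∈ interior (simplex K)) :
    divergence yh x = ∑ k, partialDeriv k (Y k) x := by
  have hn : simplex K ∈ 𝓝 x := mem_interior_iff_mem_nhds.1 hx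
  refine Finset.sum_congr rfl fun k _ => ?_
  have h2 : (fun x => yh x k) =ᶠ[𝓝 x] Y k :=
    Set.EqOn.eventuallyEq_of_mem (fun x hx => eY k x hx) hn
  rw [gradient_apply, partialDeriv, h2.fderiv_eq, partialDeriv]

theorem fderivWithin_simplex_apply {K : Finset (Pt 2)} (hK : (interior (simplex K)).Nonempty)
    {yh : Pt 2 → Pt 2} {Y : Fin 2 → Pt 2 → ℝ} (hY : ∀ i, IsQuadratic (Y i))
    (eY : ∀ i, ∀ x ∈ simplex K, yh x i = Y i x) {x : Pt 2} (hx : x ∈ simplex K) (w : Pt 2)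
    (i : Fin 2) : fderivWithin ℝ yh (simplex K) x w i = fderiv ℝ (Y i) x w := by
  have hu : UniqueDiffWithinAt ℝ (simplex K) x :=
    uniqueDiffOn_convex (convex_convexHull ℝ _) hK x hx
  rw [fderivWithin_congr' (eqOn_ofComponents eY) hx,
    fderivWithin_eq_fderiv hu
      ((contDiff_ofComponents hY (n := 1)).differentiable (by norm_num) x),
    fderiv_ofComponents_apply hY]

theorem ball_subset_interior_simplex {K : Finset (Pt 2)} {c : Pt 2} {r : ℝ}
    (hB : Metric.closedBall c r ⊆ simplex K) : Metric.ball c r ⊆ interior (simplex K) :=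
  interior_maximal (Metric.ball_subset_closedBall.trans hB) Metric.isOpen_ball

/-! ### Efficiency -/

/-- The three contributions to the indicator, for an element `K` with the finite errors `A`, `B`,
`C` on its patch and for `s ≥ 1` bounding the shape regularity constant. -/
theorem exists_bound_indicator : ∃ M : ℝ, 0 < M ∧ ∀ (P : TrackingProblem 2) (𝒯 : Mesh P.Ω)
    (s : ℝ), 1 ≤ s → 𝒯.IsShapeRegular s → ∀ (y u : Pt 2 → Pt 2) (p : Pt 2 → ℝ),
    P.IsState y p u → MemLp u 2 (volume.restrict P.Ω) →
    ∀ (yh uh : Pt 2 → Pt 2) (ph : Pt 2 → ℝ),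
    (∀ i, 𝒯.IsPiecewisePolynomial 2 fun x => yh x i) → 𝒯.IsPiecewisePolynomial 1 ph →
    (∀ i, 𝒯.IsPiecewisePolynomial 2 fun x => uh x i) →
    ∀ K ∈ 𝒯.cells, ∀ A B C : ℝ,
    ErrorBounds P.Ω (𝒯.patch K) (fun x => y x - yh x) (fun x => p x - ph x)
      (fun x => u x - uh x) A B C →
    stateIndicator 𝒯 K yh ph uh ≤ ENNReal.ofReal (M * s ^ 5 * (A + B + size K * C)) := by
  obtain ⟨M₁, hM₁, hres⟩ := exists_bound_elementResidual
  obtain ⟨M₂, hM₂, hdiv⟩ := exists_bound_divergence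
  obtain ⟨M₃, hM₃, hjump⟩ := exists_bound_jump
  refine ⟨2 * M₁ + 2 * (M₃ * (1 + M₁)) + M₂, by positivity, ?_⟩
  intro P 𝒯 s hs hreg y u p hst hu yh uh ph pY pP pU K hK A B C he
  have hA := he.nonneg_A
  have hB := he.nonneg_B
  have hC := he.nonneg_C
  obtain ⟨cK, rK, hrK, hBK, hsK⟩ := hreg K hK
  have hrs := radius_le_size hrK hBK
  set h := size K with hh
  have hpos : 0 < h := hrK.trans_le hrs
  set E := A + B + h * C with hE
  have hE0 : 0 ≤ E := by positivity
  have hΩ : ∀ S : Set (Pt 2), IsOpen S → S ⊆ closure P.Ω → S ⊆ P.Ω := fun S hS hSΩ =>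
    (interior_maximal hSΩ hS).trans P.domain.interior_closure_subset
  have hballΩ : ∀ {L : Finset (Pt 2)} {c : Pt 2} {r : ℝ}, L ∈ 𝒯.cells →
      Metric.closedBall c r ⊆ simplex L → Metric.ball c r ⊆ P.Ω := fun hL hc =>
    hΩ _ Metric.isOpen_ball
      ((Metric.ball_subset_closedBall.trans hc).trans (𝒯.simplex_subset_closure hL))
  have hpow : ∀ n : ℕ, n ≤ 5 → s ^ n ≤ s ^ 5 := fun n hn => pow_le_pow_right₀ hs hn
  -- the polynomials on an element
  have hpoly : ∀ L ∈ 𝒯.cells, ∃ (Y U : Fin 2 → Pt 2 → ℝ) (Q : Pt 2 → ℝ),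
      (∀ i, IsQuadratic (Y i)) ∧ (∀ i, IsQuadratic (U i)) ∧ IsQuadratic Q ∧
      (∀ i, ∀ x ∈ simplex L, yh x i = Y i x) ∧ (∀ i, ∀ x ∈ simplex L, uh x i = U i x) ∧
      ∀ x ∈ simplex L, ph x = Q x := by
    intro L hL
    choose Y hY eY using fun i => (pY i).exists_isQuadratic le_rfl hL
    choose U hU eU using fun i => (pU i).exists_isQuadratic le_rfl hL
    obtain ⟨Q, hQ, eQ⟩ := pP.exists_isQuadratic (by norm_num) hL
    exact ⟨Y, U, Q, hY, hU, hQ, eY, eU, eQ⟩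
  obtain ⟨Y, U, Q, hY, hU, hQ, eY, eU, eQ⟩ := hpoly K hK
  -- the residual on an element of the patch, whose inner radius is at most `h`
  have hresL : ∀ {L : Finset (Pt 2)} {c : Pt 2} {r : ℝ}, L ∈ 𝒯.cells → (L = K ∨ ShareSide K L) →
      0 < r → r ≤ h → Metric.closedBall c r ⊆ simplex L → size L ≤ s * r →
      ∀ {Y U : Fin 2 → Pt 2 → ℝ} {Q : Pt 2 → ℝ}, (∀ i, IsQuadratic (Y i)) →
      (∀ i, IsQuadratic (U i)) → IsQuadratic Q → (∀ i, ∀ x ∈ simplex L, yh x i = Y i x) →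
      (∀ i, ∀ x ∈ simplex L, uh x i = U i x) → (∀ x ∈ simplex L, ph x = Q x) →
      ∀ (i : Fin 2), ∀ x ∈ simplex L,
        r ^ 2 * |U i x + ∑ k, partialDeriv k (partialDeriv k (Y i)) x - partialDeriv i Q x| ≤
          M₁ * s ^ 2 * E := by
    intro L c r hL hLK hr hrh hBL hsL Y U Q hY hU hQ eY eU eQ i x hx
    have hsub := Metric.ball_subset_closedBall.trans hBL
    refine (hres P y u p hst hu (𝒯.patch K) yh uh ph A B C he c r s hr hs (hballΩ hL hBL)
      (hsub.trans (𝒯.simplex_subset_patch hL hLK)) i (Y i) (U i) Q (hY i) (hU i) hQ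
      (fun x hx => eY i x (hsub hx)) (fun x hx => eU i x (hsub hx)) (fun x hx => eQ x (hsub hx)) x
      ((dist_le_size hx (hBL (Metric.mem_closedBall_self hr.le))).trans hsL)).trans ?_
    refine mul_le_mul_of_nonneg_left ?_ (by positivity)
    rw [hE]
    gcongr
  have t₁ : ENNReal.ofReal (h ^ 2) * eLpNorm (fun x => uh x + Laplacian.laplacian yh x -
      gradient ph x) ∞ (volume.restrict (simplex K)) ≤
      ENNReal.ofReal (2 * M₁ * s ^ 5 * E) := by
    refine ofReal_mul_eLpNorm_top_le (by positivity) ?_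
    filter_upwards [ae_mem_interior_simplex K] with x hx
    have hcomp : ∀ i, h ^ 2 * |(uh x + Laplacian.laplacian yh x - gradient ph x) i| ≤
        M₁ * s ^ 4 * E := by
      intro i
      rw [residual_apply hY eY eU eQ hx i]
      have := hresL hK (Or.inl rfl) hrK hrs hBK hsK hY hU hQ eY eU eQ i x (interior_subset hx)
      calc _ ≤ (s * rK) ^ 2 * |U i x + ∑ k, partialDeriv k (partialDeriv k (Y i)) x -
            partialDeriv i Q x| := by gcongr
        _ = s ^ 2 * (rK ^ 2 * |U i x + ∑ k, partialDeriv k (partialDeriv k (Y i)) x -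
            partialDeriv i Q x|) := by ring
        _ ≤ s ^ 2 * (M₁ * s ^ 2 * E) := by gcongr
        _ = _ := by ring
    calc _ ≤ h ^ 2 * (|(uh x + Laplacian.laplacian yh x - gradient ph x) 0| +
          |(uh x + Laplacian.laplacian yh x - gradient ph x) 1|) := by
          gcongr
          exact norm_le_abs_add_abs _
      _ ≤ 2 * M₁ * s ^ 4 * E := by linarith [hcomp 0, hcomp 1]
      _ ≤ 2 * M₁ * s ^ 5 * E := by gcongr 2 * M₁ * ?_ * E; exact hpow 4 (by norm_num)
  have t₃ : ENNReal.ofReal h * eLpNorm (divergence yh) ∞ (volume.restrict (simplex K)) ≤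
      ENNReal.ofReal (M₂ * s ^ 5 * E) := by
    refine ofReal_mul_eLpNorm_top_le hpos ?_
    filter_upwards [ae_mem_interior_simplex K] with x hx
    have hsub := Metric.ball_subset_closedBall.trans hBK
    have := hdiv P y u p hst (𝒯.patch K) yh uh ph A B C he cK rK s hrK hs (hballΩ hK hBK)
      (hsub.trans (𝒯.simplex_subset_patch hK (Or.inl rfl))) Y hY
      (fun k x hx => eY k x (hsub hx)) x
      ((dist_le_size (interior_subset hx) (hBK (Metric.mem_closedBall_self hrK.le))).trans hsK)
    rw [divergence_eq eY hx, Real.norm_eq_abs]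
    calc _ ≤ (s * rK) * |∑ k, partialDeriv k (Y k) x| := by gcongr
      _ = s * (rK * |∑ k, partialDeriv k (Y k) x|) := by ring
      _ ≤ s * (M₂ * s ^ 2 * A) := by gcongr
      _ = M₂ * s ^ 3 * A := by ring
      _ ≤ M₂ * s ^ 5 * E := by
          have : A ≤ E := by
            have : 0 ≤ h * C := by positivity
            linarith
          gcongr
          norm_num
  have t₂ : ENNReal.ofReal (h / 2) * jumpNorm 𝒯 K yh ≤
      ENNReal.ofReal (2 * (M₃ * (1 + M₁)) * s ^ 5 * E) := by
    rw [jumpNorm, ENNReal.mul_iSup]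
    refine iSup_le fun L => ?_
    rw [ENNReal.mul_iSup]
    refine iSup_le fun hLmem => ?_
    obtain ⟨hL, hKL⟩ : L ∈ 𝒯.cells ∧ ShareSide K L := hLmem
    obtain ⟨cL, rL, hrL, hBL, hsL⟩ := hreg L hL
    obtain ⟨m, τ, ℓ, hν, hτ, hντ, hopp, l1, l2, l3, l4, dK, dL, hparam⟩ :=
      𝒯.exists_side_frame hK hL hKL hrK hrL hBK hBL
    set ν := unitNormal K ((K : Set (Pt 2)) ∩ L) with hνdef
    obtain ⟨Y', U', Q', hY', hU', hQ', eY', eU', eQ'⟩ := hpoly L hL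
    set ρ := min rK rL with hρ
    have hρ0 : 0 < ρ := lt_min hrK hrL
    have hρK : ρ ≤ rK := min_le_left _ _
    have hρL : ρ ≤ rL := min_le_right _ _
    have hℓρ : ℓ ≤ s * ρ := by
      rcases min_choice rK rL with h' | h' <;> rw [hρ, h']
      · exact l3.trans hsK
      · exact l4.trans hsL
    have hhρ : h ≤ s ^ 2 * ρ := by
      calc h ≤ s * rK := hsK
        _ ≤ s * (s * ρ) := by
          gcongr
          linarith
        _ = s ^ 2 * ρ := by ring
    have mK : ∀ x ∈ Metric.ball m ρ, 0 ≤ inner ℝ ν (x - m) → x ∈ simplex K := fun x hx hx0 =>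
      dK x ((mem_ball_iff_norm.1 hx).le.trans hρK) hx0
    have mL : ∀ x ∈ Metric.ball m ρ, inner ℝ ν (x - m) ≤ 0 → x ∈ simplex L := fun x hx hx0 =>
      dL x ((mem_ball_iff_norm.1 hx).le.trans hρL) hx0
    have hcov : ∀ T : Set (Pt 2), simplex K ⊆ T → simplex L ⊆ T → Metric.ball m ρ ⊆ T := by
      intro T hKT hLT x hx
      rcases le_total 0 (inner ℝ ν (x - m)) with h' | h'
      · exact hKT (mK x hx h')
      · exact hLT (mL x hx h')
    have two : ∀ {f Q₁ Q₂ : Pt 2 → ℝ}, IsQuadratic Q₁ → IsQuadratic Q₂ →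
        (∀ x ∈ simplex K, f x = Q₁ x) → (∀ x ∈ simplex L, f x = Q₂ x) →
        IsTwoSided m ν ρ f Q₁ Q₂ := fun h₁ h₂ e₁ e₂ =>
      { quad₁ := h₁
        quad₂ := h₂
        eq₁ := fun x hx hx0 => e₁ x (mK x hx hx0.le)
        eq₂ := fun x hx hx0 => e₂ x (mL x hx hx0.le)
        eq_line := fun x hx hx0 => by rw [← e₁ x (mK x hx hx0.ge), ← e₂ x (mL x hx hx0.le)] }
    have hm : MeasurableSet (convexHull ℝ ((K : Set (Pt 2)) ∩ L)) :=
      ((K.finite_toSet.inter_of_left _).isCompact_convexHull (𝕜 := ℝ)).isClosed.measurableSet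
    refine ofReal_mul_eLpNorm_top_le (by positivity) ?_
    filter_upwards [ae_restrict_mem hm] with x hx
    have hxK : x ∈ simplex K := convexHull_mono Set.inter_subset_left hx
    have hxL : x ∈ simplex L := convexHull_mono Set.inter_subset_right hx
    have hcomp : ∀ i, h * |normalJump K L yh x i| ≤ 2 * (M₃ * (1 + M₁)) * s ^ 5 * E := by
      intro i
      have eJ : normalJump K L yh x i = fderiv ℝ (Y i) x ν - fderiv ℝ (Y' i) x ν := by
        rw [normalJump, PiLp.add_apply, hopp,
          fderivWithin_simplex_apply ⟨cK, ball_subset_interior_simplex hBK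
            (Metric.mem_ball_self hrK)⟩ hY eY hxK,
          fderivWithin_simplex_apply ⟨cL, ball_subset_interior_simplex hBL
            (Metric.mem_ball_self hrL)⟩ hY' eY' hxL, map_neg, ← sub_eq_add_neg]
      obtain ⟨t, ht, hxt⟩ := hparam x hx
      -- `δ` bounds the residuals on both elements
      have hδ : ∀ {r R : ℝ}, ρ ≤ r → r ^ 2 * |R| ≤ M₁ * s ^ 2 * E →
          |R| ≤ M₁ * s ^ 2 * E / ρ ^ 2 := by
        intro r R hr hR
        rw [le_div_iff₀ (by positivity), mul_comm]
        exact (mul_le_mul_of_nonneg_right (by gcongr) (abs_nonneg R)).trans hR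
      have key := hjump P y u p hst hu (𝒯.patch K) yh uh ph A B C he m ν τ ρ s hν hτ hντ hρ0 hs
        (hΩ _ Metric.isOpen_ball (hcov _ (𝒯.simplex_subset_closure hK)
          (𝒯.simplex_subset_closure hL)))
        (hcov _ (𝒯.simplex_subset_patch hK (Or.inl rfl)) (𝒯.simplex_subset_patch hL (Or.inr hKL)))
        i (Y i) (Y' i) (U i) (U' i) Q Q' (two (hY i) (hY' i) (eY i) (eY' i))
        (two (hU i) (hU' i) (eU i) (eU' i)) (two hQ hQ' eQ eQ') (M₁ * s ^ 2 * E / ρ ^ 2)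
        (fun x hx hx0 => hδ hρK (hresL hK (Or.inl rfl) hrK hrs hBK hsK hY hU hQ eY eU eQ i x
          (mK x hx hx0.le)))
        (fun x hx hx0 => hδ hρL (hresL hL (Or.inr hKL) hrL (by linarith) hBL hsL hY' hU' hQ' eY'
          eU' eQ' i x (mL x hx hx0.le)))
        (by positivity) t (ht.trans hℓρ)
      rw [← hxt, ← eJ, mul_div_cancel₀ _ (by positivity : ρ ^ 2 ≠ 0)] at key
      have hρh : ρ ≤ h := hρK.trans hrs
      calc _ ≤ s ^ 2 * ρ * |normalJump K L yh x i| := by gcongr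
        _ = s ^ 2 * (ρ * |normalJump K L yh x i|) := by ring
        _ ≤ s ^ 2 * (M₃ * s * (A + B + ρ * C + M₁ * s ^ 2 * E)) := by gcongr
        _ ≤ s ^ 2 * (M₃ * s * (s ^ 2 * E + M₁ * s ^ 2 * E)) := by
            have h1 : A + B + ρ * C ≤ E := by
              rw [hE]
              gcongr
            have h2 : E ≤ s ^ 2 * E := le_mul_of_one_le_left hE0 (one_le_pow₀ hs)
            gcongr
            exact h1.trans h2
        _ = M₃ * (1 + M₁) * s ^ 5 * E := by ring
        _ ≤ _ := by
            have : 0 ≤ M₃ * (1 + M₁) * s ^ 5 * E := by positivity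
            linarith
    calc _ ≤ h / 2 * (|normalJump K L yh x 0| + |normalJump K L yh x 1|) := by
          gcongr
          exact norm_le_abs_add_abs _
      _ ≤ _ := by linarith [hcomp 0, hcomp 1]
  rw [stateIndicator]
  refine (add_le_add (add_le_add t₁ t₂) t₃).trans (le_of_eq ?_)
  rw [← ENNReal.ofReal_add (by positivity) (by positivity),
    ← ENNReal.ofReal_add (by positivity) (by positivity)]
  congr 1
  ring

theorem errorBounds_toReal {P : TrackingProblem 2} {𝒯 : Mesh P.Ω} {y z u yh zh uh : Pt 2 → Pt 2}
    {p r ph rh : Pt 2 → ℝ} (h : P.IsOptimal y p z r u) (hd : P.IsDiscreteOptimal 𝒯 yh ph zh rh uh)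
    (N : Set (Pt 2)) (h₁ : eLpNorm (fun x => y x - yh x) ∞ (volume.restrict N) ≠ ⊤)
    (h₂ : eLpNorm (fun x => p x - ph x) 2 (volume.restrict N) ≠ ⊤)
    (h₃ : eLpNorm (fun x => u x - uh x) 2 (volume.restrict N) ≠ ⊤) :
    ErrorBounds P.Ω N (fun x => y x - yh x) (fun x => p x - ph x) (fun x => u x - uh x)
      (eLpNorm (fun x => y x - yh x) ∞ (volume.restrict N)).toReal
      (eLpNorm (fun x => p x - ph x) 2 (volume.restrict N)).toReal
      (eLpNorm (fun x => u x - uh x) 2 (volume.restrict N)).toReal := by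
  obtain ⟨hp, Dy, hy, -, -⟩ := h.state
  obtain ⟨hph, Dyh, hyh, -, -⟩ := hd.state
  refine ⟨ENNReal.toReal_nonneg, ENNReal.toReal_nonneg, ENNReal.toReal_nonneg, fun i => ?_, ?_,
    fun i => ?_, (ENNReal.ofReal_toReal h₁).ge, (ENNReal.ofReal_toReal h₂).ge,
    (ENNReal.ofReal_toReal h₃).ge⟩
  · have m1 := (hy i).memLp.1
    have m2 := (hyh.2 i).memLp.1
    rw [weightedMeasure_one] at m1 m2
    exact m1.sub m2
  · refine hp.1.sub ?_
    exact (hph.continuousOn.aestronglyMeasurable isClosed_closure.measurableSet).mono_measure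
      (Measure.restrict_mono subset_closure le_rfl)
  · have m1 := (EuclideanSpace.proj i : Pt 2 →L[ℝ] ℝ).comp_memLp' h.admissible.memLp
    have m2 := (EuclideanSpace.proj i : Pt 2 →L[ℝ] ℝ).comp_memLp' hd.admissible.2.memLp
    exact m1.1.sub m2.1

end StokesTracking

end

theorem mainTheorem5 (σ : ℝ) :
    ∃ C : ℝ≥0, 0 < C ∧
      ∀ (P : StokesTracking.TrackingProblem 2) (𝒯 : StokesTracking.Mesh P.Ω),
        𝒯.IsShapeRegular σ →
      ∀ (y : StokesTracking.Pt 2 → StokesTracking.Pt 2) (p : StokesTracking.Pt 2 → ℝ)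
        (z : StokesTracking.Pt 2 → StokesTracking.Pt 2) (r : StokesTracking.Pt 2 → ℝ)
        (u : StokesTracking.Pt 2 → StokesTracking.Pt 2),
        P.IsOptimal y p z r u →
      ∀ (yh : StokesTracking.Pt 2 → StokesTracking.Pt 2) (ph : StokesTracking.Pt 2 → ℝ)
        (zh : StokesTracking.Pt 2 → StokesTracking.Pt 2) (rh : StokesTracking.Pt 2 → ℝ)
        (uh : StokesTracking.Pt 2 → StokesTracking.Pt 2),
        P.IsDiscreteOptimal 𝒯 yh ph zh rh uh →
      ∀ K ∈ 𝒯.cells,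
        StokesTracking.stateIndicator 𝒯 K yh ph uh ≤
          C * (eLpNorm (fun x => y x - yh x) ∞ (volume.restrict (𝒯.patch K)) +
            ENNReal.ofReal (StokesTracking.size K ^ (1 - (2 : ℝ) / 2)) *
              eLpNorm (fun x => p x - ph x) 2 (volume.restrict (𝒯.patch K)) +
            ENNReal.ofReal (StokesTracking.size K ^ (2 - (2 : ℝ) / 2)) *
              eLpNorm (fun x => u x - uh x) 2 (volume.restrict (𝒯.patch K))) := by
  obtain ⟨M, hM, hbound⟩ := StokesTracking.exists_bound_indicator
  set s := max σ 1 with hs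
  have hs1 : 1 ≤ s := le_max_right _ _
  have hC : 0 < M * s ^ 5 := by positivity
  refine ⟨Real.toNNReal (M * s ^ 5), Real.toNNReal_pos.2 hC, ?_⟩
  intro P 𝒯 hreg y p z r u hopt yh ph zh rh uh hdisc K hK
  have hreg' : 𝒯.IsShapeRegular s := by
    intro L hL
    obtain ⟨c, ρ, hρ, hB, hsize⟩ := hreg L hL
    exact ⟨c, ρ, hρ, hB, hsize.trans (mul_le_mul_of_nonneg_right (le_max_left _ _) hρ.le)⟩
  have hsz : 0 < StokesTracking.size K := by
    obtain ⟨c, ρ, hρ, hB, -⟩ := hreg K hK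
    exact hρ.trans_le (StokesTracking.radius_le_size hρ hB)
  have e0 : (1 - (2 : ℝ) / 2) = 0 := by norm_num
  have e1 : (2 - (2 : ℝ) / 2) = 1 := by norm_num
  rw [e0, e1, Real.rpow_zero, Real.rpow_one, ENNReal.ofReal_one, one_mul]
  change _ ≤ ENNReal.ofReal (M * s ^ 5) * _
  have hC0 : ENNReal.ofReal (M * s ^ 5) ≠ 0 := (ENNReal.ofReal_pos.2 hC).ne'
  -- infinite errors make the right-hand side infinite
  by_cases h₁ : eLpNorm (fun x => y x - yh x) ∞ (volume.restrict (𝒯.patch K)) = ⊤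
  · rw [h₁, top_add, top_add, ENNReal.mul_top hC0]
    exact le_top
  by_cases h₂ : eLpNorm (fun x => p x - ph x) 2 (volume.restrict (𝒯.patch K)) = ⊤
  · rw [h₂, add_top, top_add, ENNReal.mul_top hC0]
    exact le_top
  by_cases h₃ : eLpNorm (fun x => u x - uh x) 2 (volume.restrict (𝒯.patch K)) = ⊤
  · rw [h₃, ENNReal.mul_top (ENNReal.ofReal_pos.2 hsz).ne', add_top, ENNReal.mul_top hC0]
    exact le_top
  have he := StokesTracking.errorBounds_toReal hopt hdisc (𝒯.patch K) h₁ h₂ h₃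
  obtain ⟨hph, Dyh, hyh, -, -⟩ := hdisc.state
  refine (hbound P 𝒯 s hs1 hreg' y u p hopt.state hopt.admissible.memLp yh uh ph hyh.1 hph
    hdisc.admissible.1 K hK _ _ _ he).trans (le_of_eq ?_)
  rw [ENNReal.ofReal_mul hC.le, ENNReal.ofReal_add (by positivity) (by positivity),
    ENNReal.ofReal_add ENNReal.toReal_nonneg ENNReal.toReal_nonneg, ENNReal.ofReal_mul hsz.le,
    ENNReal.ofReal_toReal h₁, ENNReal.ofReal_toReal h₂, ENNReal.ofReal_toReal h₃]
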